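/- **Setting.** Let $0<c_1<c_0$, $z_{int}>0$, $\mathbf k_0\in\mathbb R^2$ with $|\mathbf k_0|<1/c_0$, and $\gamma\in(1/2,1]$. Put $s_j=\sqrt{1-c_j^2|\mathbf k_0|^2}/c_j$, $\mathcal R=\frac{s_0-s_1}{s_0+s_1}$, $\mathbf x_{int}=\mathbf k_0z_{int}/s_0$, $\mathbf x_{obs}=2\mathbf k_0z_{int}/s_0$, $t_{obs}=2z_{int}/(c_0^2s_0)$, $$A_0=\frac1{(1-c_0^2|\mathbf k_0|^2)^{3/2}}\begin{pmatrix}1-c_0^2k_{0,2}^2&c_0^2k_{0,1}k_{0,2}\\ c_0^2k_{0,1}k_{0,2}&1-c_0^2k_{0,1}^2\end{pmatrix},\qquad \hat{\mathcal U}_0(\omega,\mathbf q,z)=e^{-i\omega zc_0\mathbf q^TA_0\mathbf q/2}.$$ Let $\Psi\in L^1(\mathbb R\times\mathbb R^2)$ be real-valued, such that $\hat\Psi(\omega,\mathbf k)=\iint\Psi(t,\mathbf x)e^{i\omega(t-\mathbf k\cdot\mathbf x)}\,dt\,d\mathbf x$ has compact support and vanishes for $|\omega|$ smaller than some $\omega_0>0$.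 Put $|\hat\Psi|_2^2(\omega)=\frac{\omega^2}{(2\pi)^2}\int|\hat\Psi(\omega,\mathbf q)|^2d\mathbf q$. Let $V$ be a continuous, mean-zero, stationary random field on $\mathbb R^2$ such that $V(0)$ has a probability density, and which is $\alpha$-mixing: $\alpha(r)\to0$ as $r\to\infty$, where $\alpha(r)$ is the supremum of $|\mathbb P(A\cap B)-\mathbb P(A)\mathbb P(B)|$ over nonempty $S,S'\subset\mathbb R^2$ with $d(S,S')>r$, $A\in\sigma(V(\mathbf x),\mathbf x\in S)$, $B\in\sigma(V(\mathbf x),\mathbf x\in S')$. For $\varepsilon>0$ the (leading-order) reflected wave is $$u^{\varepsilon}(t,\mathbf x)=\frac{\mathcal R}{2(2\pi)^3}\iiint e^{-i\omega(t-2s_0z_{int}-\mathbf x\cdot\mathbf k_0)/\varepsilon}e^{i\omega\mathbf q\cdot(\mathbf x-\mathbf x_{obs})/\sqrt\varepsilon}K^\varepsilon(\omega,\mathbf q,\mathbf q')\,\hat{\mathcal U}_0(\omega,\mathbf q,z_{int})\hat{\mathcal U}_0(\omega,\mathbf q',z_{int})\hat\Psi(\omega,\mathbf q')\,\omega^2\,d\mathbf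 q'\,d\mathbf q\,d\omega,$$ $$K^\varepsilon(\omega,\mathbf q,\mathbf q')=\frac{\omega^2}{\varepsilon(2\pi)^2}\int e^{i\omega(\mathbf q'-\mathbf q)\cdot(\mathbf x'-\mathbf x_{int})/\sqrt\varepsilon}\,e^{2i\omega s_0V(\mathbf x'/\varepsilon^\gamma)}\,d\mathbf x',$$ where one integrates over $\mathbf q'$, $\mathbf x'$, $\mathbf q$, $\omega$ in this order, and the integral over $\mathbf q$ is an oscillatory integral, $\int f(\mathbf q)\,d\mathbf q:=\lim_{\delta\to0^+}\int e^{-\delta|\mathbf q|^2}f(\mathbf q)\,d\mathbf q$. The speckle profile is $$S^\varepsilon(\bar s,\bar{\mathbf y},\mathbf y,\tilde s,\tilde{\mathbf y})=\varepsilon^{1-2\gamma}u^\varepsilon\big(t_{obs}+\mathbf k_0\cdot\mathbf h+\varepsilon^{2(1-\gamma)}\bar s+\varepsilon\tilde s,\ \mathbf x_{obs}+\mathbf h\big),\qquad\mathbf h=\varepsilon^{1-\gamma}\bar{\mathbf y}+\sqrt\varepsilon\,\mathbf y+\varepsilon^\gamma\tilde{\mathbf y}.$$ With $X=\mathbb R\times\mathbb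 R^2$ and $\mathbb X=\mathbb R\times\mathbb R^2\times\mathbb R^2$, the correlation function on $\mathbb X\times X\times X$ and the intensity on $\mathbb X\times X$ are $$\mathcal C^\varepsilon(\bar s,\bar{\mathbf y},\mathbf y,\tilde s_1,\tilde{\mathbf y}_1,\tilde s_2,\tilde{\mathbf y}_2)=S^\varepsilon(\bar s,\bar{\mathbf y},\mathbf y,\tilde s_1,\tilde{\mathbf y}_1)\,S^\varepsilon(\bar s,\bar{\mathbf y},\mathbf y,\tilde s_2,\tilde{\mathbf y}_2),\qquad \mathcal I^\varepsilon=|S^\varepsilon|^2 .$$ **Statement.** The integrals defining $u^\varepsilon$ exist for all $\varepsilon>0$ and all realizations of $V$. For every $\omega\ne0$ there is a finite positive measure $\mathcal A_\omega(d\mathbf p)$ on $\mathbb R^2$ that equals, as a tempered distribution in $\mathbf p$, $$\mathcal A_\omega=\int\mathbb E\big[e^{2i\omega s_0(V(\mathbf y')-V(0))}\big]e^{-i\omega\mathbf p\cdot\mathbf y'}\,d\mathbf y'.$$ Define the deterministic distribution $$\mathbf C^{ref}(\bar s,\bar{\mathbf y},\tilde s,\tilde{\mathbf y})=\frac{\mathcal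 R^2}{4(2\pi)^3}\iint e^{-i\omega(\tilde s-\mathbf p\cdot\tilde{\mathbf y})}|\hat\Psi|_2^2(\omega)\,\delta\big(\bar s-\tfrac12z_{int}c_0\mathbf p^TA_0\mathbf p\big)\,\delta\big(\bar{\mathbf y}-z_{int}c_0A_0\mathbf p\big)\,\omega^2\,\mathcal A_\omega(d\mathbf p)\,d\omega .$$ Then, as $\varepsilon\to0^+$, $$\mathcal C^\varepsilon\to\mathbf C^{ref}(\bar s,\bar{\mathbf y},\tilde s_1-\tilde s_2,\tilde{\mathbf y}_1-\tilde{\mathbf y}_2)\ \text{ in }\mathcal S'(\mathbb X\times X\times X),\qquad \mathcal I^\varepsilon\to\mathbf C^{ref}(\bar s,\bar{\mathbf y},0,0)\ \text{ in }\mathcal S'(\mathbb X\times X),$$ in probability; that is, for every complex-valued Schwartz function $\phi$ on $\mathbb X\times X\times X$ (respectively $\mathbb X\times X$) and every $\varepsilon>0$ the pairing of $\mathcal C^\varepsilon$ (respectively $\mathcal I^\varepsilon$) with $\phi$ is an absolutely convergent integral and a random variable, and as $\varepsilon\to 0^+$ it converges in probability to the pairing of the limit with $\phi$. -/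

import Mathlib

open MeasureTheory ProbabilityTheory Filter Topology
open scoped SchwartzMap

/-- The transverse plane `ℝ²` with its Euclidean structure. -/
abbrev Plane : Type := EuclideanSpace ℝ (Fin 2)

/-- `X = ℝ × ℝ²`. -/
abbrev SpX : Type := ℝ × Plane

/-- `𝕏 = ℝ × ℝ² × ℝ²`. -/
abbrev SpXX : Type := ℝ × Plane × Plane

noncomputable section

/-- `cis x = e^{ix}`. -/
def cis (x : ℝ) : ℂ := Complex.exp ((x : ℂ) * Complex.I)

/-! ### The random interface -/

section Field

variable {Ω : Type*} [MeasurableSpace Ω]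

/-- The σ-field generated by the restriction of the random field `V` to the set `S`. -/
abbrev fieldSigma (V : Plane → Ω → ℝ) (S : Set Plane) : MeasurableSpace Ω :=
  ⨆ x ∈ S, MeasurableSpace.comap (V x) inferInstance

/-- The distance `d(S, S') = inf |s - s'|` between two nonempty sets. -/
def setGap (S S' : Set Plane) : ℝ := sInf {d | ∃ s ∈ S, ∃ s' ∈ S', d = dist s s'}

/-- The `α`-mixing coefficient of a random field: the supremum of `|P(A ∩ B) - P(A) P(B)|` over all
nonempty sets `S`, `S'` at distance larger than `r` and all events `A`, `B` in the σ-fields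
generated by the field on `S` and on `S'`. -/
def alphaMixing (P : Measure Ω) (V : Plane → Ω → ℝ) (r : ℝ) : ℝ :=
  sSup {a | ∃ S S' : Set Plane, S.Nonempty ∧ S'.Nonempty ∧ r < setGap S S' ∧
    ∃ A B : Set Ω, MeasurableSet[fieldSigma V S] A ∧ MeasurableSet[fieldSigma V S'] B ∧
      a = |P.real (A ∩ B) - P.real A * P.real B|}

/-- The assumptions on the interface fluctuations: a continuous, mean-zero, stationary random field
whose one-point law has a density and which is `α`-mixing. -/
structure IsInterfaceField (P : Measure Ω) (V : Plane → Ω → ℝ) : Prop where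
  measurable : ∀ x, Measurable (V x)
  continuous : ∀ θ, Continuous fun x => V x θ
  stationary : ∀ (h : Plane) (n : ℕ) (x : Fin n → Plane),
    P.map (fun θ i => V (x i + h) θ) = P.map (fun θ i => V (x i) θ)
  integrable : Integrable (V 0) P
  mean_zero : ∫ θ, V 0 θ ∂P = 0
  density : HasPDF (V 0) P volume
  mixing : Tendsto (alphaMixing P V) atTop (𝓝 0)

/-- `A` is the scattering distribution `𝒜(v, ω, ·)` of the field `V`: a finite positive measure on
`ℝ²` which is equal, as a tempered distribution in `p`, to
`∫ 𝔼[e^{iωv(V(y) - V(0))}] e^{-iω p·y} dy`. -/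
structure IsScatteringDistribution (P : Measure Ω) (V : Plane → Ω → ℝ) (v ω : ℝ)
    (A : Measure Plane) : Prop where
  finite : IsFiniteMeasure A
  fourier : ∀ χ : 𝓢(Plane, ℂ), ∫ p, χ p ∂A =
    ∫ y : Plane, (∫ θ, cis (ω * v * (V y θ - V 0 θ)) ∂P) *
      ∫ p : Plane, cis (-(ω * inner ℝ p y)) * χ p

open scoped Classical in
/-- The scattering distribution `𝒜(v, ω, ·)`. It is unique for `ω ≠ 0`; its existence
(Bochner's theorem) is part of what is claimed below. -/
def scatteringDistribution (P : Measure Ω) (V : Plane → Ω → ℝ) (v ω : ℝ) : Measure Plane :=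
  if h : ∃ A, IsScatteringDistribution P V v ω A then h.choose else 0

end Field

/-! ### The physical parameters -/

/-- The deterministic data: wave speeds above and below the interface, depth of the interface,
lateral slowness vector of the source, source profile, and the exponent of the correlation
length `ε ^ γ` of the interface. -/
structure Setup where
  c₀ : ℝ
  c₁ : ℝ
  zint : ℝ
  k₀ : Plane
  Ψ : ℝ × Plane → ℝ
  γ : ℝ

namespace Setup

variable (D : Setup)

/-- `Ψ̂(ω, k) = ∫∫ Ψ(t, x) e^{iω(t - k·x)} dt dx`. -/
def hatΨ (ω : ℝ) (k : Plane) : ℂ :=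
  ∫ tx : ℝ × Plane, (D.Ψ tx : ℂ) * cis (ω * (tx.1 - inner ℝ k tx.2))

/-- The standing assumptions on the data. The source profile is integrable, and its transform is
compactly supported and vanishes for frequencies near zero. -/
structure Admissible : Prop where
  c₁_pos : 0 < D.c₁
  c₁_lt : D.c₁ < D.c₀
  zint_pos : 0 < D.zint
  k₀_lt : ‖D.k₀‖ < 1 / D.c₀
  γ_gt : 1 / 2 < D.γ
  γ_le : D.γ ≤ 1
  Ψ_integrable : Integrable D.Ψ
  hatΨ_support : HasCompactSupport fun ωq : ℝ × Plane => D.hatΨ ωq.1 ωq.2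
  hatΨ_low : ∃ ω₀ > 0, ∀ ω q, |ω| < ω₀ → D.hatΨ ω q = 0

/-- Vertical slowness above the interface. -/
def s₀ : ℝ := √(1 - D.c₀ ^ 2 * ‖D.k₀‖ ^ 2) / D.c₀

/-- Vertical slowness below the interface. -/
def s₁ : ℝ := √(1 - D.c₁ ^ 2 * ‖D.k₀‖ ^ 2) / D.c₁

/-- Reflection coefficient `ℛ` of the flat interface. -/
def refl : ℝ := (D.s₀ - D.s₁) / (D.s₀ + D.s₁)

/-- The lateral position at which the incident pulse hits the interface. -/
def xint : Plane := (D.zint / D.s₀) • D.k₀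

/-- The lateral position at which the specularly reflected wave is observed. -/
def xobs : Plane := (2 * D.zint / D.s₀) • D.k₀

/-- The travel time of the specularly reflected wave. -/
def tobs : ℝ := 2 * D.zint / (D.c₀ ^ 2 * D.s₀)

/-- The matrix `A₀` of the paraxial approximation. -/
def A₀ : Matrix (Fin 2) (Fin 2) ℝ :=
  (1 / (D.c₀ * D.s₀) ^ 3) •
    !![1 - D.c₀ ^ 2 * D.k₀ 1 ^ 2, D.c₀ ^ 2 * (D.k₀ 0 * D.k₀ 1);
       D.c₀ ^ 2 * (D.k₀ 0 * D.k₀ 1), 1 - D.c₀ ^ 2 * D.k₀ 0 ^ 2]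

/-- The vector `A₀ p`. -/
def A₀v (p : Plane) : Plane := Matrix.toEuclideanLin D.A₀ p

/-- `𝒰̂₀(ω, q, z) = e^{-iωz c₀ qᵀA₀q / 2}`. -/
def U₀ (ω : ℝ) (q : Plane) (z : ℝ) : ℂ :=
  cis (-(ω * z * D.c₀ * inner ℝ q (D.A₀v q) / 2))

/-- `|Ψ̂|₂²(ω) = ω² / (2π)² ∫ |Ψ̂(ω, q)|² dq`. -/
def hatΨSq (ω : ℝ) : ℝ := ω ^ 2 / (2 * Real.pi) ^ 2 * ∫ q : Plane, ‖D.hatΨ ω q‖ ^ 2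

/-! ### The reflected wave

Below, `V : Plane → ℝ` is one realization of the interface fluctuations. -/

/-- The scattering operator: the action `q ↦ ∫ K^ε(τ, ω, q, q') g(q') dq'` of the kernel
`K^ε(τ, ω, q, q') = ω² / (ε (2π)²) ∫ e^{iω(q'-q)·(x'-x_int)/√ε} e^{iωτ V(x'/ε^γ)} dx'`.
The `q'`-integral is carried out first. -/
def scatOp (V : Plane → ℝ) (ε τ ω : ℝ) (g : Plane → ℂ) (q : Plane) : ℂ :=
  ((ω ^ 2 / (ε * (2 * Real.pi) ^ 2) : ℝ) : ℂ) *
    ∫ x' : Plane, cis (ω * τ * V ((ε ^ D.γ)⁻¹ • x')) *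
      ∫ q' : Plane, cis (ω * inner ℝ (q' - q) (x' - D.xint) / √ε) * g q'

/-- Gaussian regularization `∫ e^{-δ|q|²} f(q) dq` of the integral of `f`. -/
def regInt (f : Plane → ℂ) (δ : ℝ) : ℂ :=
  ∫ q : Plane, ((Real.exp (-(δ * ‖q‖ ^ 2)) : ℝ) : ℂ) * f q

/-- The oscillatory integral `∫ f(q) dq`, as the limit of its Gaussian regularizations. -/
def oscInt (f : Plane → ℂ) : ℂ := limUnder (𝓝[>] (0 : ℝ)) (regInt f)

/-- The oscillatory integral of `f` exists. -/
def OscConverges (f : Plane → ℂ) : Prop := ∃ l, Tendsto (regInt f) (𝓝[>] (0 : ℝ)) (𝓝 l)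

/-- The integrand, as a function of `q`, of the reflected wave at frequency `ω`. -/
def reflIntegrand (V : Plane → ℝ) (ε t : ℝ) (x : Plane) (ω : ℝ) (q : Plane) : ℂ :=
  cis (-(ω * (t - 2 * D.s₀ * D.zint - inner ℝ x D.k₀) / ε)) *
    cis (ω * inner ℝ q (x - D.xobs) / √ε) * D.U₀ ω q D.zint *
    D.scatOp V ε (2 * D.s₀) ω (fun q' => D.U₀ ω q' D.zint * D.hatΨ ω q') q *
    ((ω ^ 2 : ℝ) : ℂ)

/-- The (leading order) reflected wave `u^{ε,ref}(t, x, z = 0)`: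
`ℛ / (2 (2π)³) ∫∫∫ e^{-iω(t - 2 s₀ z_int - x·k₀)/ε} e^{iω q·(x - x_obs)/√ε} K^ε(2s₀, ω, q, q')`
`𝒰̂₀(ω, q, z_int) 𝒰̂₀(ω, q', z_int) Ψ̂(ω, q') ω² dω dq' dq`. -/
def uRef (V : Plane → ℝ) (ε t : ℝ) (x : Plane) : ℂ :=
  ((D.refl / (2 * (2 * Real.pi) ^ 3) : ℝ) : ℂ) *
    ∫ ω : ℝ, oscInt (D.reflIntegrand V ε t x ω)

/-- The integrals that define the reflected wave make sense. -/
def ReflWellDefined (V : Plane → ℝ) (ε : ℝ) : Prop :=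
  ∀ (t : ℝ) (x : Plane), (∀ ω, OscConverges (D.reflIntegrand V ε t x ω)) ∧
    Integrable fun ω => oscInt (D.reflIntegrand V ε t x ω)

/-- The speckle profile `S^{ε,ref}(s̄, ȳ, y, s̃, ỹ)`, with `a = (s̄, ȳ, y)` and `b = (s̃, ỹ)`. -/
def speckle (V : Plane → ℝ) (ε : ℝ) (a : SpXX) (b : SpX) : ℂ :=
  ((ε ^ (1 - 2 * D.γ) : ℝ) : ℂ) *
    D.uRef V ε
      (D.tobs + ε ^ (1 - D.γ) * inner ℝ D.k₀ a.2.1 + √ε * inner ℝ D.k₀ a.2.2 +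
        ε ^ D.γ * inner ℝ D.k₀ b.2 + ε ^ (2 * (1 - D.γ)) * a.1 + ε * b.1)
      (D.xobs + ε ^ (1 - D.γ) • a.2.1 + √ε • a.2.2 + ε ^ D.γ • b.2)

/-- The correlation function `𝒞^{ε,ref}(s̄, ȳ, y, s̃₁, ỹ₁, s̃₂, ỹ₂)`. -/
def corr (V : Plane → ℝ) (ε : ℝ) (w : SpXX × SpX × SpX) : ℂ :=
  D.speckle V ε w.1 w.2.1 * D.speckle V ε w.1 w.2.2

/-- The intensity `ℐ^{ε,ref}(s̄, ȳ, y, s̃, ỹ)`. -/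
def intensity (V : Plane → ℝ) (ε : ℝ) (w : SpXX × SpX) : ℝ := ‖D.speckle V ε w.1 w.2‖ ^ 2

/-- The pairing `⟨𝒞^{ε,ref}, φ⟩`. -/
def corrPairing (V : Plane → ℝ) (ε : ℝ) (φ : 𝓢(SpXX × SpX × SpX, ℂ)) : ℂ :=
  ∫ w, D.corr V ε w * φ w

/-- The pairing `⟨ℐ^{ε,ref}, φ⟩`. -/
def intensityPairing (V : Plane → ℝ) (ε : ℝ) (φ : 𝓢(SpXX × SpX, ℂ)) : ℂ :=
  ∫ w, (D.intensity V ε w : ℂ) * φ w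

/-! ### The deterministic limit -/

/-- The position `s̄ = z_int c₀ pᵀA₀p / 2` of the Dirac mass in the variable `s̄`. -/
def sDirac (p : Plane) : ℝ := D.zint * D.c₀ * inner ℝ p (D.A₀v p) / 2

/-- The position `ȳ = z_int c₀ A₀ p` of the Dirac mass in the variable `ȳ`. -/
def yDirac (p : Plane) : Plane := (D.zint * D.c₀) • D.A₀v p

variable {Ω : Type*} [MeasurableSpace Ω]

/-- The pairing of `(s̄, ȳ, y, s̃₁, ỹ₁, s̃₂, ỹ₂) ↦ 𝐂^{ref}(s̄, ȳ, s̃₁ - s̃₂, ỹ₁ - ỹ₂)` with `φ`, where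
`𝐂^{ref}(s̄, ȳ, s̃, ỹ) = ℛ² / (4 (2π)³) ∫∫ e^{-iω(s̃ - p·ỹ)} |Ψ̂|₂²(ω) δ(s̄ - z_int c₀ pᵀA₀p / 2)`
`δ(ȳ - z_int c₀ A₀ p) ω² 𝒜(2s₀, ω, dp) dω`.
The variable `m = (y, (s̃₁, ỹ₁), (s̃₂, ỹ₂))` collects those not fixed by the Dirac masses. -/
def corrLimit (P : Measure Ω) (V : Plane → Ω → ℝ) (φ : 𝓢(SpXX × SpX × SpX, ℂ)) : ℂ :=
  ((D.refl ^ 2 / (4 * (2 * Real.pi) ^ 3) : ℝ) : ℂ) *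
    ∫ ω : ℝ, ((ω ^ 2 * D.hatΨSq ω : ℝ) : ℂ) *
      ∫ p, (∫ m : Plane × SpX × SpX,
          cis (-(ω * ((m.2.1.1 - m.2.2.1) - inner ℝ p (m.2.1.2 - m.2.2.2)))) *
            φ ((D.sDirac p, D.yDirac p, m.1), m.2.1, m.2.2))
        ∂(scatteringDistribution P V (2 * D.s₀) ω)

/-- The pairing of `(s̄, ȳ, y, s̃, ỹ) ↦ 𝐂^{ref}(s̄, ȳ, 0, 0)` with `φ`. -/
def intensityLimit (P : Measure Ω) (V : Plane → Ω → ℝ) (φ : 𝓢(SpXX × SpX, ℂ)) : ℂ :=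
  ((D.refl ^ 2 / (4 * (2 * Real.pi) ^ 3) : ℝ) : ℂ) *
    ∫ ω : ℝ, ((ω ^ 2 * D.hatΨSq ω : ℝ) : ℂ) *
      ∫ p, (∫ m : Plane × SpX, φ ((D.sDirac p, D.yDirac p, m.1), m.2))
        ∂(scatteringDistribution P V (2 * D.s₀) ω)

end Setup

end

/-!
The proof rewrites every pairing of the speckle profile with a test function as an integral of a
purely random factor of modulus one against a deterministic amplitude, and then averages.

*The wave.* The `q'`-integral turns the source into the field `incident` at the interface, and the
oscillatory `q`-integral is a Fresnel integral in the positive definite matrix `z_int c₀ A₀`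
(`paraxial`), which can be evaluated. Hence the reflected wave is an absolutely convergent integral
over frequencies `ω` and interface points `X` (`uRef_eq`); in the variables of the speckle profile
everything depends on the scale parameter `η = ε ^ (γ - 1/2) → 0` only (`speckle_eq`), up to the
position of the specular point, which stationarity makes irrelevant. The profile is real, so that a
product of two of them is a product of one with the conjugate of the other.

*Rescaling.* A product of two profiles, paired with a test function, is an integral over two
frequencies and two interface points. The test function forces `ω₁ - ω₂ = η² ν` and
`ω₁ X₁ - ω₂ X₂ = η ξ` with `ν`, `ξ` of order one: in these variables the powers of `η` cancel
(`speckleMoment_eq`), and integration by parts in `s̄` and in `ȳ` bounds the remaining kernel, by an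
integrable function of `ν` and `ξ`, uniformly in `η` (`exists_norm_kernel_le`). The interface points
then are at distance of order `η` from each other, that is, of the order of the correlation length
in units of which the field `V` varies, while distinct pairs of interface points separate.

*Averaging.* By stationarity and path continuity the mean of the random factor converges to
`𝔼 e^{iωv(V(ξ/ω) - V(0))}`, with `v = 2 s₀`; by mixing, the factors at two distinct points become
uncorrelated. Dominated convergence gives convergence of the pairings in mean square
(`tendsto_meanSquare_integral`), hence in probability.

*The limit.* Fourier inversion in `ν` produces the Dirac mass in `s̄` (`integral_cis_sub_eq`), the
change of variables `ȳ = z_int c₀ A₀ p` the one in `ȳ`, and the remaining integral over `ξ = ω y'`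
is, by Bochner's theorem, an integral against the scattering distribution
(`integral_scatteringDistribution`). The total mass follows from Plancherel's formula
(`integral_norm_sq_source`).

Bochner's theorem is proved in the form needed here: the field correlation `ψ`, multiplied by a
Gaussian, has a nonnegative integrable Fourier transform, since it is positive definite; it is
therefore a characteristic function, and Lévy's continuity theorem passes to the limit of a constant
Gaussian factor.
-/

open scoped LineDeriv ComplexConjugate

set_option linter.unusedSectionVars false

/-! ### The unit complex exponential -/

@[simp] lemma cis_zero : cis 0 = 1 := by simp [cis]

lemma cis_add (x y : ℝ) : cis (x + y) = cis x * cis y := by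
  simp [cis, add_mul, Complex.exp_add]

@[simp] lemma norm_cis (x : ℝ) : ‖cis x‖ = 1 := Complex.norm_exp_ofReal_mul_I x

lemma conj_cis (x : ℝ) : conj (cis x) = cis (-x) := by
  simp [cis, ← Complex.exp_conj]

@[fun_prop] lemma continuous_cis : Continuous cis := by unfold cis; fun_prop

@[fun_prop] lemma measurable_cis : Measurable cis := continuous_cis.measurable

lemma hasDerivAt_cis (x : ℝ) : HasDerivAt cis (Complex.I * cis x) x := by
  have h : HasDerivAt (fun x : ℝ => (x : ℂ) * Complex.I) (1 * Complex.I) x :=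
    (Complex.ofRealCLM.hasDerivAt (x := x)).mul_const _
  have h2 : HasDerivAt cis (cis x * (1 * Complex.I)) x := h.cexp
  rwa [one_mul, mul_comm] at h2

lemma integrable_mul_cis {α : Type*} [TopologicalSpace α] [MeasurableSpace α]
    [OpensMeasurableSpace α] {μ : Measure α} {f : α → ℂ} (hf : Integrable f μ) {p : α → ℝ}
    (hp : Continuous p) : Integrable (fun w => f w * cis (p w)) μ :=
  hf.mul_bdd (c := 1) (continuous_cis.measurable.comp hp.measurable).aestronglyMeasurable (by simp)

/-! ### Oscillatory integrals with quadratic phases -/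

section Oscillatory

variable {E : Type*} [NormedAddCommGroup E] [NormedSpace ℝ E]

lemma HasLineDerivAt.cis {p : E → ℝ} {p' : ℝ} {w e : E} (h : HasLineDerivAt ℝ p p' w e) :
    HasLineDerivAt ℝ (fun w => cis (p w)) (Complex.I * (p' : ℂ) * cis (p w)) w e := by
  have h1 : HasDerivAt (fun t : ℝ => p (w + t • e)) p' 0 := h
  have h2 := (hasDerivAt_cis (p (w + (0 : ℝ) • e))).scomp (0 : ℝ) h1
  have : HasDerivAt (fun t : ℝ => _root_.cis (p (w + t • e)))
      (Complex.I * (p' : ℂ) * _root_.cis (p w)) 0 := by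
    refine h2.congr_deriv ?_
    simp only [zero_smul, add_zero, Complex.real_smul]
    ring
  exact this

variable [FiniteDimensional ℝ E] [MeasurableSpace E] [BorelSpace E] {μ : Measure E}
  [μ.IsAddHaarMeasure]

/-- Multiplication of a Schwartz function by a linear functional. -/
noncomputable def mulCoord (l : E →L[ℝ] ℝ) (φ : 𝓢(E, ℂ)) : 𝓢(E, ℂ) := SchwartzMap.smulLeftCLM ℂ l φ

lemma mulCoord_apply (l : E →L[ℝ] ℝ) (φ : 𝓢(E, ℂ)) (w : E) :
    mulCoord l φ w = (l w : ℂ) * φ w := by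
  rw [mulCoord, SchwartzMap.smulLeftCLM_apply_apply l.hasTemperateGrowth]; simp

/-- Integration by parts against an oscillating factor whose phase has an affine derivative
`lam + l w` in the direction `e`. -/
lemma integral_mul_cis_by_parts (φ : 𝓢(E, ℂ)) {p : E → ℝ} (hp : Continuous p) {e : E} {lam : ℝ}
    {l : E →L[ℝ] ℝ} (h : ∀ w, HasLineDerivAt ℝ p (lam + l w) w e) :
    (lam : ℂ) * ∫ w, φ w * cis (p w) ∂μ =
      Complex.I * ∫ w, (∂_{e} φ) w * cis (p w) ∂μ - ∫ w, mulCoord l φ w * cis (p w) ∂μ := by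
  have i0 := integrable_mul_cis (φ.integrable (μ := μ)) hp
  have i1 := integrable_mul_cis ((∂_{e} φ).integrable (μ := μ)) hp
  have i2 := integrable_mul_cis ((mulCoord l φ).integrable (μ := μ)) hp
  have i3 : Integrable (fun w => φ w * (Complex.I * ((lam + l w : ℝ) : ℂ) * cis (p w))) μ := by
    refine ((i0.const_mul (Complex.I * lam)).add (i2.const_mul Complex.I)).congr
      (Eventually.of_forall fun w => ?_)
    simp [mulCoord_apply]; ring
  have key := integral_bilinear_hasLineDerivAt_right_eq_neg_left_of_integrable (μ := μ)
    (B := ContinuousLinearMap.mul ℝ ℂ) (f := φ) (f' := fun w => (∂_{e} φ) w)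
    (g := fun w => cis (p w)) (g' := fun w => Complex.I * ((lam + l w : ℝ) : ℂ) * cis (p w)) (v := e)
    (by simpa using i1) (by simpa using i3) (by simpa using i0)
    (fun w _ => by
      have := (φ.differentiableAt (x := w)).lineDifferentiableAt.hasLineDerivAt (v := e)
      rwa [← SchwartzMap.lineDerivOp_apply] at this)
    (fun w _ => (h w).cis)
  simp only [ContinuousLinearMap.mul_apply'] at key
  have e1 : ∫ w, φ w * (Complex.I * ((lam + l w : ℝ) : ℂ) * cis (p w)) ∂μ =
      Complex.I * lam * ∫ w, φ w * cis (p w) ∂μ +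
        Complex.I * ∫ w, mulCoord l φ w * cis (p w) ∂μ := by
    rw [← integral_const_mul, ← integral_const_mul, ← integral_add (i0.const_mul _)
      (i2.const_mul _)]
    congr 1; ext w; simp [mulCoord_apply]; ring
  rw [e1] at key
  linear_combination (-Complex.I) * key + (lam * ∫ w, φ w * cis (p w) ∂μ +
    ∫ w, mulCoord l φ w * cis (p w) ∂μ) * Complex.I_mul_I

/-- One step of the non-stationary phase argument, for a family `p i` of phases and weights `W i`.
If `W i * N i * |∫ φ e^{i p}|` is bounded in `i` for every Schwartz function `φ`, and if the
derivative of the phase in the direction `e` is `lam i + l i w` with `‖l i‖ ≤ C₀ N i`, then one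
power of `lam i` is gained. -/
lemma bounded_oscillatory_step {ι : Type*} {p : ι → E → ℝ} (hp : ∀ i, Continuous (p i)) (e : E)
    {lam N W : ι → ℝ} {l : ι → E →L[ℝ] ℝ} {C₀ : ℝ}
    (h : ∀ i w, HasLineDerivAt ℝ (p i) (lam i + l i w) w e)
    (hl : ∀ i, ‖l i‖ ≤ C₀ * N i) (hN : ∀ i, 1 ≤ N i) (hW : ∀ i, 0 ≤ W i)
    (H : ∀ φ : 𝓢(E, ℂ), ∃ C, ∀ i, W i * N i * ‖∫ w, φ w * cis (p i w) ∂μ‖ ≤ C) (φ : 𝓢(E, ℂ)) :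
    ∃ C, ∀ i, W i * |lam i| * ‖∫ w, φ w * cis (p i w) ∂μ‖ ≤ C := by
  let b := Module.finBasis ℝ E
  let co : Fin (Module.finrank ℝ E) → E →L[ℝ] ℝ := fun j => LinearMap.toContinuousLinearMap (b.coord j)
  obtain ⟨C1, h1⟩ := H (∂_{e} φ)
  choose C2 h2 using fun j => H (mulCoord (co j) φ)
  refine ⟨C1 + ∑ j, C₀ * ‖b j‖ * C2 j, fun i => ?_⟩
  set K : 𝓢(E, ℂ) → ℂ := fun φ => ∫ w, φ w * cis (p i w) ∂μ with hK
  have hsum : K (mulCoord (l i) φ) = ∑ j, (l i (b j) : ℂ) * K (mulCoord (co j) φ) := by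
    simp only [hK, ← integral_const_mul]
    rw [← integral_finsetSum _ fun j _ => ((integrable_mul_cis
      ((mulCoord (co j) φ).integrable (μ := μ)) (hp i)).const_mul _)]
    congr 1; ext w
    have : l i w = ∑ j, l i (b j) * co j w := by
      conv_lhs => rw [← b.sum_repr w]
      rw [map_sum]
      exact Finset.sum_congr rfl fun j _ => by simp [co, mul_comm]
    simp only [mulCoord_apply]
    rw [this]; push_cast
    rw [Finset.sum_mul, Finset.sum_mul]
    exact Finset.sum_congr rfl fun j _ => by ring
  have hbp : (lam i : ℂ) * K φ = Complex.I * K (∂_{e} φ) - K (mulCoord (l i) φ) :=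
    integral_mul_cis_by_parts φ (hp i) (h i)
  have hn : |lam i| * ‖K φ‖ ≤ ‖K (∂_{e} φ)‖ + ∑ j, C₀ * N i * ‖b j‖ * ‖K (mulCoord (co j) φ)‖ := by
    have : |lam i| * ‖K φ‖ = ‖(lam i : ℂ) * K φ‖ := by simp
    rw [this, hbp]
    refine (norm_sub_le _ _).trans (add_le_add (by simp) ?_)
    rw [hsum]
    refine (norm_sum_le _ _).trans (Finset.sum_le_sum fun j _ => ?_)
    rw [norm_mul, Complex.norm_real]
    gcongr
    exact ((l i).le_opNorm _).trans (by gcongr; exact hl i)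
  have hWN : 0 ≤ W i * N i := mul_nonneg (hW i) (by linarith [hN i])
  have hC0 : 0 ≤ C₀ := by
    by_contra hc
    have := (norm_nonneg _).trans (hl i)
    nlinarith [hN i]
  calc W i * |lam i| * ‖K φ‖ ≤ W i * (‖K (∂_{e} φ)‖ +
        ∑ j, C₀ * N i * ‖b j‖ * ‖K (mulCoord (co j) φ)‖) := by
        rw [mul_assoc]; exact mul_le_mul_of_nonneg_left hn (hW i)
    _ = W i * ‖K (∂_{e} φ)‖ + ∑ j, C₀ * ‖b j‖ * (W i * N i * ‖K (mulCoord (co j) φ)‖) := by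
        rw [mul_add, Finset.mul_sum]
        congr 1
        exact Finset.sum_congr rfl fun j _ => by ring
    _ ≤ C1 + ∑ j, C₀ * ‖b j‖ * C2 j := by
        refine add_le_add (le_trans ?_ (h1 i)) (Finset.sum_le_sum fun j _ => ?_)
        · exact mul_le_mul_of_nonneg_right
            (le_mul_of_one_le_right (hW i) (hN i)) (norm_nonneg _)
        · exact mul_le_mul_of_nonneg_left (h2 j i) (by positivity)

lemma norm_oscillatory_le (φ : 𝓢(E, ℂ)) :
    ∃ C, ∀ p : E → ℝ, ‖∫ w, φ w * cis (p w) ∂μ‖ ≤ C :=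
  ⟨∫ w, ‖φ w‖ ∂μ, fun p => (norm_integral_le_integral_norm _).trans_eq (by simp)⟩

/-- Passing from the coordinates of a vector to its norm in weighted bounds. -/
lemma bounded_norm_of_bounded_coords {ι n : Type*} [Fintype n] {x : ι → EuclideanSpace ℝ n}
    {F : ι → ℝ} (hF : ∀ i, 0 ≤ F i) (h : ∀ j, ∃ C, ∀ i, |x i j| * F i ≤ C) :
    ∃ C, ∀ i, ‖x i‖ * F i ≤ C := by
  choose C hC using h
  refine ⟨∑ j, C j, fun i => ?_⟩
  have : ‖x i‖ ≤ ∑ j, |x i j| := by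
    rw [EuclideanSpace.norm_eq]
    refine Real.sqrt_le_iff.2 ⟨Finset.sum_nonneg fun _ _ => abs_nonneg _, ?_⟩
    exact Finset.sum_sq_le_sq_sum_of_nonneg (fun _ _ => norm_nonneg _)
  calc ‖x i‖ * F i ≤ (∑ j, |x i j|) * F i := mul_le_mul_of_nonneg_right this (hF i)
    _ ≤ _ := by rw [Finset.sum_mul]; exact Finset.sum_le_sum fun j _ => hC j i

end Oscillatory

/-! ### Fourier inversion and Plancherel's identity -/

section Fourier

variable {H : Type*} [NormedAddCommGroup H] [InnerProductSpace ℝ H] [FiniteDimensional ℝ H]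
  [MeasurableSpace H] [BorelSpace H]

lemma fourier_eq_integral_cis (f : H → ℂ) (k : H) :
    FourierTransform.fourier f k =
      ∫ x, cis (-inner ℝ ((2 * Real.pi) • k) x) * f x := by
  rw [Real.fourier_eq']
  congr 1; ext x
  simp [cis, inner_smul_left, real_inner_comm x k]

/-- Fourier inversion, for the normalization `f̂(k) = ∫ e^{-i k·x} f(x) dx`. -/
lemma fourier_inversion_cis {f : H → ℂ} (hc : Continuous f) (hf : Integrable f)
    (h : Integrable fun k : H => ∫ x, cis (-inner ℝ k x) * f x) (x : H) :
    ∫ k : H, cis (inner ℝ k x) * ∫ x', cis (-inner ℝ k x') * f x' =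
      (((2 * Real.pi) ^ Module.finrank ℝ H : ℝ) : ℂ) * f x := by
  have hpi : (2 * Real.pi) ≠ 0 := by positivity
  have hF : Integrable (FourierTransform.fourier f) := by
    have := h.comp_smul hpi
    refine this.congr (Eventually.of_forall fun k => ?_)
    simp only [fourier_eq_integral_cis]
  have h1 := congrFun (hc.fourierInv_fourier_eq hf hF) x
  rw [Real.fourierInv_eq'] at h1
  rw [← h1]
  have h2 := Measure.integral_comp_smul (volume : Measure H)
    (fun k : H => cis (inner ℝ k x) * ∫ x', cis (-inner ℝ k x') * f x') (2 * Real.pi)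
  have h3 : ∫ v : H, Complex.exp (↑(2 * Real.pi * inner ℝ v x) * Complex.I) •
      FourierTransform.fourier f v =
      ∫ v : H, cis (inner ℝ ((2 * Real.pi) • v) x) *
        ∫ x', cis (-inner ℝ ((2 * Real.pi) • v) x') * f x' := by
    congr 1; ext v
    rw [fourier_eq_integral_cis]
    simp [cis, inner_smul_left]
  rw [h3, h2, abs_of_nonneg (by positivity), Complex.real_smul, ← mul_assoc, ← Complex.ofReal_mul,
    mul_inv_cancel₀ (by positivity)]
  simp

/-- Plancherel's identity for an integrable function with an integrable Fourier transform. -/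
lemma plancherel_cis {f : H → ℂ} (hc : Continuous f) (hf : Integrable f)
    (h : Integrable fun k : H => ∫ x, cis (-inner ℝ k x) * f x) :
    ∫ k : H, ‖∫ x, cis (-inner ℝ k x) * f x‖ ^ 2 =
      (2 * Real.pi) ^ Module.finrank ℝ H * ∫ x, ‖f x‖ ^ 2 := by
  set g : H → ℂ := fun k => ∫ x, cis (-inner ℝ k x) * f x with hg
  have hprod : Integrable (fun z : H × H => conj (g z.1) * (cis (-inner ℝ z.1 z.2) * f z.2))
      (volume.prod volume) := by
    have h1 : Integrable (fun z : H × H => conj (g z.1) * f z.2) (volume.prod volume) :=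
      (Complex.conjCLE.integrable_comp_iff.2 h).mul_prod hf
    refine (h1.bdd_mul (c := 1) (f := fun z : H × H => cis (-inner ℝ z.1 z.2))
      (Continuous.aestronglyMeasurable (by fun_prop)) (by simp)).congr
      (Eventually.of_forall fun z => ?_)
    simp only; ring
  have key : ∫ k : H, conj (g k) * g k = ∫ x, (∫ k : H, conj (g k) * (cis (-inner ℝ k x) * f x)) := by
    rw [← integral_integral_swap hprod]
    congr 1; ext k
    rw [integral_const_mul]
  have h2 : ∀ x, ∫ k : H, conj (g k) * (cis (-inner ℝ k x) * f x) =
      (((2 * Real.pi) ^ Module.finrank ℝ H : ℝ) : ℂ) * ((‖f x‖ ^ 2 : ℝ) : ℂ) := by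
    intro x
    have := congrArg conj (fourier_inversion_cis hc hf h x)
    rw [← integral_conj] at this
    simp only [map_mul, conj_cis, Complex.conj_ofReal] at this
    calc _ = ∫ k : H, f x * (cis (-inner ℝ k x) * conj (g k)) := by congr 1; ext k; ring
      _ = f x * ((((2 * Real.pi) ^ Module.finrank ℝ H : ℝ) : ℂ) * conj (f x)) := by
        rw [integral_const_mul, ← this]
      _ = _ := by
        have := Complex.mul_conj' (f x)
        push_cast
        linear_combination ((2 * Real.pi : ℂ) ^ Module.finrank ℝ H) * this
  simp only [h2] at key
  rw [integral_const_mul, integral_complex_ofReal] at key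
  have h3 : ∫ k : H, conj (g k) * g k = ((∫ k : H, ‖g k‖ ^ 2 : ℝ) : ℂ) := by
    refine Eq.trans ?_ integral_complex_ofReal
    congr 1; ext k
    simp [Complex.conj_mul']
  rw [h3, ← Complex.ofReal_mul] at key
  exact_mod_cast key

end Fourier

/-! ### Probability measures with a prescribed characteristic function -/

section CharFun

variable {H : Type*} [NormedAddCommGroup H] [InnerProductSpace ℝ H] [FiniteDimensional ℝ H]
  [MeasurableSpace H] [BorelSpace H]

lemma charFun_eq_integral_cis (μ : Measure H) (t : H) : charFun μ t = ∫ x, cis (inner ℝ x t) ∂μ := by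
  simp [charFun_apply, cis]

/-- A pointwise limit of characteristic functions which is continuous at `0` is a characteristic
function: tightness and Prokhorov's theorem provide a limit point. -/
lemma exists_charFun_eq_of_tendsto (μ : ℕ → ProbabilityMeasure H) {f : H → ℂ}
    (hf : ContinuousAt f 0) (h : ∀ t, Tendsto (fun n => charFun (μ n : Measure H) t) atTop (𝓝 (f t))) :
    ∃ μ₀ : Measure H, IsProbabilityMeasure μ₀ ∧ ∀ t, charFun μ₀ t = f t := by
  have ht : IsTightMeasureSet (Set.range fun n => (μ n : Measure H)) :=
    isTightMeasureSet_of_tendsto_charFun hf h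
  have hc : IsCompact (closure (Set.range μ)) := by
    refine isCompact_closure_of_isTightMeasureSet ?_
    convert ht using 1
    ext ν; simp
  obtain ⟨μ₀, -, φ, hφ, hlim⟩ := hc.isSeqCompact (x := μ) fun n => subset_closure ⟨n, rfl⟩
  refine ⟨μ₀, inferInstance, fun t => ?_⟩
  have h1 := (ProbabilityMeasure.tendsto_iff_tendsto_charFun.1 hlim) t
  exact tendsto_nhds_unique h1 ((h t).comp hφ.tendsto_atTop)

lemma continuous_fourier_cis {f : H → ℂ} (hf : Integrable f) :
    Continuous fun k : H => ∫ x, cis (-inner ℝ k x) * f x := by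
  refine continuous_of_dominated (bound := fun x => ‖f x‖) (fun k => ?_)
    (fun k => Eventually.of_forall fun x => by simp) hf.norm
    (Eventually.of_forall fun x => by fun_prop)
  exact (Continuous.aestronglyMeasurable (by fun_prop)).mul hf.aestronglyMeasurable

lemma integral_gaussian_mul_cis {t : ℝ} (ht : 0 < t) (x : H) :
    ‖∫ k : H, (Real.exp (-t * ‖k‖ ^ 2) : ℂ) * cis (-inner ℝ k x)‖ =
      (Real.pi / t) ^ ((Module.finrank ℝ H : ℝ) / 2) * Real.exp (-(1 / (4 * t)) * ‖x‖ ^ 2) := by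
  have h := GaussianFourier.integral_cexp_neg_mul_sq_norm_add (V := H) (b := (t : ℂ)) (by simpa)
    (-Complex.I) x
  have e : ∫ k : H, (Real.exp (-t * ‖k‖ ^ 2) : ℂ) * cis (-inner ℝ k x) =
      ∫ v : H, Complex.exp (-(t : ℂ) * (‖v‖ : ℂ) ^ 2 + -Complex.I * (inner ℝ x v : ℂ)) := by
    congr 1; ext k
    rw [Complex.exp_add, cis, real_inner_comm]
    push_cast
    congr 2; ring
  rw [e, h, norm_mul, Complex.norm_exp]
  congr 1
  · rw [← Complex.ofReal_div, Complex.norm_cpow_eq_rpow_re_of_pos (by positivity)]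
    congr 1
    rw [show ((Module.finrank ℝ H : ℂ) / 2) = ((Module.finrank ℝ H / 2 : ℝ) : ℂ) by push_cast; rfl,
      Complex.ofReal_re]
  · congr 1
    have : (-Complex.I) ^ 2 * (‖x‖ : ℂ) ^ 2 / (4 * (t : ℂ)) =
        ((-(1 / (4 * t)) * ‖x‖ ^ 2 : ℝ) : ℂ) := by
      push_cast; rw [neg_sq, Complex.I_sq]; field_simp
    rw [this, Complex.ofReal_re]

/-- A bounded integrable function with a nonnegative Fourier transform has an integrable Fourier
transform. -/
lemma integrable_fourier_of_nonneg {f : H → ℂ} (hf : Integrable f) {B : ℝ} (hB : ∀ x, ‖f x‖ ≤ B)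
    {g : H → ℝ} (hg : ∀ k : H, ∫ x, cis (-inner ℝ k x) * f x = (g k : ℂ)) (hg0 : ∀ k, 0 ≤ g k) :
    Integrable g := by
  have hgc : Continuous g := by
    have := Complex.continuous_re.comp (continuous_fourier_cis hf)
    refine this.congr fun k => ?_
    simp [hg k]
  have hgb : ∀ k, ‖g k‖ ≤ ∫ x, ‖f x‖ := fun k => by
    rw [← Complex.norm_real, ← hg k]
    exact (norm_integral_le_integral_norm _).trans_eq (by simp)
  set d : ℝ := (Module.finrank ℝ H : ℝ) / 2 with hd
  have hgi : ∀ t : ℝ, 0 < t → Integrable fun k : H => Real.exp (-t * ‖k‖ ^ 2) * g k := fun t ht =>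
    ((GaussianFourier.integrable_cexp_neg_mul_sq_norm_add (V := H) (b := (t : ℂ)) (by simpa) 0
      0).norm.congr (Eventually.of_forall fun k => by
        simp only [Complex.norm_exp]; congr 1; simp [← Complex.ofReal_pow])).mul_bdd
      hgc.aestronglyMeasurable (Eventually.of_forall hgb)
  -- regularized by a Gaussian, the integral of the transform is bounded by the supremum of `f`
  have hbd : ∀ t : ℝ, 0 < t → ∫ k : H, Real.exp (-t * ‖k‖ ^ 2) * g k ≤
      B * ((Real.pi / t) ^ d * (Real.pi / (1 / (4 * t))) ^ d) := by
    intro t ht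
    have hG : Integrable fun k : H => (Real.exp (-t * ‖k‖ ^ 2) : ℂ) :=
      (GaussianFourier.integrable_cexp_neg_mul_sq_norm_add (V := H) (b := (t : ℂ)) (by simpa) 0
        0).congr (Eventually.of_forall fun k => by simp)
    have hsw : Integrable (fun z : H × H =>
        (Real.exp (-t * ‖z.1‖ ^ 2) : ℂ) * (cis (-inner ℝ z.1 z.2) * f z.2))
        (volume.prod volume) := by
      refine ((hG.mul_prod hf).bdd_mul (c := 1) (f := fun z : H × H => cis (-inner ℝ z.1 z.2))
        (Continuous.aestronglyMeasurable (by fun_prop)) (by simp)).congr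
        (Eventually.of_forall fun z => ?_)
      simp only; ring
    have e1 : ((∫ k : H, Real.exp (-t * ‖k‖ ^ 2) * g k : ℝ) : ℂ) =
        ∫ x : H, (∫ k : H, (Real.exp (-t * ‖k‖ ^ 2) : ℂ) * cis (-inner ℝ k x)) * f x := by
      rw [← integral_complex_ofReal]
      calc _ = ∫ k : H, ∫ x : H, (Real.exp (-t * ‖k‖ ^ 2) : ℂ) * (cis (-inner ℝ k x) * f x) := by
            congr 1; ext k; rw [integral_const_mul, hg k]; simp
        _ = _ := by
            rw [integral_integral_swap hsw]
            congr 1; ext x; rw [← integral_mul_const]; congr 1; ext k; ring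
    have e2 : ∫ k : H, Real.exp (-t * ‖k‖ ^ 2) * g k ≤
        ‖∫ x : H, (∫ k : H, (Real.exp (-t * ‖k‖ ^ 2) : ℂ) * cis (-inner ℝ k x)) * f x‖ := by
      rw [← e1, Complex.norm_real]; exact le_abs_self _
    refine e2.trans ?_
    have hi : Integrable fun x : H => Real.exp (-(1 / (4 * t)) * ‖x‖ ^ 2) :=
      (GaussianFourier.integrable_cexp_neg_mul_sq_norm_add (V := H) (b := ((1 / (4 * t) : ℝ) : ℂ))
        (by rw [Complex.ofReal_re]; positivity) 0 0).norm.congr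
        (Eventually.of_forall fun k => by
          simp only [Complex.norm_exp]; congr 1; simp [← Complex.ofReal_pow])
    calc _ ≤ ∫ x : H, B * ((Real.pi / t) ^ d * Real.exp (-(1 / (4 * t)) * ‖x‖ ^ 2)) := by
          refine norm_integral_le_of_norm_le ((hi.const_mul _).const_mul _)
            (Eventually.of_forall fun x => ?_)
          rw [norm_mul, integral_gaussian_mul_cis ht, mul_comm]
          exact mul_le_mul_of_nonneg_right (hB x) (by positivity)
      _ = _ := by
          rw [integral_const_mul, integral_const_mul,
            GaussianFourier.integral_rexp_neg_mul_sq_norm (by positivity)]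
  refine (aecover_closedBall (μ := (volume : Measure H)) (x := 0)
    (tendsto_natCast_atTop_atTop (R := ℝ))).integrable_of_integral_norm_bounded
    (Real.exp 1 * (B * (4 * Real.pi ^ 2) ^ d))
    (fun n => hgc.continuousOn.integrableOn_compact (isCompact_closedBall _ _)) ?_
  filter_upwards [eventually_ge_atTop 1] with n hn
  have hn' : (1 : ℝ) ≤ n := by exact_mod_cast hn
  set t : ℝ := 1 / (n : ℝ) ^ 2 with ht
  have ht0 : 0 < t := by positivity
  calc ∫ k in Metric.closedBall (0 : H) n, ‖g k‖
      ≤ ∫ k in Metric.closedBall (0 : H) n, Real.exp 1 * (Real.exp (-t * ‖k‖ ^ 2) * g k) := by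
        refine setIntegral_mono_on (hgc.norm.continuousOn.integrableOn_compact
          (isCompact_closedBall _ _)) ((hgi t ht0).const_mul _).integrableOn
          Metric.isClosed_closedBall.measurableSet fun k hk => ?_
        rw [Real.norm_of_nonneg (hg0 k), ← mul_assoc, ← Real.exp_add]
        refine le_mul_of_one_le_left (hg0 k) (Real.one_le_exp ?_)
        have hk' : ‖k‖ ≤ n := by simpa using hk
        have : t * ‖k‖ ^ 2 ≤ 1 := by
          rw [ht, one_div, inv_mul_le_one₀ (by positivity)]
          gcongr
        linarith
    _ ≤ ∫ k : H, Real.exp 1 * (Real.exp (-t * ‖k‖ ^ 2) * g k) :=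
        setIntegral_le_integral ((hgi t ht0).const_mul _) (Eventually.of_forall fun k =>
          mul_nonneg (Real.exp_pos _).le (mul_nonneg (Real.exp_pos _).le (hg0 k)))
    _ ≤ Real.exp 1 * (B * ((Real.pi / t) ^ d * (Real.pi / (1 / (4 * t))) ^ d)) := by
        rw [integral_const_mul]
        exact mul_le_mul_of_nonneg_left (hbd t ht0) (Real.exp_pos _).le
    _ = _ := by
        rw [← Real.mul_rpow (by positivity) (by positivity)]
        rw [show Real.pi / t * (Real.pi / (1 / (4 * t))) = 4 * Real.pi ^ 2 by field_simp]

/-- A continuous integrable function with nonnegative Fourier transform and with value `1` at the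
origin is the characteristic function of a probability measure. -/
lemma exists_charFun_eq_of_fourier_nonneg {f : H → ℂ} (hc : Continuous f) (hf : Integrable f)
    {B : ℝ} (hB : ∀ x, ‖f x‖ ≤ B) (h1 : f 0 = 1)
    {g : H → ℝ} (hg : ∀ k : H, ∫ x, cis (-inner ℝ k x) * f x = (g k : ℂ)) (hg0 : ∀ k, 0 ≤ g k) :
    ∃ μ : ProbabilityMeasure H, ∀ t, charFun (μ : Measure H) t = f t := by
  have hgi := integrable_fourier_of_nonneg hf hB hg hg0
  have hgm : AEMeasurable (fun k => ENNReal.ofReal (g k)) (volume : Measure H) :=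
    hgi.aestronglyMeasurable.aemeasurable.ennreal_ofReal
  have hgc : Continuous g := by
    have := Complex.continuous_re.comp (continuous_fourier_cis hf)
    refine this.congr fun k => ?_
    simp [hg k]
  set c : ℝ := (2 * Real.pi) ^ Module.finrank ℝ H with hcdef
  have hc0 : 0 < c := by positivity
  set μ : Measure H := volume.withDensity fun k => ENNReal.ofReal (c⁻¹ * g k) with hμ
  have hfin : IsFiniteMeasure μ := isFiniteMeasure_withDensity_ofReal (hgi.const_mul _).2
  have hchar : ∀ t, charFun μ t = f t := by
    intro t
    rw [charFun_eq_integral_cis, hμ, integral_withDensity_eq_integral_toReal_smul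
      (by fun_prop) (Eventually.of_forall fun _ => ENNReal.ofReal_lt_top)]
    have hinv := fourier_inversion_cis hc hf (by simp only [hg]; exact hgi.ofReal (𝕜 := ℂ)) t
    simp only [hg] at hinv
    calc _ = ∫ k : H, (c⁻¹ : ℂ) * (cis (inner ℝ k t) * (g k : ℂ)) := by
          congr 1; ext k
          rw [ENNReal.toReal_ofReal (mul_nonneg (by positivity) (hg0 k)), Complex.real_smul]
          push_cast; ring
      _ = f t := by
          rw [integral_const_mul, hinv, ← mul_assoc, inv_mul_cancel₀, one_mul]
          exact_mod_cast hc0.ne'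
  have hprob : IsProbabilityMeasure μ := by
    have h0 := hchar 0
    rw [charFun_zero, h1] at h0
    constructor
    have : μ.real Set.univ = 1 := by exact_mod_cast h0
    rwa [Measure.real, ENNReal.toReal_eq_one_iff] at this
  exact ⟨⟨μ, hprob⟩, hchar⟩

/-- The integral of `χ` against a finite measure, in terms of the characteristic function of the
measure and of the Fourier transform of `χ`. -/
lemma integral_eq_integral_charFun_mul_fourier (μ : Measure H) [IsFiniteMeasure μ] {χ : H → ℂ}
    (hc : Continuous χ) (hχ : Integrable χ)
    (h : Integrable fun k : H => ∫ x, cis (-inner ℝ k x) * χ x) :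
    (((2 * Real.pi) ^ Module.finrank ℝ H : ℝ) : ℂ) * ∫ p, χ p ∂μ =
      ∫ k : H, charFun μ k * ∫ x, cis (-inner ℝ k x) * χ x := by
  rw [← integral_const_mul]
  simp only [← fourier_inversion_cis hc hχ h]
  rw [integral_integral_swap]
  · congr 1; ext k
    rw [integral_mul_const, charFun_eq_integral_cis]
    congr 2; ext p; rw [real_inner_comm]
  · have := (integrable_const (μ := μ) (1 : ℂ)).mul_prod h
    refine (this.bdd_mul (c := 1) (f := fun z : H × H => cis (inner ℝ z.2 z.1))
      (Continuous.aestronglyMeasurable (by fun_prop)) (by simp)).congr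
      (Eventually.of_forall fun z => ?_)
    simp [Function.uncurry]

end CharFun

/-! ### The scattering distribution -/

section Scattering

variable {Ω : Type*} [MeasurableSpace Ω] {P : Measure Ω} [IsProbabilityMeasure P]
  {V : Plane → Ω → ℝ}

lemma IsInterfaceField.measurable_uncurry (hV : IsInterfaceField P V) :
    Measurable fun z : Plane × Ω => V z.1 z.2 :=
  measurable_uncurry_of_continuous_of_measurable hV.continuous hV.measurable

lemma IsInterfaceField.measurable_comp (hV : IsInterfaceField P V) {α : Type*} [MeasurableSpace α]
    {f : α → Plane} {g : α → Ω} (hf : Measurable f) (hg : Measurable g) :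
    Measurable fun a => V (f a) (g a) :=
  hV.measurable_uncurry.comp (hf.prodMk hg)

/-- Expectations of functions of the field at two points are invariant under translations. -/
lemma IsInterfaceField.integral_shift (hV : IsInterfaceField P V) {E : Type*}
    [NormedAddCommGroup E] [NormedSpace ℝ E] {F : ℝ × ℝ → E} (hF : StronglyMeasurable F)
    (x x' h : Plane) :
    ∫ θ, F (V (x + h) θ, V (x' + h) θ) ∂P = ∫ θ, F (V x θ, V x' θ) ∂P := by
  have hm : Measurable fun u : Fin 2 → ℝ => (u 0, u 1) := by fun_prop
  have key := congrArg (fun μ => ∫ u : Fin 2 → ℝ, F (u 0, u 1) ∂μ) (hV.stationary h 2 ![x, x'])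
  rw [integral_map, integral_map] at key
  · simpa using key
  · exact (measurable_pi_lambda _ fun i => hV.measurable _).aemeasurable
  · exact (hF.comp_measurable hm).aestronglyMeasurable
  · exact (measurable_pi_lambda _ fun i => hV.measurable _).aemeasurable
  · exact (hF.comp_measurable hm).aestronglyMeasurable

/-- `ψ_κ(y) = 𝔼[e^{iκ(V(y) - V(0))}]`. -/
noncomputable def fieldCorr (P : Measure Ω) (V : Plane → Ω → ℝ) (κ : ℝ) (y : Plane) : ℂ :=
  ∫ θ, cis (κ * (V y θ - V 0 θ)) ∂P

lemma integral_cis_sub (hV : IsInterfaceField P V) (κ : ℝ) (x x' : Plane) :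
    ∫ θ, cis (κ * (V x θ - V x' θ)) ∂P = fieldCorr P V κ (x - x') := by
  have := hV.integral_shift (F := fun u : ℝ × ℝ => cis (κ * (u.1 - u.2)))
    (Continuous.stronglyMeasurable (by fun_prop)) (x - x') 0 x'
  simpa [fieldCorr] using this

@[simp] lemma fieldCorr_zero (κ : ℝ) : fieldCorr P V κ 0 = 1 := by simp [fieldCorr]

lemma norm_fieldCorr_le (κ : ℝ) (y : Plane) : ‖fieldCorr P V κ y‖ ≤ 1 := by
  refine (norm_integral_le_integral_norm _).trans ?_
  simp

lemma continuous_fieldCorr (hV : IsInterfaceField P V) (κ : ℝ) : Continuous (fieldCorr P V κ) := by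
  refine continuous_of_dominated (bound := fun _ => 1) (fun y => ?_)
    (fun y => Eventually.of_forall fun θ => by simp) (integrable_const _)
    (Eventually.of_forall fun θ => ?_)
  · have := hV.measurable y
    have := hV.measurable 0
    exact Measurable.aestronglyMeasurable (by fun_prop)
  · have := hV.continuous θ
    fun_prop

lemma integrable_gaussian_plane {δ : ℝ} (hδ : 0 < δ) :
    Integrable fun x : Plane => Real.exp (-δ * ‖x‖ ^ 2) :=
  (GaussianFourier.integrable_cexp_neg_mul_sq_norm_add (V := Plane) (b := (δ : ℂ)) (by simpa) 0
    0).norm.congr (Eventually.of_forall fun k => by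
      simp only [Complex.norm_exp]; congr 1; simp [← Complex.ofReal_pow])

lemma gaussian_mul_gaussian (δ : ℝ) (x u : Plane) :
    Real.exp (-(2 * δ) * ‖x‖ ^ 2) * Real.exp (-(2 * δ) * ‖x + u‖ ^ 2) =
      Real.exp (-(4 * δ) * ‖x + (2⁻¹ : ℝ) • u‖ ^ 2) * Real.exp (-δ * ‖u‖ ^ 2) := by
  rw [← Real.exp_add, ← Real.exp_add, norm_add_sq_real, norm_add_sq_real, norm_smul,
    inner_smul_right]
  congr 1
  norm_num
  ring

/-- The Fourier transform of `ψ_κ(u) e^{-δ|u|²}` is, up to a positive factor, the mean power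
`𝔼 |∫ e^{-2δ|x|²} e^{iκV(x)} e^{-ik·x} dx|²`. -/
lemma fourier_fieldCorr_gaussian (hV : IsInterfaceField P V) (κ : ℝ) {δ : ℝ} (hδ : 0 < δ)
    (k : Plane) :
    ((∫ x : Plane, Real.exp (-(4 * δ) * ‖x‖ ^ 2) : ℝ) : ℂ) *
      ∫ u : Plane, cis (-inner ℝ k u) * (fieldCorr P V κ u * (Real.exp (-δ * ‖u‖ ^ 2) : ℂ)) =
    ((∫ θ, ‖∫ x : Plane, (Real.exp (-(2 * δ) * ‖x‖ ^ 2) : ℂ) *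
      (cis (κ * V x θ) * cis (-inner ℝ k x))‖ ^ 2 ∂P : ℝ) : ℂ) := by
  set g : Plane → ℝ := fun x => Real.exp (-(2 * δ) * ‖x‖ ^ 2) with hg
  have hgi : Integrable g := integrable_gaussian_plane (by positivity)
  have hgc : Continuous g := by fun_prop
  -- the product of two copies of the field transform, as an integral over pairs `(x', x)`
  let A : Plane × Plane → Ω → ℂ := fun z θ =>
    ((g z.1 * g z.2 : ℝ) : ℂ) * (cis (κ * (V z.2 θ - V z.1 θ)) * cis (-inner ℝ k (z.2 - z.1)))
  have hAm : Measurable fun q : Ω × (Plane × Plane) => A q.2 q.1 := by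
    have h1 := hV.measurable_comp (f := fun q : Ω × (Plane × Plane) => q.2.1) (by fun_prop)
      measurable_fst
    have h2 := hV.measurable_comp (f := fun q : Ω × (Plane × Plane) => q.2.2) (by fun_prop)
      measurable_fst
    have h3 : Measurable fun q : Ω × (Plane × Plane) => ((g q.2.1 * g q.2.2 : ℝ) : ℂ) := by
      fun_prop
    have h4 : Measurable fun q : Ω × (Plane × Plane) => cis (-inner ℝ k (q.2.2 - q.2.1)) := by
      fun_prop
    exact h3.mul ((measurable_cis.comp ((h2.sub h1).const_mul κ)).mul h4)
  have hgg : Integrable (fun z : Plane × Plane => g z.1 * g z.2) := hgi.mul_prod hgi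
  have hgn : ∀ z : Plane × Plane, 0 ≤ g z.1 * g z.2 := fun z => by positivity
  have hnA : ∀ z θ, ‖A z θ‖ = g z.1 * g z.2 := fun z θ => by
    rw [norm_mul, Complex.norm_real, Real.norm_of_nonneg (hgn z)]
    simp
  have hAi : Integrable (fun q : Ω × (Plane × Plane) => A q.2 q.1) (P.prod volume) := by
    refine ((integrable_const (μ := P) (1 : ℝ)).mul_prod hgg).mono' hAm.aestronglyMeasurable
      (Eventually.of_forall fun q => ?_)
    rw [hnA]; simp
  have h1 : ∀ θ, ((‖∫ x : Plane, (g x : ℂ) * (cis (κ * V x θ) * cis (-inner ℝ k x))‖ ^ 2 : ℝ) : ℂ) =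
      ∫ z, A z θ := by
    intro θ
    have : ∫ z, A z θ = (∫ x : Plane, conj ((g x : ℂ) * (cis (κ * V x θ) * cis (-inner ℝ k x)))) *
        ∫ x : Plane, (g x : ℂ) * (cis (κ * V x θ) * cis (-inner ℝ k x)) := by
      rw [← integral_prod_mul]
      congr 1; ext z
      simp only [A, map_mul, conj_cis, Complex.conj_ofReal, Complex.ofReal_mul]
      rw [mul_sub, sub_eq_add_neg, cis_add, inner_sub_right, neg_sub, sub_eq_add_neg, cis_add]
      rw [neg_neg]; ring
    rw [this, integral_conj, Complex.conj_mul']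
    norm_cast
  have h2 : ((∫ θ, ‖∫ x : Plane, (g x : ℂ) * (cis (κ * V x θ) * cis (-inner ℝ k x))‖ ^ 2 ∂P : ℝ)
      : ℂ) = ∫ z : Plane × Plane, ((g z.1 * g z.2 : ℝ) : ℂ) *
        (fieldCorr P V κ (z.2 - z.1) * cis (-inner ℝ k (z.2 - z.1))) := by
    rw [← integral_complex_ofReal]
    simp only [h1]
    rw [integral_integral_swap hAi]
    congr 1; ext z
    simp only [A]
    rw [integral_const_mul, integral_mul_const, integral_cis_sub hV]
  have hF : Integrable (fun z : Plane × Plane => ((g z.1 * g z.2 : ℝ) : ℂ) *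
        (fieldCorr P V κ (z.2 - z.1) * cis (-inner ℝ k (z.2 - z.1)))) := by
    refine (hgg.ofReal (𝕜 := ℂ)).mul_bdd (c := 1) (Continuous.aestronglyMeasurable ?_)
      (Eventually.of_forall fun z => ?_)
    · have := continuous_fieldCorr hV κ
      fun_prop
    · simpa using norm_fieldCorr_le κ _
  have hmp : MeasurePreserving (MeasurableEquiv.shearAddRight Plane)
      (volume.prod volume) (volume.prod volume) := measurePreserving_prod_add volume volume
  have h3 := hmp.integral_comp (MeasurableEquiv.shearAddRight Plane).measurableEmbedding
    (fun z : Plane × Plane => ((g z.1 * g z.2 : ℝ) : ℂ) *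
        (fieldCorr P V κ (z.2 - z.1) * cis (-inner ℝ k (z.2 - z.1))))
  have hF' := (hmp.integrable_comp_emb
    (MeasurableEquiv.shearAddRight Plane).measurableEmbedding).2 hF
  rw [h2, Measure.volume_eq_prod, ← h3]
  refine Eq.trans ?_ (integral_prod_symm _ hF').symm
  rw [← integral_const_mul]
  congr 1; ext u
  have h4 : ∀ x : Plane, ((g x * g (x + u) : ℝ) : ℂ) * (fieldCorr P V κ (x + u - x) *
      cis (-inner ℝ k (x + u - x))) = ((Real.exp (-(4 * δ) * ‖x + (2⁻¹ : ℝ) • u‖ ^ 2) : ℝ) : ℂ) *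
      (cis (-inner ℝ k u) * (fieldCorr P V κ u * (Real.exp (-δ * ‖u‖ ^ 2) : ℂ))) := by
    intro x
    simp only [hg]
    rw [gaussian_mul_gaussian, add_sub_cancel_left]
    push_cast; ring
  change _ = ∫ x : Plane, ((g x * g (x + u) : ℝ) : ℂ) * (fieldCorr P V κ (x + u - x) *
      cis (-inner ℝ k (x + u - x)))
  simp only [h4]
  rw [integral_mul_const, integral_complex_ofReal,
    integral_add_right_eq_self (fun x : Plane => Real.exp (-(4 * δ) * ‖x‖ ^ 2))]

/-- Bochner's theorem for the positive definite function `ψ_κ`. -/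
lemma exists_charFun_eq_fieldCorr (hV : IsInterfaceField P V) (κ : ℝ) :
    ∃ μ : Measure Plane, IsProbabilityMeasure μ ∧ ∀ t, charFun μ t = fieldCorr P V κ t := by
  have hstep : ∀ n : ℕ, ∃ μ : ProbabilityMeasure Plane, ∀ t, charFun (μ : Measure Plane) t =
      fieldCorr P V κ t * (Real.exp (-(1 / ((n : ℝ) + 1)) * ‖t‖ ^ 2) : ℂ) := by
    intro n
    have hδ : 0 < 1 / ((n : ℝ) + 1) := by positivity
    generalize 1 / ((n : ℝ) + 1) = δ at hδ ⊢
    have hc : Continuous fun t : Plane => fieldCorr P V κ t * (Real.exp (-δ * ‖t‖ ^ 2) : ℂ) := by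
      have := continuous_fieldCorr hV κ
      fun_prop
    have hi : Integrable fun t : Plane => fieldCorr P V κ t * (Real.exp (-δ * ‖t‖ ^ 2) : ℂ) :=
      ((integrable_gaussian_plane hδ).ofReal (𝕜 := ℂ)).bdd_mul (c := 1)
        (continuous_fieldCorr hV κ).aestronglyMeasurable
        (Eventually.of_forall fun t => norm_fieldCorr_le κ t)
    have hC : 0 < ∫ x : Plane, Real.exp (-(4 * δ) * ‖x‖ ^ 2) := by
      rw [GaussianFourier.integral_rexp_neg_mul_sq_norm (by positivity)]
      positivity
    refine exists_charFun_eq_of_fourier_nonneg (B := 1) hc hi (fun t => ?_) (by simp)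
      (g := fun k => (∫ x : Plane, Real.exp (-(4 * δ) * ‖x‖ ^ 2))⁻¹ *
        ∫ θ, ‖∫ x : Plane, (Real.exp (-(2 * δ) * ‖x‖ ^ 2) : ℂ) *
      (cis (κ * V x θ) * cis (-inner ℝ k x))‖ ^ 2 ∂P) (fun k => ?_) (fun k => ?_)
    · rw [norm_mul, Complex.norm_real, Real.norm_of_nonneg (Real.exp_pos _).le]
      refine mul_le_one₀ (norm_fieldCorr_le κ t) (Real.exp_pos _).le ?_
      rw [Real.exp_le_one_iff]
      nlinarith [sq_nonneg ‖t‖]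
    · rw [Complex.ofReal_mul, ← fourier_fieldCorr_gaussian hV κ hδ k, ← mul_assoc,
        ← Complex.ofReal_mul, inv_mul_cancel₀ hC.ne']
      simp
    · exact mul_nonneg (inv_nonneg.2 hC.le) (integral_nonneg fun θ => by positivity)
  choose μ hμ using hstep
  refine exists_charFun_eq_of_tendsto μ (continuous_fieldCorr hV κ).continuousAt fun t => ?_
  simp only [hμ]
  have h1 : Tendsto (fun n : ℕ => Real.exp (-(1 / ((n : ℝ) + 1)) * ‖t‖ ^ 2)) atTop (𝓝 1) := by
    have := ((tendsto_one_div_add_atTop_nhds_zero_nat (𝕜 := ℝ)).neg.mul_const (‖t‖ ^ 2))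
    simpa using this.rexp
  simpa using ((Complex.continuous_ofReal.tendsto 1).comp h1).const_mul (fieldCorr P V κ t)

/-- A finite measure is determined by the integrals of Schwartz functions. -/
lemma measure_eq_of_integral_schwartz {A A' : Measure Plane} [IsFiniteMeasure A]
    [IsFiniteMeasure A'] (h : ∀ χ : 𝓢(Plane, ℂ), ∫ p, χ p ∂A = ∫ p, χ p ∂A') : A = A' := by
  refine Measure.ext_of_charFun (funext fun t => ?_)
  -- characters are approximated by truncated characters
  let b : ℕ → ContDiffBump (0 : Plane) := fun n =>
    ⟨(n : ℝ) + 1, (n : ℝ) + 2, by positivity, by linarith⟩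
  have hbt : ∀ p : Plane, Tendsto (fun n => b n p) atTop (𝓝 1) := by
    intro p
    refine tendsto_const_nhds.congr' ?_
    obtain ⟨N, hN⟩ := exists_nat_ge ‖p‖
    filter_upwards [eventually_ge_atTop N] with n hn
    refine ((b n).one_of_mem_closedBall ?_).symm
    have : (N : ℝ) ≤ n := by exact_mod_cast hn
    simp only [mem_closedBall_zero_iff]
    change ‖p‖ ≤ (n : ℝ) + 1
    linarith
  have hlim : ∀ (B : Measure Plane) [IsFiniteMeasure B],
      Tendsto (fun n => ∫ p, (b n p : ℂ) * cis (inner ℝ p t) ∂B) atTop (𝓝 (charFun B t)) := by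
    intro B _
    rw [charFun_eq_integral_cis]
    refine tendsto_integral_of_dominated_convergence (fun _ => (1 : ℝ)) (fun n => ?_)
      (integrable_const _) (fun n => Eventually.of_forall fun p => ?_)
      (Eventually.of_forall fun p => ?_)
    · have := (b n).continuous
      exact Continuous.aestronglyMeasurable (by fun_prop)
    · rw [norm_mul, norm_cis, mul_one, Complex.norm_real, Real.norm_of_nonneg (b n).nonneg]
      exact (b n).le_one
    · have := ((Complex.continuous_ofReal.tendsto 1).comp (hbt p)).mul_const (cis (inner ℝ p t))
      simpa using this
  refine tendsto_nhds_unique (hlim A) ((hlim A').congr fun n => ?_)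
  have hs : HasCompactSupport fun p : Plane => (b n p : ℂ) * cis (inner ℝ p t) := by
    refine HasCompactSupport.mul_right ?_
    exact (b n).hasCompactSupport.comp_left (g := fun x : ℝ => (x : ℂ)) (by simp)
  have hd : ContDiff ℝ ((⊤ : ℕ∞) : WithTop ℕ∞) fun p : Plane => (b n p : ℂ) * cis (inner ℝ p t) := by
    refine ContDiff.mul (Complex.ofRealCLM.contDiff.comp (b n).contDiff) ?_
    unfold cis
    exact ((Complex.ofRealCLM.contDiff.comp (contDiff_id.inner ℝ contDiff_const)).mul
      contDiff_const).cexp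
  exact (h (hs.toSchwartzMap hd)).symm

/-- The image of the measure with characteristic function `ψ_{ωv}` under `p ↦ p / ω`, suitably
normalized, has the defining property of the scattering distribution, for a class of test functions
larger than the Schwartz class. -/
lemma exists_isScatteringDistribution (hV : IsInterfaceField P V) (v : ℝ) {ω : ℝ} (hω : ω ≠ 0) :
    ∃ A : Measure Plane, IsFiniteMeasure A ∧ ∀ χ : Plane → ℂ, Continuous χ → Integrable χ →
      Integrable (fun k : Plane => ∫ x, cis (-inner ℝ k x) * χ x) →
      ∫ p, χ p ∂A = ∫ y, fieldCorr P V (ω * v) y * ∫ p, cis (-(ω * inner ℝ p y)) * χ p := by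
  obtain ⟨μ, hμ, hμc⟩ := exists_charFun_eq_fieldCorr hV (ω * v)
  set c : ℝ := (2 * Real.pi) ^ 2 / ω ^ 2 with hc
  have hc0 : 0 < c := by positivity
  refine ⟨ENNReal.ofReal c • μ.map (fun p => ω⁻¹ • p), Measure.smul_finite _ ENNReal.ofReal_ne_top,
    fun χ h1 h2 h3 => ?_⟩
  have hpr : IsFiniteMeasure (μ.map fun p : Plane => ω⁻¹ • p) := inferInstance
  have key := integral_eq_integral_charFun_mul_fourier (μ.map fun p : Plane => ω⁻¹ • p) h1 h2 h3
  simp only [charFun_map_smul, hμc] at key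
  have hsub := Measure.integral_comp_inv_smul (volume : Measure Plane)
    (fun y : Plane => fieldCorr P V (ω * v) y * ∫ p, cis (-(ω * inner ℝ p y)) * χ p) ω
  have e : ∀ k : Plane, ∫ p : Plane, cis (-(ω * inner ℝ p (ω⁻¹ • k))) * χ p =
      ∫ x, cis (-inner ℝ k x) * χ x := by
    intro k
    congr 1; ext p
    rw [inner_smul_right, mul_inv_cancel_left₀ hω, real_inner_comm]
  simp only [e] at hsub
  rw [hsub] at key
  rw [integral_smul_measure, ENNReal.toReal_ofReal hc0.le]
  have hf : Module.finrank ℝ Plane = 2 := by simp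
  rw [hf, abs_of_nonneg (by positivity), Complex.real_smul] at key
  rw [Complex.real_smul, hc, Complex.ofReal_div, div_mul_eq_mul_div, key, mul_div_assoc,
    mul_div_cancel₀]
  exact_mod_cast pow_ne_zero 2 hω

lemma integrable_fourier_schwartz (χ : 𝓢(Plane, ℂ)) :
    Integrable (fun k : Plane => ∫ x, cis (-inner ℝ k x) * χ x) := by
  have h := (FourierTransform.fourier χ : 𝓢(Plane, ℂ)).integrable (μ := volume)
  have h2 := h.comp_smul (inv_ne_zero (show (2 * Real.pi) ≠ 0 by positivity))
  refine h2.congr (Eventually.of_forall fun k => ?_)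
  simp only [SchwartzMap.fourier_coe, fourier_eq_integral_cis]
  rw [smul_inv_smul₀ (by positivity)]

lemma isScatteringDistribution_scatteringDistribution (hV : IsInterfaceField P V) (v : ℝ) {ω : ℝ}
    (hω : ω ≠ 0) :
    IsScatteringDistribution P V v ω (scatteringDistribution P V v ω) := by
  obtain ⟨A, hA, h⟩ := exists_isScatteringDistribution hV v hω
  have : ∃ A, IsScatteringDistribution P V v ω A :=
    ⟨A, hA, fun χ => h χ χ.continuous (χ.integrable) (integrable_fourier_schwartz χ)⟩
  rw [scatteringDistribution, dif_pos this]
  exact this.choose_spec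

lemma integral_scatteringDistribution (hV : IsInterfaceField P V) (v : ℝ) {ω : ℝ} (hω : ω ≠ 0)
    {χ : Plane → ℂ} (h1 : Continuous χ) (h2 : Integrable χ)
    (h3 : Integrable (fun k : Plane => ∫ x, cis (-inner ℝ k x) * χ x)) :
    ∫ p, χ p ∂(scatteringDistribution P V v ω) =
      ∫ y, fieldCorr P V (ω * v) y * ∫ p, cis (-(ω * inner ℝ p y)) * χ p := by
  obtain ⟨A, hA, h⟩ := exists_isScatteringDistribution hV v hω
  have hs := isScatteringDistribution_scatteringDistribution hV v hω
  have := hs.finite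
  rw [← h χ h1 h2 h3]
  congr 1
  refine measure_eq_of_integral_schwartz fun χ => ?_
  rw [hs.fourier, h χ χ.continuous χ.integrable (integrable_fourier_schwartz χ)]
  rfl

end Scattering

/-! ### Decorrelation of distant observations -/

section Mixing

variable {Ω : Type*} [MeasurableSpace Ω] {P : Measure Ω} [IsProbabilityMeasure P]
  {V : Plane → Ω → ℝ}

lemma IsInterfaceField.fieldSigma_le (hV : IsInterfaceField P V) (S : Set Plane) :
    fieldSigma V S ≤ (inferInstance : MeasurableSpace Ω) :=
  iSup₂_le fun x _ => (hV.measurable x).comap_le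

lemma abs_measureReal_inter_sub_le {S S' : Set Plane}
    (hS : S.Nonempty) (hS' : S'.Nonempty) {r : ℝ} (hr : r < setGap S S') {A B : Set Ω}
    (hA : MeasurableSet[fieldSigma V S] A) (hB : MeasurableSet[fieldSigma V S'] B) :
    |P.real (A ∩ B) - P.real A * P.real B| ≤ alphaMixing P V r := by
  refine le_csSup ⟨1, ?_⟩ ⟨S, S', hS, hS', hr, A, B, hA, hB, rfl⟩
  rintro a ⟨S, S', -, -, -, A, B, -, -, rfl⟩
  have h1 := measureReal_le_one (μ := P) (s := A ∩ B)
  have h2 := mul_le_one₀ (measureReal_le_one (μ := P) (s := A)) measureReal_nonneg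
    (measureReal_le_one (μ := P) (s := B))
  have h3 : 0 ≤ P.real (A ∩ B) := measureReal_nonneg
  have h4 : 0 ≤ P.real A * P.real B := mul_nonneg measureReal_nonneg measureReal_nonneg
  exact abs_sub_le_iff.2 ⟨by linarith, by linarith⟩

/-- The covariance inequality for `[0,1]`-valued observables, by integrating the mixing estimate
over the level sets of the two observables. -/
lemma abs_cov_le_alphaMixing_of_mem_Icc (hV : IsInterfaceField P V) {S S' : Set Plane}
    (hS : S.Nonempty) (hS' : S'.Nonempty) {r : ℝ} (hr : r < setGap S S') {F G : Ω → ℝ}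
    (hF : Measurable[fieldSigma V S] F) (hG : Measurable[fieldSigma V S'] G)
    (hF1 : ∀ θ, F θ ∈ Set.Icc (0 : ℝ) 1) (hG1 : ∀ θ, G θ ∈ Set.Icc (0 : ℝ) 1) :
    |∫ θ, F θ * G θ ∂P - (∫ θ, F θ ∂P) * ∫ θ, G θ ∂P| ≤ alphaMixing P V r := by
  have hFm : Measurable F := hF.mono (hV.fieldSigma_le S) le_rfl
  have hGm : Measurable G := hG.mono (hV.fieldSigma_le S') le_rfl
  set ν : Measure ℝ := volume.restrict (Set.Ioc 0 1) with hν
  have hνp : IsProbabilityMeasure ν := ⟨by simp [hν]⟩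
  let i : ℝ → ℝ → ℝ := fun a s => (Set.Iio a).indicator 1 s
  have hi1 : ∀ a s, ‖i a s‖ ≤ 1 := fun a s => by
    simp only [i, Set.indicator]; split_ifs <;> simp
  have hint : ∀ a ∈ Set.Icc (0 : ℝ) 1, ∫ s, i a s ∂ν = a := by
    intro a ha
    have : (Set.Iio a ∩ Set.Ioc (0 : ℝ) 1 : Set ℝ) =ᵐ[volume] (Set.Ioc 0 a : Set ℝ) := by
      have h1 : Set.Iio a ∩ Set.Ioc (0 : ℝ) 1 = Set.Ioo 0 a := by
        ext s; simp only [Set.mem_inter_iff, Set.mem_Iio, Set.mem_Ioc, Set.mem_Ioo]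
        exact ⟨fun h => ⟨h.2.1, h.1⟩, fun h => ⟨h.2, h.1, h.2.le.trans ha.2⟩⟩
      rw [h1]; exact Ioo_ae_eq_Ioc
    simp only [i]
    rw [integral_indicator_one measurableSet_Iio, hν, measureReal_restrict_apply measurableSet_Iio,
      measureReal_congr this]
    simp [ha.1]
  have him : ∀ {H : Ω → ℝ}, Measurable H → Measurable fun q : Ω × ℝ => i (H q.1) q.2 := by
    intro H hH
    have : MeasurableSet {q : Ω × ℝ | q.2 < H q.1} :=
      measurableSet_lt measurable_snd (hH.comp measurable_fst)
    exact (measurable_one.indicator this)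
  have hFi := him hFm
  have hGi := him hGm
  have hjm : Measurable fun q : Ω × (ℝ × ℝ) => i (F q.1) q.2.1 * i (G q.1) q.2.2 :=
    (hFi.comp (measurable_fst.prodMk (measurable_fst.comp measurable_snd))).mul
      (hGi.comp (measurable_fst.prodMk (measurable_snd.comp measurable_snd)))
  have e1 : ∫ θ, F θ * G θ ∂P =
      ∫ z : ℝ × ℝ, P.real ({θ | z.1 < F θ} ∩ {θ | z.2 < G θ}) ∂(ν.prod ν) := by
    have h1 : ∀ θ, F θ * G θ = ∫ z : ℝ × ℝ, i (F θ) z.1 * i (G θ) z.2 ∂(ν.prod ν) := fun θ => by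
      rw [integral_prod_mul, hint _ (hF1 θ), hint _ (hG1 θ)]
    simp only [h1]
    rw [integral_integral_swap]
    · congr 1; ext z
      rw [← integral_indicator_one ((measurableSet_lt measurable_const hFm).inter
        (measurableSet_lt measurable_const hGm))]
      congr 1; ext θ
      simp only [i, Set.indicator, Set.mem_Iio, Set.mem_inter_iff, Set.mem_ofPred_eq, Pi.one_apply]
      split_ifs <;> simp_all
    · refine (integrable_const (1 : ℝ)).mono' hjm.aestronglyMeasurable
        (Eventually.of_forall fun q => ?_)
      simp only [Function.uncurry, norm_mul]
      exact mul_le_one₀ (hi1 _ _) (norm_nonneg _) (hi1 _ _)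
  have e2 : ∀ {H : Ω → ℝ}, Measurable H → (∀ θ, H θ ∈ Set.Icc (0 : ℝ) 1) →
      ∫ θ, H θ ∂P = ∫ s, P.real {θ | s < H θ} ∂ν := by
    intro H hH hH1
    have h1 : ∀ θ, H θ = ∫ s, i (H θ) s ∂ν := fun θ => (hint _ (hH1 θ)).symm
    conv_lhs => enter [2, θ]; rw [h1 θ]
    rw [integral_integral_swap]
    · congr 1; ext s
      rw [← integral_indicator_one (measurableSet_lt measurable_const hH)]
      congr 1
    · exact (integrable_const (1 : ℝ)).mono' (him hH).aestronglyMeasurable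
        (Eventually.of_forall fun q => hi1 _ _)
  have hm1 : Measurable fun z : ℝ × ℝ => P.real ({θ | z.1 < F θ} ∩ {θ | z.2 < G θ}) := by
    have : MeasurableSet {q : (ℝ × ℝ) × Ω | q.1.1 < F q.2 ∧ q.1.2 < G q.2} :=
      MeasurableSet.inter (s₁ := {q : (ℝ × ℝ) × Ω | q.1.1 < F q.2})
        (s₂ := {q : (ℝ × ℝ) × Ω | q.1.2 < G q.2})
        (measurableSet_lt (measurable_fst.comp measurable_fst) (hFm.comp measurable_snd))
        (measurableSet_lt (measurable_snd.comp measurable_fst) (hGm.comp measurable_snd))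
    exact (measurable_measure_prodMk_left (ν := P) this).ennreal_toReal
  have hm2 : ∀ {H : Ω → ℝ}, Measurable H → Measurable fun s : ℝ => P.real {θ | s < H θ} := by
    intro H hH
    have : MeasurableSet {q : ℝ × Ω | q.1 < H q.2} :=
      measurableSet_lt measurable_fst (hH.comp measurable_snd)
    exact (measurable_measure_prodMk_left (ν := P) this).ennreal_toReal
  have hm2F := hm2 hFm
  have hm2G := hm2 hGm
  rw [e1, e2 hFm hF1, e2 hGm hG1, ← integral_prod_mul, ← integral_sub]
  · have hle : ∀ z : ℝ × ℝ, ‖P.real ({θ | z.1 < F θ} ∩ {θ | z.2 < G θ}) -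
        P.real {θ | z.1 < F θ} * P.real {θ | z.2 < G θ}‖ ≤ alphaMixing P V r := fun z =>
      abs_measureReal_inter_sub_le hS hS' hr (hF measurableSet_Ioi) (hG measurableSet_Ioi)
    have := norm_integral_le_of_norm_le_const (μ := ν.prod ν) (Eventually.of_forall hle)
    rwa [probReal_univ (μ := ν.prod ν), mul_one] at this
  · refine (integrable_const (1 : ℝ)).mono' hm1.aestronglyMeasurable
      (Eventually.of_forall fun z => ?_)
    rw [Real.norm_of_nonneg measureReal_nonneg]
    exact measureReal_le_one
  · refine (integrable_const (1 : ℝ)).mono' ((hm2F.comp measurable_fst).mul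
      (hm2G.comp measurable_snd)).aestronglyMeasurable (Eventually.of_forall fun z => ?_)
    rw [Real.norm_of_nonneg (mul_nonneg measureReal_nonneg measureReal_nonneg)]
    exact mul_le_one₀ measureReal_le_one measureReal_nonneg measureReal_le_one

lemma abs_cov_le_alphaMixing (hV : IsInterfaceField P V) {S S' : Set Plane}
    (hS : S.Nonempty) (hS' : S'.Nonempty) {r : ℝ} (hr : r < setGap S S') {F G : Ω → ℝ}
    (hF : Measurable[fieldSigma V S] F) (hG : Measurable[fieldSigma V S'] G)
    (hF1 : ∀ θ, |F θ| ≤ 1) (hG1 : ∀ θ, |G θ| ≤ 1) :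
    |∫ θ, F θ * G θ ∂P - (∫ θ, F θ ∂P) * ∫ θ, G θ ∂P| ≤ 4 * alphaMixing P V r := by
  have hFm : Measurable F := hF.mono (hV.fieldSigma_le S) le_rfl
  have hGm : Measurable G := hG.mono (hV.fieldSigma_le S') le_rfl
  have key := abs_cov_le_alphaMixing_of_mem_Icc hV hS hS' hr (F := fun θ => (1 + F θ) / 2)
    (G := fun θ => (1 + G θ) / 2) ((measurable_const.add hF).div_const 2)
    ((measurable_const.add hG).div_const 2)
    (fun θ => by have := abs_le.1 (hF1 θ); constructor <;> linarith)
    (fun θ => by have := abs_le.1 (hG1 θ); constructor <;> linarith)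
  have iF : Integrable F P := (integrable_const (1 : ℝ)).mono' hFm.aestronglyMeasurable
    (Eventually.of_forall hF1)
  have iG : Integrable G P := (integrable_const (1 : ℝ)).mono' hGm.aestronglyMeasurable
    (Eventually.of_forall hG1)
  have iFG : Integrable (fun θ => F θ * G θ) P := iG.bdd_mul hFm.aestronglyMeasurable
    (Eventually.of_forall hF1)
  have h1 : ∫ θ, (1 + F θ) / 2 ∂P = (1 + ∫ θ, F θ ∂P) / 2 := by
    rw [integral_div, integral_add (integrable_const _) iF]; simp
  have h2 : ∫ θ, (1 + G θ) / 2 ∂P = (1 + ∫ θ, G θ ∂P) / 2 := by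
    rw [integral_div, integral_add (integrable_const _) iG]; simp
  have h3 : ∫ θ, (1 + F θ) / 2 * ((1 + G θ) / 2) ∂P =
      (1 + ∫ θ, F θ ∂P + ∫ θ, G θ ∂P + ∫ θ, F θ * G θ ∂P) / 4 := by
    have : ∀ θ, (1 + F θ) / 2 * ((1 + G θ) / 2) = (1 + F θ + G θ + F θ * G θ) / 4 := fun θ => by
      ring
    have j1 : Integrable (fun θ => 1 + F θ) P := (integrable_const _).add iF
    have j2 : Integrable (fun θ => 1 + F θ + G θ) P := j1.add iG
    simp only [this]
    rw [integral_div, integral_add j2 iFG, integral_add j1 iG, integral_add (integrable_const _) iF]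
    simp
  rw [h1, h2, h3] at key
  have h4 : (1 + ∫ θ, F θ ∂P + ∫ θ, G θ ∂P + ∫ θ, F θ * G θ ∂P) / 4 -
      (1 + ∫ θ, F θ ∂P) / 2 * ((1 + ∫ θ, G θ ∂P) / 2) =
      (∫ θ, F θ * G θ ∂P - (∫ θ, F θ ∂P) * ∫ θ, G θ ∂P) / 4 := by ring
  rw [h4, abs_div, abs_of_pos (by norm_num : (0 : ℝ) < 4)] at key
  linarith

lemma norm_cov_le_alphaMixing (hV : IsInterfaceField P V) {S S' : Set Plane}
    (hS : S.Nonempty) (hS' : S'.Nonempty) {r : ℝ} (hr : r < setGap S S') {F G : Ω → ℂ}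
    (hF : Measurable[fieldSigma V S] F) (hG : Measurable[fieldSigma V S'] G)
    (hF1 : ∀ θ, ‖F θ‖ ≤ 1) (hG1 : ∀ θ, ‖G θ‖ ≤ 1) :
    ‖∫ θ, F θ * G θ ∂P - (∫ θ, F θ ∂P) * ∫ θ, G θ ∂P‖ ≤ 16 * alphaMixing P V r := by
  have hFm : Measurable F := hF.mono (hV.fieldSigma_le S) le_rfl
  have hGm : Measurable G := hG.mono (hV.fieldSigma_le S') le_rfl
  have iF : Integrable F P := (integrable_const (1 : ℝ)).mono' hFm.aestronglyMeasurable
    (Eventually.of_forall hF1)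
  have iG : Integrable G P := (integrable_const (1 : ℝ)).mono' hGm.aestronglyMeasurable
    (Eventually.of_forall hG1)
  have iFG : Integrable (fun θ => F θ * G θ) P := iG.bdd_mul hFm.aestronglyMeasurable
    (Eventually.of_forall hF1)
  have b : ∀ {H : Ω → ℂ}, (∀ θ, ‖H θ‖ ≤ 1) → (∀ θ, |(H θ).re| ≤ 1) ∧ ∀ θ, |(H θ).im| ≤ 1 :=
    fun h => ⟨fun θ => (Complex.abs_re_le_norm _).trans (h θ),
      fun θ => (Complex.abs_im_le_norm _).trans (h θ)⟩
  have mFr := Complex.measurable_re.comp hF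
  have mFi := Complex.measurable_im.comp hF
  have mGr := Complex.measurable_re.comp hG
  have mGi := Complex.measurable_im.comp hG
  have k1 := abs_cov_le_alphaMixing hV hS hS' hr mFr mGr (b hF1).1 (b hG1).1
  have k2 := abs_cov_le_alphaMixing hV hS hS' hr mFi mGi (b hF1).2 (b hG1).2
  have k3 := abs_cov_le_alphaMixing hV hS hS' hr mFr mGi (b hF1).1 (b hG1).2
  have k4 := abs_cov_le_alphaMixing hV hS hS' hr mFi mGr (b hF1).2 (b hG1).1
  simp only [Function.comp_apply] at k1 k2 k3 k4
  have re' : ∀ {H : Ω → ℂ}, Integrable H P → (∫ θ, H θ ∂P).re = ∫ θ, (H θ).re ∂P :=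
    fun h => (integral_re h).symm
  have im' : ∀ {H : Ω → ℂ}, Integrable H P → (∫ θ, H θ ∂P).im = ∫ θ, (H θ).im ∂P :=
    fun h => (integral_im h).symm
  have m : ∀ {H K : Ω → ℝ}, Integrable H P → Integrable K P → (∀ θ, |H θ| ≤ 1) →
      Integrable (fun θ => H θ * K θ) P := fun h k hb =>
    k.bdd_mul h.aestronglyMeasurable (Eventually.of_forall hb)
  refine (Complex.norm_le_abs_re_add_abs_im _).trans ?_
  rw [Complex.sub_re, Complex.sub_im, Complex.mul_re, Complex.mul_im, re' iFG, im' iFG, re' iF,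
    im' iF, re' iG, im' iG]
  simp only [Complex.mul_re, Complex.mul_im]
  have e1 := integral_sub (m iF.re iG.re (b hF1).1) (m iF.im iG.im (b hF1).2)
  have e2 := integral_add (m iF.re iG.im (b hF1).1) (m iF.im iG.re (b hF1).2)
  simp only [RCLike.re_to_complex, RCLike.im_to_complex] at e1 e2
  rw [e1, e2]
  rw [abs_le] at k1 k2 k3 k4
  have : ∀ {a c : ℝ}, |a| ≤ 8 * c → ∀ {d : ℝ}, |d| ≤ 8 * c → |a| + |d| ≤ 16 * c := by
    intros; linarith
  refine this (abs_le.2 ⟨?_, ?_⟩) (abs_le.2 ⟨?_, ?_⟩) <;> linarith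

lemma le_setGap_pair (x d x' d' : Plane) :
    dist x x' - ‖d‖ - ‖d'‖ ≤ setGap {x, x + d} {x', x' + d'} := by
  refine le_csInf ⟨_, x, by simp, x', by simp, rfl⟩ ?_
  have h0 := norm_nonneg d
  have h0' := norm_nonneg d'
  have h1 : dist x (x + d) = ‖d‖ := by simp
  have h2 : dist (x' + d') x' = ‖d'‖ := by simp
  rintro _ ⟨s, hs, s', hs', rfl⟩
  simp only [Set.mem_insert_iff, Set.mem_singleton_iff] at hs hs'
  have t1 := dist_triangle x s x'
  have t2 := dist_triangle s s' x'
  have t3 : dist x s ≤ ‖d‖ := by rcases hs with rfl | rfl <;> simp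
  have t4 : dist s' x' ≤ ‖d'‖ := by rcases hs' with rfl | rfl <;> simp
  linarith

/-- Observables of the field near two points become uncorrelated as the points separate. -/
lemma tendsto_cov_of_dist_tendsto (hV : IsInterfaceField P V) {ι : Type*} {l : Filter ι}
    {x x' : ι → Plane} (h : Tendsto (fun i => dist (x i) (x' i)) l atTop) (d d' : Plane)
    {F G : ℝ × ℝ → ℂ} (hF : Measurable F) (hG : Measurable G) (hF1 : ∀ u, ‖F u‖ ≤ 1)
    (hG1 : ∀ u, ‖G u‖ ≤ 1) :
    Tendsto (fun i => ∫ θ, F (V (x i) θ, V (x i + d) θ) * G (V (x' i) θ, V (x' i + d') θ) ∂P -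
      (∫ θ, F (V (x i) θ, V (x i + d) θ) ∂P) * ∫ θ, G (V (x' i) θ, V (x' i + d') θ) ∂P)
      l (𝓝 0) := by
  have hr : Tendsto (fun i => dist (x i) (x' i) - ‖d‖ - ‖d'‖ - 1) l atTop := by
    simp only [sub_eq_add_neg]
    exact tendsto_atTop_add_const_right _ _ (tendsto_atTop_add_const_right _ _
      (tendsto_atTop_add_const_right _ _ h))
  have hα : Tendsto (fun i => 16 * alphaMixing P V (dist (x i) (x' i) - ‖d‖ - ‖d'‖ - 1)) l
      (𝓝 0) := by simpa using (hV.mixing.comp hr).const_mul 16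
  refine squeeze_zero_norm (fun i => ?_) hα
  have hm : ∀ (y e : Plane) {K : ℝ × ℝ → ℂ}, Measurable K →
      Measurable[fieldSigma V {y, y + e}] fun θ => K (V y θ, V (y + e) θ) := by
    intro y e K hK
    have h1 : Measurable[fieldSigma V {y, y + e}] (V y) :=
      (comap_measurable (V y)).mono (le_iSup₂ (f := fun x (_ : x ∈ ({y, y + e} : Set Plane)) =>
        MeasurableSpace.comap (V x) inferInstance) y (by simp)) le_rfl
    have h2 : Measurable[fieldSigma V {y, y + e}] (V (y + e)) :=
      (comap_measurable (V (y + e))).mono (le_iSup₂ (f := fun x (_ : x ∈ ({y, y + e} : Set Plane)) =>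
        MeasurableSpace.comap (V x) inferInstance) (y + e) (by simp)) le_rfl
    exact hK.comp (h1.prodMk h2)
  exact norm_cov_le_alphaMixing hV (by simp) (by simp)
    (lt_of_lt_of_le (by linarith) (le_setGap_pair (x i) d (x' i) d'))
    (hm _ _ hF) (hm _ _ hG) (fun θ => hF1 _) (fun θ => hG1 _)

/-- If the mean square deviation from a constant tends to zero, then the convergence holds in
probability. -/
lemma tendstoInMeasure_of_tendsto_meanSquare {ι : Type*} {l : Filter ι} {Y : ι → Ω → ℂ} {L : ℂ}
    (hY : ∀ᶠ i in l, AEStronglyMeasurable (Y i) P) {C : ι → ℝ}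
    (hC : ∀ᶠ i in l, ∀ θ, ‖Y i θ‖ ≤ C i)
    (h : Tendsto (fun i => ∫ θ, ‖Y i θ - L‖ ^ 2 ∂P) l (𝓝 0)) :
    TendstoInMeasure P Y l fun _ => L := by
  rw [tendstoInMeasure_iff_measureReal_norm]
  intro ε hε
  have h' : Tendsto (fun i => (∫ θ, ‖Y i θ - L‖ ^ 2 ∂P) / ε ^ 2) l (𝓝 0) := by
    simpa using h.div_const (ε ^ 2)
  refine squeeze_zero' (Eventually.of_forall fun _ => measureReal_nonneg) ?_ h'
  filter_upwards [hY, hC] with i hi hCi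
  have hint : Integrable (fun θ => ‖Y i θ - L‖ ^ 2) P := by
    refine (integrable_const ((C i + ‖L‖) ^ 2)).mono' ((hi.sub aestronglyMeasurable_const).norm.pow 2)
      (Eventually.of_forall fun θ => ?_)
    rw [Real.norm_of_nonneg (by positivity)]
    exact pow_le_pow_left₀ (norm_nonneg _) ((norm_sub_le _ _).trans (by gcongr; exact hCi θ)) 2
  have key := mul_meas_ge_le_integral_of_nonneg (Eventually.of_forall fun θ => by positivity) hint
    (ε ^ 2)
  rw [le_div_iff₀ (by positivity), mul_comm]
  refine le_trans (le_of_eq ?_) key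
  congr 2
  ext θ
  simp only [Set.mem_ofPred_eq]
  exact (pow_le_pow_iff_left₀ hε.le (norm_nonneg _) two_ne_zero).symm

/-- A law of large numbers in the mean square sense for integrals `∫ f_i(z) W_i(z) dz` of random
functions that are asymptotically uncorrelated. -/
lemma tendsto_meanSquare_integral {Z : Type*} [MeasurableSpace Z] {μ : Measure Z} [SigmaFinite μ]
    {ι : Type*} {l : Filter ι} [l.IsCountablyGenerated] {f : ι → Z → ℂ} {f₀ : Z → ℂ} {b : Z → ℝ}
    {W : ι → Z → Ω → ℂ} {w : Z → ℂ} (hb : Integrable b μ)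
    (hfm : ∀ᶠ i in l, AEStronglyMeasurable (f i) μ)
    (hfb : ∀ᶠ i in l, ∀ z, ‖f i z‖ ≤ b z) (hf : ∀ᵐ z ∂μ, Tendsto (fun i => f i z) l (𝓝 (f₀ z)))
    (hWm : ∀ i, Measurable fun q : Z × Ω => W i q.1 q.2) (hW1 : ∀ i z θ, ‖W i z θ‖ ≤ 1)
    (hw1 : ∀ᵐ z ∂μ, Tendsto (fun i => ∫ θ, W i z θ ∂P) l (𝓝 (w z)))
    (hw2 : ∀ᵐ q ∂(μ.prod μ), Tendsto (fun i => ∫ θ, W i q.1 θ * conj (W i q.2 θ) ∂P) l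
      (𝓝 (w q.1 * conj (w q.2)))) :
    Tendsto (fun i => ∫ θ, ‖∫ z, f i z * W i z θ ∂μ - ∫ z, f₀ z * w z ∂μ‖ ^ 2 ∂P) l (𝓝 0) := by
  set L := ∫ z, f₀ z * w z ∂μ with hL
  set Y : ι → Ω → ℂ := fun i θ => ∫ z, f i z * W i z θ ∂μ with hY
  have hEW : ∀ i z, ‖∫ θ, W i z θ ∂P‖ ≤ 1 := fun i z =>
    (norm_integral_le_of_norm_le_const (Eventually.of_forall fun θ => hW1 i z θ)).trans (by simp)
  have hfi : ∀ᶠ i in l, Integrable (f i) μ := by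
    filter_upwards [hfm, hfb] with i h1 h2 using hb.mono' h1 (Eventually.of_forall h2)
  -- the means converge, by dominated convergence
  have hlim1 : Tendsto (fun i => ∫ θ, Y i θ ∂P) l (𝓝 L) := by
    have e : ∀ᶠ i in l, ∫ z, f i z * ∫ θ, W i z θ ∂P ∂μ = ∫ θ, Y i θ ∂P := by
      filter_upwards [hfi] with i hi
      simp only [hY, ← integral_const_mul]
      refine integral_integral_swap ?_
      exact ((hi.mul_prod (integrable_const (μ := P) (1 : ℂ))).mul_bdd (c := 1)
        (hWm i).aestronglyMeasurable (Eventually.of_forall fun q => hW1 i _ _)).congr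
        (Eventually.of_forall fun q => by simp [Function.uncurry])
    refine Tendsto.congr' e (tendsto_integral_filter_of_dominated_convergence b ?_ ?_ hb ?_)
    · filter_upwards [hfm] with i hi
      exact hi.mul ((hWm i).stronglyMeasurable.integral_prod_right (ν := P)).aestronglyMeasurable
    · filter_upwards [hfb] with i hi
      refine Eventually.of_forall fun z => ?_
      rw [norm_mul]
      exact (mul_le_of_le_one_right (norm_nonneg _) (hEW i z)).trans (hi z)
    · filter_upwards [hf, hw1] with z h1 h2 using h1.mul h2
  -- the second moment is an integral over pairs, on which the factors decorrelate
  have hlim2 : Tendsto (fun i => ∫ θ, Y i θ * conj (Y i θ) ∂P) l (𝓝 (L * conj L)) := by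
    have hLL : L * conj L = ∫ q : Z × Z, (f₀ q.1 * w q.1) * conj (f₀ q.2 * w q.2) ∂(μ.prod μ) := by
      rw [hL, ← integral_conj]
      exact (integral_prod_mul (fun z => f₀ z * w z) fun z => conj (f₀ z * w z)).symm
    have hm2 : ∀ i, Measurable fun q : (Z × Z) × Ω => W i q.1.1 q.2 * conj (W i q.1.2 q.2) := by
      intro i
      exact ((hWm i).comp ((measurable_fst.comp measurable_fst).prodMk measurable_snd)).mul
        (Complex.continuous_conj.measurable.comp
          ((hWm i).comp ((measurable_snd.comp measurable_fst).prodMk measurable_snd)))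
    have hn2 : ∀ i z z' θ, ‖W i z θ * conj (W i z' θ)‖ ≤ 1 := fun i z z' θ => by
      rw [norm_mul, Complex.norm_conj]
      exact mul_le_one₀ (hW1 _ _ _) (norm_nonneg _) (hW1 _ _ _)
    have e : ∀ᶠ i in l, ∫ q : Z × Z, (f i q.1 * conj (f i q.2)) *
        ∫ θ, W i q.1 θ * conj (W i q.2 θ) ∂P ∂(μ.prod μ) = ∫ θ, Y i θ * conj (Y i θ) ∂P := by
      filter_upwards [hfi] with i hi
      have hi' : Integrable (fun z => conj (f i z)) μ := Complex.conjCLE.integrable_comp_iff.2 hi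
      simp only [hY, ← integral_const_mul]
      rw [integral_integral_swap]
      · congr 1; ext θ
        rw [← integral_conj, ← integral_prod_mul]
        congr 1; ext q
        simp only [map_mul]; ring
      · exact (((hi.mul_prod hi').mul_prod (integrable_const (μ := P) (1 : ℂ))).mul_bdd (c := 1)
          (hm2 i).aestronglyMeasurable (Eventually.of_forall fun q => hn2 i _ _ _)).congr
          (Eventually.of_forall fun q => by simp [Function.uncurry])
    rw [hLL]
    refine Tendsto.congr' e (tendsto_integral_filter_of_dominated_convergence
      (fun q => b q.1 * b q.2) ?_ ?_ (hb.mul_prod hb) ?_)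
    · filter_upwards [hfi] with i hi
      have hi' : Integrable (fun z => conj (f i z)) μ := Complex.conjCLE.integrable_comp_iff.2 hi
      exact (hi.mul_prod hi').aestronglyMeasurable.mul
        ((hm2 i).stronglyMeasurable.integral_prod_right (ν := P)).aestronglyMeasurable
    · filter_upwards [hfb] with i hi
      refine Eventually.of_forall fun q => ?_
      rw [norm_mul, norm_mul, Complex.norm_conj]
      have : ‖∫ θ, W i q.1 θ * conj (W i q.2 θ) ∂P‖ ≤ 1 :=
        (norm_integral_le_of_norm_le_const
          (Eventually.of_forall fun θ => hn2 i _ _ θ)).trans (by simp)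
      exact (mul_le_of_le_one_right (by positivity) this).trans
        (mul_le_mul (hi _) (hi _) (norm_nonneg _) ((norm_nonneg _).trans (hi _)))
    · have q1 : ∀ᵐ q ∂(μ.prod μ), Tendsto (fun i => f i q.1) l (𝓝 (f₀ q.1)) :=
        Measure.quasiMeasurePreserving_fst.ae hf
      have q2 : ∀ᵐ q ∂(μ.prod μ), Tendsto (fun i => f i q.2) l (𝓝 (f₀ q.2)) :=
        Measure.quasiMeasurePreserving_snd.ae hf
      filter_upwards [q1, q2, hw2] with q h1 h2 h3
      have := (h1.mul ((Complex.continuous_conj.tendsto _).comp h2)).mul h3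
      refine (this.congr fun i => ?_).trans_eq ?_
      · simp
      · congr 1; simp only [map_mul]; ring
  have hYm : ∀ᶠ i in l, AEStronglyMeasurable (Y i) P := by
    filter_upwards [hfi] with i hi
    have : Integrable (fun q : Ω × Z => f i q.2 * W i q.2 q.1) (P.prod μ) :=
      (((integrable_const (μ := P) (1 : ℂ)).mul_prod hi).mul_bdd (c := 1)
        ((hWm i).comp measurable_swap).aestronglyMeasurable
        (Eventually.of_forall fun q => hW1 i _ _)).congr
        (Eventually.of_forall fun q => by simp)
    exact this.integral_prod_left.aestronglyMeasurable
  have hYb : ∀ᶠ i in l, ∀ θ, ‖Y i θ‖ ≤ ∫ z, b z ∂μ := by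
    filter_upwards [hfb] with i hi θ
    refine norm_integral_le_of_norm_le hb (Eventually.of_forall fun z => ?_)
    rw [norm_mul]
    exact (mul_le_of_le_one_right (norm_nonneg _) (hW1 i z θ)).trans (hi z)
  have hfinal : ∀ᶠ i in l, ∫ θ, Y i θ * conj (Y i θ) ∂P - (∫ θ, Y i θ ∂P) * conj L -
      L * conj (∫ θ, Y i θ ∂P) + L * conj L = ((∫ θ, ‖Y i θ - L‖ ^ 2 ∂P : ℝ) : ℂ) := by
    filter_upwards [hYm, hYb] with i hm hbd
    have i1 : Integrable (Y i) P := (integrable_const _).mono' hm (Eventually.of_forall hbd)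
    have i2 : Integrable (fun θ => conj (Y i θ)) P := Complex.conjCLE.integrable_comp_iff.2 i1
    have i3 : Integrable (fun θ => Y i θ * conj (Y i θ)) P :=
      i2.bdd_mul hm (Eventually.of_forall hbd)
    have : ∀ θ, ((‖Y i θ - L‖ ^ 2 : ℝ) : ℂ) =
        Y i θ * conj (Y i θ) - Y i θ * conj L - L * conj (Y i θ) + L * conj L := fun θ => by
      push_cast
      rw [← Complex.mul_conj', map_sub]; ring
    rw [← integral_complex_ofReal]
    simp only [this]
    have j1 : Integrable (fun θ => Y i θ * conj (Y i θ) - Y i θ * conj L) P :=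
      i3.sub (i1.mul_const _)
    have j2 : Integrable (fun θ => Y i θ * conj (Y i θ) - Y i θ * conj L - L * conj (Y i θ)) P :=
      j1.sub (i2.const_mul _)
    rw [integral_add j2 (integrable_const _), integral_sub j1 (i2.const_mul _),
      integral_sub i3 (i1.mul_const _),
      integral_mul_const, integral_const_mul, integral_conj]
    simp
  have hlim : Tendsto (fun i => ((∫ θ, ‖Y i θ - L‖ ^ 2 ∂P : ℝ) : ℂ)) l (𝓝 0) := by
    refine Tendsto.congr' hfinal ?_
    have := ((hlim2.sub (hlim1.mul_const (conj L))).sub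
      (((Complex.continuous_conj.tendsto _).comp hlim1).const_mul L)).add_const (L * conj L)
    refine this.trans_eq ?_
    congr 1; ring
  refine ((Complex.continuous_re.tendsto 0).comp hlim).congr fun i => ?_
  rw [Function.comp_apply, Complex.ofReal_re]

end Mixing

/-! ### The paraxial quadratic form -/

namespace Setup

variable {D : Setup}

/-- The symmetric operator `z_int c₀ A₀`. -/
noncomputable def paraxial (D : Setup) : Plane →L[ℝ] Plane :=
  LinearMap.toContinuousLinearMap ((D.zint * D.c₀) • Matrix.toEuclideanLin D.A₀)

/-- The inverse `(s₀ / z_int) (1 - c₀² k₀ ⊗ k₀)` of `z_int c₀ A₀`. -/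
noncomputable def paraxialInv (D : Setup) : Plane →L[ℝ] Plane :=
  (D.s₀ / D.zint) • (ContinuousLinearMap.id ℝ Plane -
    (D.c₀ ^ 2) • (innerSL ℝ D.k₀).smulRight D.k₀)

lemma paraxial_apply (p : Plane) : D.paraxial p = (D.zint * D.c₀) • D.A₀v p := rfl

lemma yDirac_eq (p : Plane) : D.yDirac p = D.paraxial p := rfl

lemma sDirac_eq (p : Plane) : D.sDirac p = inner ℝ p (D.paraxial p) / 2 := by
  rw [sDirac, paraxial_apply, inner_smul_right]

lemma U₀_eq (ω : ℝ) (q : Plane) : D.U₀ ω q D.zint = cis (-(ω * (inner ℝ q (D.paraxial q) / 2))) := by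
  rw [U₀, paraxial_apply, inner_smul_right]
  congr 1; ring

lemma A₀v_apply_zero (p : Plane) : D.A₀v p 0 =
    (1 / (D.c₀ * D.s₀) ^ 3) * ((1 - D.c₀ ^ 2 * D.k₀ 1 ^ 2) * p 0 + D.c₀ ^ 2 * (D.k₀ 0 * D.k₀ 1) * p 1) := by
  simp [A₀v, A₀, Matrix.toLpLin_apply, dotProduct, Fin.sum_univ_two]
  ring

lemma A₀v_apply_one (p : Plane) : D.A₀v p 1 =
    (1 / (D.c₀ * D.s₀) ^ 3) * (D.c₀ ^ 2 * (D.k₀ 0 * D.k₀ 1) * p 0 + (1 - D.c₀ ^ 2 * D.k₀ 0 ^ 2) * p 1) := by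
  simp [A₀v, A₀, Matrix.toLpLin_apply, dotProduct, Fin.sum_univ_two]
  ring

lemma inner_plane (x y : Plane) : inner ℝ x y = x 0 * y 0 + x 1 * y 1 := by
  simp [PiLp.inner_apply, Fin.sum_univ_two, mul_comm]

lemma norm_sq_plane (x : Plane) : ‖x‖ ^ 2 = x 0 ^ 2 + x 1 ^ 2 := by
  rw [← real_inner_self_eq_norm_sq, inner_plane]; ring

namespace Admissible

variable (hD : D.Admissible)
include hD

lemma c₀_pos : 0 < D.c₀ := hD.c₁_pos.trans hD.c₁_lt

lemma one_sub_pos : 0 < 1 - D.c₀ ^ 2 * ‖D.k₀‖ ^ 2 := by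
  have h := hD.k₀_lt
  have hc := hD.c₀_pos
  rw [lt_div_iff₀ hc] at h
  have : (‖D.k₀‖ * D.c₀) ^ 2 < 1 := by
    rw [sq_lt_one_iff₀ (by positivity)]; exact h
  linarith [mul_pow ‖D.k₀‖ D.c₀ 2]

lemma s₀_pos : 0 < D.s₀ := div_pos (Real.sqrt_pos.2 hD.one_sub_pos) hD.c₀_pos

lemma c₀s₀_sq : (D.c₀ * D.s₀) ^ 2 = 1 - D.c₀ ^ 2 * ‖D.k₀‖ ^ 2 := by
  rw [s₀, mul_div_cancel₀ _ hD.c₀_pos.ne', Real.sq_sqrt hD.one_sub_pos.le]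

lemma paraxial_symm (x y : Plane) : inner ℝ x (D.paraxial y) = inner ℝ (D.paraxial x) y := by
  simp only [paraxial_apply, inner_smul_left, inner_smul_right, inner_plane, A₀v_apply_zero,
    A₀v_apply_one, conj_trivial]
  ring

lemma paraxial_pos {x : Plane} (hx : x ≠ 0) : 0 < inner ℝ x (D.paraxial x) := by
  have hN : 0 < D.zint * D.c₀ * (1 / (D.c₀ * D.s₀) ^ 3) := by
    have := hD.c₀_pos; have := hD.s₀_pos; have := hD.zint_pos
    positivity
  have e : inner ℝ x (D.paraxial x) = D.zint * D.c₀ * (1 / (D.c₀ * D.s₀) ^ 3) *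
      ((1 - D.c₀ ^ 2 * ‖D.k₀‖ ^ 2) * ‖x‖ ^ 2 + D.c₀ ^ 2 * (D.k₀ 0 * x 0 + D.k₀ 1 * x 1) ^ 2) := by
    simp only [paraxial_apply, inner_smul_right, inner_plane, A₀v_apply_zero, A₀v_apply_one,
      norm_sq_plane]
    ring
  rw [e]
  have := hD.one_sub_pos
  have := norm_pos_iff.2 hx
  positivity

lemma paraxial_paraxialInv (x : Plane) : D.paraxial (D.paraxialInv x) = x := by
  have hs := hD.s₀_pos.ne'
  have hc := hD.c₀_pos.ne'
  have hz := hD.zint_pos.ne'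
  have key := hD.c₀s₀_sq
  rw [norm_sq_plane] at key
  have e : ∀ a : ℝ, D.zint * D.c₀ * (1 / (D.c₀ * D.s₀) ^ 3 * (D.s₀ / D.zint * ((D.c₀ * D.s₀) ^ 2 * a)))
      = a := fun a => by field_simp
  have h0 : (D.paraxial (D.paraxialInv x)) 0 = x 0 := by
    rw [← e (x 0), key]
    simp [paraxial_apply, A₀v_apply_zero, paraxialInv, inner_plane]
    ring
  have h1 : (D.paraxial (D.paraxialInv x)) 1 = x 1 := by
    rw [← e (x 1), key]
    simp [paraxial_apply, A₀v_apply_one, paraxialInv, inner_plane]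
    ring
  ext i; fin_cases i
  · exact h0
  · exact h1

lemma paraxialInv_paraxial (x : Plane) : D.paraxialInv (D.paraxial x) = x := by
  have h : (D.paraxial : Plane →ₗ[ℝ] Plane) * (D.paraxialInv : Plane →ₗ[ℝ] Plane) = 1 :=
    LinearMap.ext fun x => hD.paraxial_paraxialInv x
  exact LinearMap.congr_fun (mul_eq_one_comm.1 h) x

lemma paraxialInv_symm (x y : Plane) :
    inner ℝ x (D.paraxialInv y) = inner ℝ (D.paraxialInv x) y := by
  have := hD.paraxial_symm (D.paraxialInv x) (D.paraxialInv y)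
  rw [hD.paraxial_paraxialInv, hD.paraxial_paraxialInv] at this
  exact this.symm

/-- Diagonalization of `z_int c₀ A₀` in an orthonormal basis. -/
lemma exists_eigenbasis : ∃ (b : OrthonormalBasis (Fin 2) ℝ Plane) (lam : Fin 2 → ℝ),
    (∀ i, 0 < lam i) ∧ (∀ i, D.paraxial (b i) = lam i • b i) ∧
      D.paraxial.toLinearMap.det = lam 0 * lam 1 := by
  have hs : D.paraxial.toLinearMap.IsSymmetric := fun x y => (hD.paraxial_symm x y).symm
  have hn : Module.finrank ℝ Plane = 2 := by simp
  have he : ∀ i, D.paraxial (hs.eigenvectorBasis hn i) =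
      hs.eigenvalues hn i • hs.eigenvectorBasis hn i := fun i =>
    hs.apply_eigenvectorBasis hn i
  refine ⟨hs.eigenvectorBasis hn, hs.eigenvalues hn, fun i => ?_, he, ?_⟩
  · have h := hD.paraxial_pos (x := hs.eigenvectorBasis hn i)
      ((hs.eigenvectorBasis hn).orthonormal.ne_zero i)
    rw [he, inner_smul_right] at h
    simpa using h
  · rw [hs.det_eq_prod_eigenvalues hn, Fin.prod_univ_two]; rfl

lemma det_paraxial_pos : 0 < D.paraxial.toLinearMap.det := by
  obtain ⟨b, lam, hl, -, h⟩ := hD.exists_eigenbasis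
  rw [h]; exact mul_pos (hl 0) (hl 1)

end Admissible

/-! ### The Fresnel integral -/

/-- The amplitude `2π / (iω √det(z_int c₀ A₀))` of the paraxial Green's function. -/
noncomputable def fresnelAmp (D : Setup) (ω : ℝ) : ℂ :=
  2 * Real.pi / (Complex.I * ω * (√(D.paraxial.toLinearMap.det) : ℝ))

/-- The Gaussian regularization of the Fresnel integral
`∫ e^{iω q·ξ} e^{-iω q·(z_int c₀ A₀) q / 2} dq`. -/
noncomputable def fresnelReg (D : Setup) (ω δ : ℝ) (ξ : Plane) : ℂ :=
  ∫ q : Plane, (Real.exp (-(δ * ‖q‖ ^ 2)) : ℂ) * (cis (ω * inner ℝ q ξ) * D.U₀ ω q D.zint)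

lemma fresnelReg_eq {b : OrthonormalBasis (Fin 2) ℝ Plane} {lam : Fin 2 → ℝ}
    (hb : ∀ i, D.paraxial (b i) = lam i • b i) (ω : ℝ) {δ : ℝ} (hδ : 0 < δ) (ξ : Plane) :
    D.fresnelReg ω δ ξ = ∏ i, (Real.pi / ((δ : ℂ) + Complex.I * (ω * lam i / 2 : ℝ))) ^ (1 / 2 : ℂ) *
      Complex.exp ((Complex.I * (ω * inner ℝ (b i) ξ : ℝ)) ^ 2 /
        (4 * ((δ : ℂ) + Complex.I * (ω * lam i / 2 : ℝ)))) := by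
  rw [← GaussianFourier.integral_cexp_neg_sum_mul_add (fun i => by simp [hδ])]
  have h1 := (b.measurePreserving_repr_symm).integral_comp
    b.repr.symm.toHomeomorph.measurableEmbedding
    (fun q : Plane => (Real.exp (-(δ * ‖q‖ ^ 2)) : ℂ) *
      (cis (ω * inner ℝ q ξ) * D.U₀ ω q D.zint))
  rw [fresnelReg, ← h1, ← (PiLp.volume_preserving_toLp (Fin 2)).integral_comp
    (MeasurableEquiv.toLp 2 (Fin 2 → ℝ)).measurableEmbedding]
  congr 1; ext v
  set q : Plane := b.repr.symm (WithLp.toLp 2 v) with hq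
  have hqs : q = v 0 • b 0 + v 1 • b 1 := by
    have := b.sum_repr q
    rw [Fin.sum_univ_two] at this
    rw [← this]
    simp [hq]
  have hn : ‖q‖ ^ 2 = v 0 ^ 2 + v 1 ^ 2 := by
    rw [hq, LinearIsometryEquiv.norm_map, norm_sq_plane]
  have hbi : ∀ i j, inner ℝ (b i) (b j) = if i = j then (1 : ℝ) else 0 :=
    fun i j => orthonormal_iff_ite.1 b.orthonormal i j
  have hM : inner ℝ q (D.paraxial q) = lam 0 * v 0 ^ 2 + lam 1 * v 1 ^ 2 := by
    rw [hqs]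
    simp only [map_add, map_smul, hb, inner_add_left, inner_add_right, inner_smul_left,
      inner_smul_right, hbi]
    simp; ring
  have hξ : inner ℝ q ξ = v 0 * inner ℝ (b 0) ξ + v 1 * inner ℝ (b 1) ξ := by
    rw [hqs]; simp [inner_add_left, inner_smul_left]
  rw [U₀_eq, hn, hM, hξ, cis, cis, Complex.ofReal_exp, ← Complex.exp_add, ← Complex.exp_add]
  congr 1
  simp only [Fin.sum_univ_two]
  push_cast
  ring

namespace Admissible

variable (hD : D.Admissible)
include hD

lemma inner_paraxialInv_eq {b : OrthonormalBasis (Fin 2) ℝ Plane} {lam : Fin 2 → ℝ}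
    (hl : ∀ i, 0 < lam i) (hb : ∀ i, D.paraxial (b i) = lam i • b i) (ξ : Plane) :
    inner ℝ ξ (D.paraxialInv ξ) = inner ℝ (b 0) ξ ^ 2 / lam 0 + inner ℝ (b 1) ξ ^ 2 / lam 1 := by
  have hi : ∀ i, D.paraxialInv (b i) = (lam i)⁻¹ • b i := fun i => by
    have h := hD.paraxialInv_paraxial (b i)
    rw [hb, map_smul] at h
    rw [← h, inv_smul_smul₀ (hl i).ne', h]
  have e := b.sum_repr' ξ
  rw [Fin.sum_univ_two] at e
  have : D.paraxialInv ξ = inner ℝ (b 0) ξ • (lam 0)⁻¹ • b 0 + inner ℝ (b 1) ξ • (lam 1)⁻¹ • b 1 := by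
    conv_lhs => rw [← e]
    simp [hi]
  rw [this]
  simp only [inner_add_right, inner_smul_right, real_inner_comm ξ]
  ring

/-- The regularized Fresnel integrals are bounded uniformly in the regularization. -/
lemma norm_fresnelReg_le {ω : ℝ} (hω : ω ≠ 0) :
    ∃ C, ∀ δ > 0, ∀ ξ, ‖D.fresnelReg ω δ ξ‖ ≤ C := by
  obtain ⟨b, lam, hl, hb, -⟩ := hD.exists_eigenbasis
  refine ⟨∏ i, (Real.pi / |ω * lam i / 2|) ^ (1 / 2 : ℝ), fun δ hδ ξ => ?_⟩
  rw [fresnelReg_eq hb ω hδ, norm_prod]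
  refine Finset.prod_le_prod (fun _ _ => norm_nonneg _) fun i _ => ?_
  have hβ : 0 < |ω * lam i / 2| := abs_pos.2 (by have := (hl i).ne'; positivity)
  set β := ω * lam i / 2
  set z : ℂ := (δ : ℂ) + Complex.I * (β : ℝ) with hz
  have hre : z.re = δ := by simp [hz]
  have him : z.im = β := by simp [hz]
  have hz0 : z ≠ 0 := fun h => by rw [h] at hre; simp at hre; linarith
  have hzβ : |β| ≤ ‖z‖ := by rw [← him]; exact Complex.abs_im_le_norm z
  rw [norm_mul]
  have h1 : ‖((Real.pi : ℂ) / z) ^ (1 / 2 : ℂ)‖ ≤ (Real.pi / |β|) ^ (1 / 2 : ℝ) := by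
    have : (1 / 2 : ℂ) = ((1 / 2 : ℝ) : ℂ) := by norm_num
    rw [this, Complex.norm_cpow_real, norm_div, Complex.norm_real,
      Real.norm_of_nonneg Real.pi_pos.le]
    gcongr
  have h2 : ‖Complex.exp ((Complex.I * (ω * inner ℝ (b i) ξ : ℝ)) ^ 2 / (4 * z))‖ ≤ 1 := by
    rw [Complex.norm_exp, Real.exp_le_one_iff]
    set a : ℝ := ω * inner ℝ (b i) ξ
    have : (Complex.I * (a : ℂ)) ^ 2 / (4 * z) = ((-(a ^ 2) / 4 : ℝ) : ℂ) * z⁻¹ := by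
      rw [mul_pow, Complex.I_sq]; push_cast; field_simp
    rw [this, Complex.re_ofReal_mul, Complex.inv_re, hre]
    have : 0 ≤ δ / Complex.normSq z := div_nonneg hδ.le (Complex.normSq_nonneg z)
    nlinarith [sq_nonneg a]
  calc _ ≤ (Real.pi / |β|) ^ (1 / 2 : ℝ) * 1 := by gcongr
    _ = _ := mul_one _

lemma prod_sqrt_eq_fresnelAmp {lam : Fin 2 → ℝ} (hl : ∀ i, 0 < lam i)
    (hdet : D.paraxial.toLinearMap.det = lam 0 * lam 1) {ω : ℝ} (hω : ω ≠ 0) :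
    ∏ i, (Real.pi / (Complex.I * (ω * lam i / 2 : ℝ))) ^ (1 / 2 : ℂ) = D.fresnelAmp ω := by
  set w : ℂ := Real.pi / (Complex.I * (ω / 2 : ℝ)) with hw
  have hω' : (ω : ℂ) ≠ 0 := by exact_mod_cast hω
  have hsplit : ∀ i, (Real.pi / (Complex.I * (ω * lam i / 2 : ℝ)) : ℂ) ^ (1 / 2 : ℂ) =
      ((√(lam i))⁻¹ : ℝ) * w ^ (1 / 2 : ℂ) := by
    intro i
    have h0 : (lam i : ℂ) ≠ 0 := by exact_mod_cast (hl i).ne'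
    have hw0 : w ≠ 0 := div_ne_zero (by exact_mod_cast Real.pi_ne_zero)
      (mul_ne_zero Complex.I_ne_zero (by push_cast; simpa using hω))
    have hr : 0 < (lam i)⁻¹ := inv_pos.2 (hl i)
    have : (Real.pi / (Complex.I * (ω * lam i / 2 : ℝ)) : ℂ) = (((lam i)⁻¹ : ℝ) : ℂ) * w := by
      rw [hw]; push_cast; field_simp [Complex.I_ne_zero]
    rw [this, Complex.cpow_def_of_ne_zero (mul_ne_zero (by exact_mod_cast hr.ne') hw0),
      Complex.log_ofReal_mul hr hw0, add_mul, Complex.exp_add, ← Complex.cpow_def_of_ne_zero hw0,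
      Complex.ofReal_log hr.le, ← Complex.cpow_def_of_ne_zero (by exact_mod_cast hr.ne')]
    congr 1
    rw [show (1 / 2 : ℂ) = ((1 / 2 : ℝ) : ℂ) by norm_num, ← Complex.ofReal_cpow hr.le,
      ← Real.sqrt_eq_rpow, Real.sqrt_inv]
  simp only [Fin.prod_univ_two, hsplit]
  have hsq : w ^ (1 / 2 : ℂ) * w ^ (1 / 2 : ℂ) = w := by
    have := Complex.cpow_nat_inv_pow w two_ne_zero
    rw [pow_two] at this
    simpa [one_div] using this
  rw [mul_mul_mul_comm, hsq, fresnelAmp, hdet, Real.sqrt_mul (hl 0).le, hw]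
  have h0 : ((√(lam 0) : ℝ) : ℂ) ≠ 0 := by exact_mod_cast (Real.sqrt_pos.2 (hl 0)).ne'
  have h1 : ((√(lam 1) : ℝ) : ℂ) ≠ 0 := by exact_mod_cast (Real.sqrt_pos.2 (hl 1)).ne'
  push_cast
  field_simp [Complex.I_ne_zero]

/-- The Fresnel integral. -/
lemma tendsto_fresnelReg {ω : ℝ} (hω : ω ≠ 0) (ξ : Plane) :
    Tendsto (fun δ => D.fresnelReg ω δ ξ) (𝓝[>] 0)
      (𝓝 (D.fresnelAmp ω * cis (ω * (inner ℝ ξ (D.paraxialInv ξ) / 2)))) := by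
  obtain ⟨b, lam, hl, hb, hdet⟩ := hD.exists_eigenbasis
  have hval : D.fresnelAmp ω * cis (ω * (inner ℝ ξ (D.paraxialInv ξ) / 2)) =
      ∏ i, (Real.pi / (((0 : ℝ) : ℂ) + Complex.I * (ω * lam i / 2 : ℝ))) ^ (1 / 2 : ℂ) *
      Complex.exp ((Complex.I * (ω * inner ℝ (b i) ξ : ℝ)) ^ 2 /
        (4 * (((0 : ℝ) : ℂ) + Complex.I * (ω * lam i / 2 : ℝ)))) := by
    rw [Finset.prod_mul_distrib, ← Complex.exp_sum]
    simp only [Complex.ofReal_zero, zero_add]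
    rw [hD.prod_sqrt_eq_fresnelAmp hl hdet hω, hD.inner_paraxialInv_eq hl hb, cis]
    congr 2
    have hω' : (ω : ℂ) ≠ 0 := by exact_mod_cast hω
    have h0 : (lam 0 : ℂ) ≠ 0 := by exact_mod_cast (hl 0).ne'
    have h1 : (lam 1 : ℂ) ≠ 0 := by exact_mod_cast (hl 1).ne'
    simp only [Fin.sum_univ_two, mul_pow, Complex.I_sq]
    push_cast
    field_simp [Complex.I_ne_zero]
    linear_combination (4 : ℂ) * ((inner ℝ (b 0) ξ : ℂ) ^ 2 * lam 1 +
      (inner ℝ (b 1) ξ : ℂ) ^ 2 * lam 0) * Complex.I_sq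
  rw [hval]
  have hev : ∀ᶠ δ in 𝓝[>] (0 : ℝ), D.fresnelReg ω δ ξ =
      ∏ i, (Real.pi / ((δ : ℂ) + Complex.I * (ω * lam i / 2 : ℝ))) ^ (1 / 2 : ℂ) *
      Complex.exp ((Complex.I * (ω * inner ℝ (b i) ξ : ℝ)) ^ 2 /
        (4 * ((δ : ℂ) + Complex.I * (ω * lam i / 2 : ℝ)))) := by
    filter_upwards [self_mem_nhdsWithin] with δ hδ using fresnelReg_eq hb ω hδ ξ
  refine Tendsto.congr' (hev.mono fun _ h => h.symm) (tendsto_nhdsWithin_of_tendsto_nhds ?_)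
  refine tendsto_finsetProd _ fun i _ => ?_
  have hz0 : ((0 : ℝ) : ℂ) + Complex.I * (ω * lam i / 2 : ℝ) ≠ 0 := by
    rw [Complex.ofReal_zero, zero_add]
    refine mul_ne_zero Complex.I_ne_zero ?_
    have := (hl i).ne'
    exact_mod_cast (by positivity : ω * lam i / 2 ≠ 0)
  have hc : ContinuousAt (fun δ : ℝ => (δ : ℂ) + Complex.I * (ω * lam i / 2 : ℝ)) 0 := by fun_prop
  have hd : ContinuousAt (fun δ : ℝ => (Real.pi : ℂ) / ((δ : ℂ) + Complex.I * (ω * lam i / 2 : ℝ))) 0 :=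
    continuousAt_const.div hc hz0
  have h1 : ContinuousAt (fun δ : ℝ =>
      (Real.pi / ((δ : ℂ) + Complex.I * (ω * lam i / 2 : ℝ))) ^ (1 / 2 : ℂ)) 0 := by
    refine hd.cpow continuousAt_const ?_
    refine Or.inr ?_
    rw [Complex.ofReal_zero, zero_add, div_eq_mul_inv, mul_inv, Complex.inv_I]
    have : (Real.pi : ℂ) * (-Complex.I * (((ω * lam i / 2 : ℝ) : ℂ))⁻¹) =
        ((-(Real.pi * (ω * lam i / 2)⁻¹) : ℝ) : ℂ) * Complex.I := by push_cast; ring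
    rw [this, Complex.im_ofReal_mul, Complex.I_im, mul_one]
    have := (hl i).ne'
    have := Real.pi_ne_zero
    exact neg_ne_zero.2 (by positivity)
  have h2 : ContinuousAt (fun δ : ℝ => Complex.exp ((Complex.I * (ω * inner ℝ (b i) ξ : ℝ)) ^ 2 /
        (4 * ((δ : ℂ) + Complex.I * (ω * lam i / 2 : ℝ))))) 0 :=
    (continuousAt_const.div (continuousAt_const.mul hc) (mul_ne_zero (by norm_num) hz0)).cexp
  exact (h1.mul h2).tendsto

end Admissible

end Setup

/-! ### The incident field on the interface -/

namespace Setup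

variable {D : Setup}

namespace Admissible

variable (hD : D.Admissible)
include hD

lemma norm_hatΨ_le (ω : ℝ) (q : Plane) : ‖D.hatΨ ω q‖ ≤ ∫ tx, ‖D.Ψ tx‖ := by
  refine (norm_integral_le_integral_norm _).trans_eq ?_
  simp

lemma continuous_hatΨ : Continuous fun z : ℝ × Plane => D.hatΨ z.1 z.2 := by
  refine continuous_of_dominated (bound := fun tx => ‖D.Ψ tx‖) (fun z => ?_)
    (fun z => Eventually.of_forall fun tx => by simp) hD.Ψ_integrable.norm
    (Eventually.of_forall fun tx => by fun_prop)
  exact (hD.Ψ_integrable.ofReal (𝕜 := ℂ)).aestronglyMeasurable.mul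
    (Continuous.aestronglyMeasurable (by fun_prop))

/-- The transform of the source is supported in a bounded set of frequencies and slownesses, at
a positive distance from zero frequency. -/
lemma exists_support : ∃ ω₀ > 0, ∃ R > 0, ∀ ω q, D.hatΨ ω q ≠ 0 →
    ω₀ ≤ |ω| ∧ |ω| ≤ R ∧ ‖q‖ ≤ R := by
  obtain ⟨ω₀, h0, hlow⟩ := hD.hatΨ_low
  obtain ⟨R, hR⟩ := hD.hatΨ_support.isBounded.subset_closedBall (0 : ℝ × Plane)
  refine ⟨ω₀, h0, max R 1, by positivity, fun ω q h => ⟨?_, ?_⟩⟩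
  · by_contra hc; exact h (hlow ω q (not_le.1 hc))
  · have : (ω, q) ∈ Metric.closedBall (0 : ℝ × Plane) R := hR (subset_tsupport _ h)
    rw [mem_closedBall_zero_iff, Prod.norm_mk, max_le_iff, Real.norm_eq_abs] at this
    exact ⟨this.1.trans (le_max_left _ _), this.2.trans (le_max_left _ _)⟩

lemma continuous_U₀ : Continuous fun z : ℝ × Plane => D.U₀ z.1 z.2 D.zint := by
  simp only [U₀_eq]
  fun_prop

lemma norm_U₀ (ω : ℝ) (q : Plane) : ‖D.U₀ ω q D.zint‖ = 1 := by simp [U₀]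

end Admissible

/-- The wave `∫ e^{iω q·X} 𝒰̂₀(ω, q, z_int) Ψ̂(ω, q) dq` that reaches the interface at the rescaled
lateral position `X`. -/
noncomputable def incident (D : Setup) (ω : ℝ) (X : Plane) : ℂ :=
  ∫ q : Plane, cis (ω * inner ℝ q X) * (D.U₀ ω q D.zint * D.hatΨ ω q)

namespace Admissible

variable (hD : D.Admissible)
include hD

lemma norm_incident_integrand_le :
    ∃ B : Plane → ℝ, Integrable B ∧ ∀ ω X q,
      ‖cis (ω * inner ℝ q X) * (D.U₀ ω q D.zint * D.hatΨ ω q)‖ ≤ B q := by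
  obtain ⟨ω₀, -, R, -, h⟩ := hD.exists_support
  refine ⟨(Metric.closedBall 0 R).indicator fun _ => ∫ tx, ‖D.Ψ tx‖, ?_, fun ω X q => ?_⟩
  · exact (integrable_indicator_iff Metric.isClosed_closedBall.measurableSet).2
      (integrableOn_const (isCompact_closedBall _ _).measure_lt_top.ne)
  · rw [norm_mul, norm_mul, norm_cis, hD.norm_U₀, one_mul, one_mul]
    by_cases hq : D.hatΨ ω q = 0
    · rw [hq, norm_zero]
      exact Set.indicator_nonneg (fun _ _ => integral_nonneg fun _ => norm_nonneg _) _
    · rw [Set.indicator_of_mem (by simpa using (h ω q hq).2.2)]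
      exact hD.norm_hatΨ_le ω q

lemma continuous_U₀_mul_hatΨ :
    Continuous fun z : ℝ × Plane => D.U₀ z.1 z.2 D.zint * D.hatΨ z.1 z.2 :=
  hD.continuous_U₀.mul hD.continuous_hatΨ

lemma continuous_U₀_mul_hatΨ_left (ω : ℝ) :
    Continuous fun q : Plane => D.U₀ ω q D.zint * D.hatΨ ω q :=
  hD.continuous_U₀_mul_hatΨ.comp (g := fun z : ℝ × Plane => D.U₀ z.1 z.2 D.zint * D.hatΨ z.1 z.2)
    (f := fun q : Plane => (ω, q)) (by fun_prop)

lemma integrable_U₀_mul_hatΨ (ω : ℝ) : Integrable fun q => D.U₀ ω q D.zint * D.hatΨ ω q := by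
  obtain ⟨B, hB, h⟩ := hD.norm_incident_integrand_le
  refine hB.mono' (hD.continuous_U₀_mul_hatΨ_left ω).aestronglyMeasurable
    (Eventually.of_forall fun q => ?_)
  simpa using h ω 0 q

lemma continuous_incident : Continuous fun z : ℝ × Plane => D.incident z.1 z.2 := by
  obtain ⟨B, hB, h⟩ := hD.norm_incident_integrand_le
  refine continuous_of_dominated (fun z => ?_) (fun z => Eventually.of_forall fun q => h z.1 z.2 q)
    hB (Eventually.of_forall fun q => ?_)
  · have := hD.continuous_U₀_mul_hatΨ_left z.1
    exact Continuous.aestronglyMeasurable (by fun_prop)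
  · have := hD.continuous_U₀_mul_hatΨ.comp (f := fun z : ℝ × Plane => (z.1, q)) (by fun_prop)
    exact (by fun_prop : Continuous fun z : ℝ × Plane => cis (z.1 * inner ℝ q z.2)).mul this

lemma exists_norm_incident_le : ∃ C, ∀ ω X, ‖D.incident ω X‖ ≤ C := by
  obtain ⟨B, hB, h⟩ := hD.norm_incident_integrand_le
  exact ⟨∫ q, B q, fun ω X => norm_integral_le_of_norm_le hB (Eventually.of_forall (h ω X))⟩

lemma exists_incident_support : ∃ ω₀ > 0, ∃ R > 0, ∀ ω X, D.incident ω X ≠ 0 →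
    ω₀ ≤ |ω| ∧ |ω| ≤ R := by
  obtain ⟨ω₀, h0, R, hR, h⟩ := hD.exists_support
  refine ⟨ω₀, h0, R, hR, fun ω X hne => ?_⟩
  by_contra hc
  refine hne ?_
  have : ∀ q, D.hatΨ ω q = 0 := fun q => by
    by_contra hq
    exact hc ⟨(h ω q hq).1, (h ω q hq).2.1⟩
  simp [incident, this]

omit hD in
lemma conj_hatΨ (ω : ℝ) (q : Plane) : conj (D.hatΨ ω q) = D.hatΨ (-ω) q := by
  rw [hatΨ, ← integral_conj, hatΨ]
  congr 1; ext tx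
  rw [map_mul, Complex.conj_ofReal, conj_cis]
  congr 2; ring

omit hD in
lemma conj_incident (ω : ℝ) (X : Plane) : conj (D.incident ω X) = D.incident (-ω) X := by
  rw [incident, ← integral_conj, incident]
  congr 1; ext q
  rw [map_mul, map_mul, U₀_eq, U₀_eq, conj_cis, conj_cis, conj_hatΨ]
  congr 2
  · ring
  · congr 2; ring

/-- Decay of the paraxial propagator acting on a smooth cutoff, by integration by parts. -/
lemma exists_propagator_decay (χ : 𝓢(Plane, ℂ)) {ω₀ R : ℝ} (h0 : 0 < ω₀) (k : ℕ) :
    ∃ C, ∀ (ω : ℝ) (X : Plane), ω₀ ≤ |ω| → |ω| ≤ R →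
      ‖X‖ ^ k * ‖∫ q, χ q * cis (ω * inner ℝ q X - ω * (inner ℝ q (D.paraxial q) / 2))‖ ≤ C := by
  let ι := {i : ℝ × Plane // ω₀ ≤ |i.1| ∧ |i.1| ≤ R}
  let p : ι → Plane → ℝ := fun i q =>
    i.1.1 * inner ℝ q i.1.2 - i.1.1 * (inner ℝ q (D.paraxial q) / 2)
  have hp : ∀ i, Continuous (p i) := fun i => by fun_prop
  suffices H : ∀ χ : 𝓢(Plane, ℂ), ∃ C, ∀ i : ι, ‖i.1.2‖ ^ k * ‖∫ q, χ q * cis (p i q)‖ ≤ C by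
    obtain ⟨C, hC⟩ := H χ
    exact ⟨C, fun ω X h1 h2 => hC ⟨(ω, X), h1, h2⟩⟩
  induction k with
  | zero =>
    intro χ
    obtain ⟨C, hC⟩ := norm_oscillatory_le (μ := (volume : Measure Plane)) χ
    exact ⟨C, fun i => by simpa using hC (p i)⟩
  | succ k ih =>
    intro χ
    have hstep : ∀ j : Fin 2, ∃ C, ∀ i : ι, |(i.1.2) j| *
        (‖i.1.2‖ ^ k * ‖∫ q, χ q * cis (p i q)‖) ≤ C := by
      intro j
      let e : Plane := EuclideanSpace.single j 1
      have hd : ∀ (i : ι) w, HasLineDerivAt ℝ (p i) (i.1.1 * (i.1.2) j +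
          (-i.1.1 • (innerSL ℝ e).comp D.paraxial) w) w e := by
        intro i w
        have h1 : HasDerivAt (fun t : ℝ => w + t • e) e 0 := by
          simpa using ((hasDerivAt_id (0 : ℝ)).smul_const e).const_add w
        have h2 := h1.inner ℝ (hasDerivAt_const (0 : ℝ) i.1.2)
        have h3 := h1.inner ℝ (D.paraxial.hasFDerivAt.comp_hasDerivAt (0 : ℝ) h1)
        have h4 := (h2.const_mul i.1.1).sub ((h3.div_const 2).const_mul i.1.1)
        refine h4.congr_deriv ?_
        have e1 : inner ℝ e i.1.2 = (i.1.2) j := by simp [e, EuclideanSpace.inner_single_left]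
        have e2 : inner ℝ w (D.paraxial e) = inner ℝ e (D.paraxial w) := by
          rw [hD.paraxial_symm, real_inner_comm]
        simp only [zero_smul, add_zero, inner_zero_right, zero_add, e1, e2, Function.comp_apply]
        simp
        ring
      obtain ⟨C, hC⟩ := bounded_oscillatory_step (μ := (volume : Measure Plane)) hp e
        (lam := fun i => i.1.1 * (i.1.2) j) (N := fun _ => 1) (W := fun i => ‖i.1.2‖ ^ k)
        (C₀ := R * ‖(innerSL ℝ e).comp D.paraxial‖) hd
        (fun i => by
          rw [norm_smul, norm_neg, Real.norm_eq_abs, mul_one]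
          exact mul_le_mul_of_nonneg_right i.2.2 (norm_nonneg _))
        (fun _ => le_rfl) (fun _ => by positivity) (by simpa using ih) χ
      refine ⟨ω₀⁻¹ * C, fun i => ?_⟩
      have h1 := hC i
      rw [abs_mul] at h1
      rw [← div_eq_inv_mul, le_div_iff₀ h0]
      refine le_trans ?_ h1
      have : ω₀ * (|(i.1.2) j| * (‖i.1.2‖ ^ k * ‖∫ q, χ q * cis (p i q)‖)) ≤
          |i.1.1| * (|(i.1.2) j| * (‖i.1.2‖ ^ k * ‖∫ q, χ q * cis (p i q)‖)) :=
        mul_le_mul_of_nonneg_right i.2.1 (by positivity)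
      linarith
    obtain ⟨C, hC⟩ := bounded_norm_of_bounded_coords (fun i => by positivity) hstep
    exact ⟨C, fun i => by rw [pow_succ']; simpa [mul_assoc] using hC i⟩

/-- The incident field is the convolution of the integrable source with a rapidly decaying
propagator; it is therefore dominated, uniformly in the frequency, by an integrable function. -/
lemma exists_integrable_bound_incident :
    ∃ B : Plane → ℝ, Integrable B ∧ ∀ ω X, ‖D.incident ω X‖ ≤ B X := by
  obtain ⟨ω₀, h0, R, hR, hsupp⟩ := hD.exists_support
  -- a smooth cutoff equal to one on the support of the transform
  let bump : ContDiffBump (0 : Plane) := ⟨R, R + 1, hR, by linarith⟩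
  have hcs : HasCompactSupport fun q : Plane => ((bump q : ℝ) : ℂ) :=
    bump.hasCompactSupport.comp_left (g := fun x : ℝ => (x : ℂ)) (by simp)
  let χ : 𝓢(Plane, ℂ) := hcs.toSchwartzMap (Complex.ofRealCLM.contDiff.comp bump.contDiff)
  have hχ : ∀ q, χ q = ((bump q : ℝ) : ℂ) := fun q => rfl
  obtain ⟨C1, h1⟩ := hD.exists_propagator_decay χ (R := R) h0 0
  obtain ⟨C3, h3⟩ := hD.exists_propagator_decay χ (R := R) h0 3
  set H : ℝ → Plane → ℂ := fun ω X =>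
    ∫ q, χ q * cis (ω * inner ℝ q X - ω * (inner ℝ q (D.paraxial q) / 2)) with hH
  set C := 4 * (|C1| + |C3|) with hC
  have hdecay : ∀ ω X, ω₀ ≤ |ω| → |ω| ≤ R → ‖H ω X‖ ≤ C * (1 + ‖X‖) ^ (-3 : ℝ) := by
    intro ω X hω1 hω2
    have k1 := h1 ω X hω1 hω2
    have k3 := h3 ω X hω1 hω2
    rw [pow_zero, one_mul] at k1
    rw [Real.rpow_neg (by positivity), ← div_eq_mul_inv, le_div_iff₀ (by positivity)]
    rw [show (3 : ℝ) = ((3 : ℕ) : ℝ) by norm_num, Real.rpow_natCast]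
    have hx := norm_nonneg X
    have : (1 + ‖X‖) ^ 3 ≤ 4 * (1 + ‖X‖ ^ 3) := by nlinarith [sq_nonneg (‖X‖ - 1)]
    calc ‖H ω X‖ * (1 + ‖X‖) ^ 3 ≤ ‖H ω X‖ * (4 * (1 + ‖X‖ ^ 3)) := by gcongr
      _ = 4 * (‖H ω X‖ + ‖X‖ ^ 3 * ‖H ω X‖) := by ring
      _ ≤ C := by rw [hC]; gcongr; exacts [k1.trans (le_abs_self _), k3.trans (le_abs_self _)]
  have hint3 : Integrable fun X : Plane => (1 + ‖X‖) ^ (-3 : ℝ) :=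
    integrable_one_add_norm (by simp; norm_num)
  have hC0 : 0 ≤ C := by positivity
  -- the dominating function is itself a convolution
  have hpr : Integrable (fun z : Plane × (ℝ × Plane) =>
      ‖D.Ψ z.2‖ * (C * (1 + ‖z.1 - z.2.2‖) ^ (-3 : ℝ))) (volume.prod volume) := by
    have hm : AEStronglyMeasurable (fun z : Plane × (ℝ × Plane) =>
        ‖D.Ψ z.2‖ * (C * (1 + ‖z.1 - z.2.2‖) ^ (-3 : ℝ))) (volume.prod volume) := by
      refine hD.Ψ_integrable.aestronglyMeasurable.comp_snd.norm.mul ?_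
      exact Measurable.aestronglyMeasurable (by fun_prop)
    refine (integrable_prod_iff' hm).2 ⟨Eventually.of_forall fun tx => ?_, ?_⟩
    · exact ((hint3.comp_sub_right tx.2).const_mul C).const_mul ‖D.Ψ tx‖
    · have : ∀ tx : ℝ × Plane, ∫ X : Plane, ‖‖D.Ψ tx‖ * (C * (1 + ‖X - tx.2‖) ^ (-3 : ℝ))‖ =
          ‖D.Ψ tx‖ * (C * ∫ X : Plane, (1 + ‖X‖) ^ (-3 : ℝ)) := by
        intro tx
        have e : ∀ X : Plane, ‖‖D.Ψ tx‖ * (C * (1 + ‖X - tx.2‖) ^ (-3 : ℝ))‖ =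
            ‖D.Ψ tx‖ * (C * (1 + ‖X - tx.2‖) ^ (-3 : ℝ)) := fun X =>
          Real.norm_of_nonneg (by positivity)
        simp only [e]
        rw [integral_const_mul, integral_const_mul,
          integral_sub_right_eq_self (fun X : Plane => (1 + ‖X‖) ^ (-3 : ℝ))]
      simp only [this]
      exact hD.Ψ_integrable.norm.mul_const _
  refine ⟨fun X => ∫ tx : ℝ × Plane, ‖D.Ψ tx‖ * (C * (1 + ‖X - tx.2‖) ^ (-3 : ℝ)),
    hpr.integral_prod_left, fun ω X => ?_⟩
  by_cases hω : ω₀ ≤ |ω| ∧ |ω| ≤ R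
  swap
  · have : ∀ q, D.hatΨ ω q = 0 := fun q => by
      by_contra hq; exact hω ⟨(hsupp ω q hq).1, (hsupp ω q hq).2.1⟩
    simp only [incident, this, mul_zero, integral_zero, norm_zero]
    exact integral_nonneg fun tx => by positivity
  have hconv : D.incident ω X = ∫ tx : ℝ × Plane, ((D.Ψ tx : ℂ) * cis (ω * tx.1)) * H ω (X - tx.2) := by
    have e1 : ∀ q, cis (ω * inner ℝ q X) * (D.U₀ ω q D.zint * D.hatΨ ω q) =
        ∫ tx : ℝ × Plane, ((D.Ψ tx : ℂ) * cis (ω * tx.1)) *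
          (χ q * cis (ω * inner ℝ q (X - tx.2) - ω * (inner ℝ q (D.paraxial q) / 2))) := by
      intro q
      have hcut : D.hatΨ ω q = χ q * D.hatΨ ω q := by
        by_cases hq : D.hatΨ ω q = 0
        · simp [hq]
        · rw [hχ, bump.one_of_mem_closedBall (by simpa using (hsupp ω q hq).2.2)]; simp
      rw [hcut, hatΨ, ← integral_const_mul, ← integral_const_mul, ← integral_const_mul]
      congr 1; ext tx
      have e2 : cis (ω * inner ℝ q (X - tx.2) - ω * (inner ℝ q (D.paraxial q) / 2)) * cis (ω * tx.1) =
          cis (ω * inner ℝ q X) * D.U₀ ω q D.zint * cis (ω * (tx.1 - inner ℝ q tx.2)) := by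
        rw [U₀_eq, ← cis_add, ← cis_add, ← cis_add, inner_sub_right]
        congr 1; ring
      linear_combination (-(D.Ψ tx : ℂ) * χ q) * e2
    rw [incident]
    simp only [e1]
    rw [integral_integral_swap]
    · congr 1; ext tx; rw [integral_const_mul]
    · have := (χ.integrable (μ := volume)).mul_prod (hD.Ψ_integrable.ofReal (𝕜 := ℂ))
      refine (this.mul_bdd (c := 1) (g := fun z : Plane × (ℝ × Plane) => cis (ω * z.2.1) *
        cis (ω * inner ℝ z.1 (X - z.2.2) - ω * (inner ℝ z.1 (D.paraxial z.1) / 2)))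
        (Continuous.aestronglyMeasurable (by fun_prop)) (by simp)).congr
        (Eventually.of_forall fun z => ?_)
      simp only [Function.uncurry, Complex.coe_algebraMap]
      ring
  rw [hconv]
  refine norm_integral_le_of_norm_le ?_ (Eventually.of_forall fun tx => ?_)
  · refine hD.Ψ_integrable.norm.mul_bdd (c := C) ?_ (Eventually.of_forall fun tx => ?_)
    · exact Measurable.aestronglyMeasurable (by fun_prop)
    · rw [Real.norm_of_nonneg (by positivity)]
      refine mul_le_of_le_one_right hC0 ?_
      exact Real.rpow_le_one_of_one_le_of_nonpos (by linarith [norm_nonneg (X - tx.2)]) (by norm_num)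
  · rw [norm_mul, norm_mul, norm_cis, mul_one, Complex.norm_real]
    gcongr
    exact hdecay ω _ hω.1 hω.2

lemma integrable_incident (ω : ℝ) : Integrable (D.incident ω) := by
  obtain ⟨B, hB, h⟩ := hD.exists_integrable_bound_incident
  have hc : Continuous (D.incident ω) :=
    hD.continuous_incident.comp (f := fun X : Plane => (ω, X)) (by fun_prop)
  exact hB.mono' hc.aestronglyMeasurable (Eventually.of_forall (h ω))

lemma integrable_incident_prod : Integrable fun z : ℝ × Plane => D.incident z.1 z.2 := by
  obtain ⟨B, hB, h⟩ := hD.exists_integrable_bound_incident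
  obtain ⟨ω₀, h0, R, hR, hsupp⟩ := hD.exists_incident_support
  have hI : Integrable ((Set.Icc (-R) R).indicator fun _ => (1 : ℝ)) :=
    (integrable_indicator_iff measurableSet_Icc).2 (integrableOn_const (by simp))
  refine (hI.mul_prod hB).mono' hD.continuous_incident.aestronglyMeasurable
    (Eventually.of_forall fun z => ?_)
  by_cases hz : D.incident z.1 z.2 = 0
  · rw [hz, norm_zero]
    exact mul_nonneg (Set.indicator_nonneg (fun _ _ => zero_le_one) _)
      ((norm_nonneg _).trans (h z.1 z.2))
  · rw [Set.indicator_of_mem (Set.mem_Icc.2 (abs_le.1 (hsupp _ _ hz).2)), one_mul]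
    exact h z.1 z.2

/-- Plancherel's identity for the incident field. -/
lemma integral_norm_sq_incident {ω : ℝ} (hω : ω ≠ 0) :
    ∫ X, ‖D.incident ω X‖ ^ 2 = (2 * Real.pi) ^ 2 / ω ^ 2 * ∫ q, ‖D.hatΨ ω q‖ ^ 2 := by
  have hω' : -ω⁻¹ ≠ 0 := neg_ne_zero.2 (inv_ne_zero hω)
  have e : ∀ k : Plane, ∫ q, cis (-inner ℝ k q) * (D.U₀ ω q D.zint * D.hatΨ ω q) =
      D.incident ω (-ω⁻¹ • k) := by
    intro k
    rw [incident]
    congr 1; ext q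
    rw [inner_smul_right, real_inner_comm]
    congr 2; field_simp
  have key := plancherel_cis (hD.continuous_U₀_mul_hatΨ_left ω) (hD.integrable_U₀_mul_hatΨ ω)
    (by simp only [e]; exact (hD.integrable_incident ω).comp_smul hω')
  simp only [e, norm_mul, hD.norm_U₀, one_mul] at key
  rw [Measure.integral_comp_smul (volume : Measure Plane) (fun X => ‖D.incident ω X‖ ^ 2)] at key
  have hf : Module.finrank ℝ Plane = 2 := by simp
  rw [hf] at key
  have h2 : |((-ω⁻¹) ^ 2)⁻¹| = ω ^ 2 := by
    rw [neg_sq, inv_pow, inv_inv, abs_of_nonneg (sq_nonneg ω)]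
  rw [h2, smul_eq_mul] at key
  rw [div_mul_eq_mul_div, ← key, mul_div_cancel_left₀ _ (pow_ne_zero 2 hω)]

end Admissible

end Setup

/-! ### The reflected wave as an absolutely convergent integral -/

namespace Setup

variable {D : Setup}

/-- The scalar factor of the reflected wave at frequency `ω`. -/
noncomputable def waveAmp (D : Setup) (ω : ℝ) : ℂ :=
  ((ω ^ 4 / (2 * Real.pi) ^ 2 : ℝ) : ℂ) * D.fresnelAmp ω

/-- The deterministic amplitude of the contribution, to the reflected wave, of the frequency `ω` and
of the interface point `X` (in units of `√ε`). -/
noncomputable def source (D : Setup) (z : ℝ × Plane) : ℂ :=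
  D.waveAmp z.1 * D.incident z.1 z.2 * cis (z.1 * (inner ℝ z.2 (D.paraxialInv z.2) / 2))

/-- The random factor imprinted by the interface `U`, as a function of frequency and position. -/
noncomputable def modulation (D : Setup) (U : Plane → ℝ) (ω : ℝ) (x : Plane) : ℂ :=
  cis (ω * (2 * D.s₀) * U x)

@[simp] lemma norm_modulation (U : Plane → ℝ) (ω : ℝ) (x : Plane) : ‖D.modulation U ω x‖ = 1 := by
  simp [modulation]

lemma conj_fresnelAmp (ω : ℝ) : conj (D.fresnelAmp ω) = D.fresnelAmp (-ω) := by
  simp only [fresnelAmp, map_div₀, map_mul, Complex.conj_ofReal, Complex.conj_I, map_ofNat]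
  push_cast
  congr 1; ring

lemma continuousAt_fresnelAmp {ω : ℝ} (hω : ω ≠ 0) (hdet : 0 < D.paraxial.toLinearMap.det) :
    ContinuousAt D.fresnelAmp ω := by
  unfold fresnelAmp
  refine continuousAt_const.div (by fun_prop) ?_
  have := (Real.sqrt_pos.2 hdet).ne'
  exact mul_ne_zero (mul_ne_zero Complex.I_ne_zero (by exact_mod_cast hω)) (by exact_mod_cast this)

lemma conj_source (ω : ℝ) (X : Plane) : conj (D.source (ω, X)) = D.source (-ω, X) := by
  simp only [source, waveAmp, map_mul, conj_fresnelAmp, Admissible.conj_incident, conj_cis,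
    Complex.conj_ofReal]
  congr 2
  · congr 3; ring
  · ring

/-- The scattering operator in the rescaled variable `X = (x' - x_int) / √ε`. -/
lemma scatOp_eq {U : Plane → ℝ} {ε : ℝ} (hε : 0 < ε) (τ ω : ℝ) (q : Plane) :
    D.scatOp U ε τ ω (fun q' => D.U₀ ω q' D.zint * D.hatΨ ω q') q =
      ((ω ^ 2 / (2 * Real.pi) ^ 2 : ℝ) : ℂ) * ∫ X : Plane,
        cis (ω * τ * U ((ε ^ D.γ)⁻¹ • (D.xint + √ε • X))) *
          (cis (-(ω * inner ℝ q X)) * D.incident ω X) := by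
  have hs : √ε ≠ 0 := (Real.sqrt_pos.2 hε).ne'
  set F : Plane → ℂ := fun x' => cis (ω * τ * U ((ε ^ D.γ)⁻¹ • x')) *
      ∫ q' : Plane, cis (ω * inner ℝ (q' - q) (x' - D.xint) / √ε) *
        (D.U₀ ω q' D.zint * D.hatΨ ω q') with hF
  have h1 : ∫ x', F x' = ((√ε) ^ 2 : ℝ) • ∫ X, F (D.xint + √ε • X) := by
    rw [Measure.integral_comp_smul (volume : Measure Plane) (fun x => F (D.xint + x)) (√ε),
      integral_add_left_eq_self F D.xint]
    have hf : Module.finrank ℝ Plane = 2 := by simp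
    rw [hf, abs_of_nonneg (by positivity), smul_smul, mul_inv_cancel₀ (pow_ne_zero 2 hs), one_smul]
  have h2 : ∀ X, F (D.xint + √ε • X) = cis (ω * τ * U ((ε ^ D.γ)⁻¹ • (D.xint + √ε • X))) *
          (cis (-(ω * inner ℝ q X)) * D.incident ω X) := by
    intro X
    simp only [hF, incident]
    simp only [← integral_const_mul]
    congr 1; ext q'
    have e1 : ω * inner ℝ (q' - q) (D.xint + √ε • X - D.xint) / √ε =
        -(ω * inner ℝ q X) + ω * inner ℝ q' X := by
      rw [add_sub_cancel_left, inner_smul_right, inner_sub_left]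
      field_simp
      ring
    rw [e1, cis_add]
    ring
  rw [scatOp, h1, Real.sq_sqrt hε.le, Complex.real_smul, ← mul_assoc, ← Complex.ofReal_mul]
  simp only [h2]
  congr 2
  field_simp

namespace Admissible

variable (hD : D.Admissible)
include hD

/-- `fresnelAmp` is singular at zero frequency, but the source has no low frequencies. -/
lemma continuous_source : Continuous D.source := by
  obtain ⟨ω₀, h0, R, hR, hsupp⟩ := hD.exists_incident_support
  rw [continuous_iff_continuousAt]
  rintro ⟨ω, X⟩
  by_cases hω : ω = 0
  · subst hω
    have : ∀ᶠ z : ℝ × Plane in 𝓝 ((0 : ℝ), X), D.source z = 0 := by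
      have h : ∀ᶠ z : ℝ × Plane in 𝓝 ((0 : ℝ), X), |z.1| < ω₀ :=
        ((continuous_abs.comp continuous_fst).tendsto ((0 : ℝ), X)).eventually_lt_const
          (by simpa using h0)
      filter_upwards [h] with z hz
      have : D.incident z.1 z.2 = 0 := by
        by_contra hc; exact absurd (hsupp _ _ hc).1 (not_le.2 hz)
      simp [source, this]
    have h0 : D.source ((0 : ℝ), X) = 0 := this.self_of_nhds
    rw [ContinuousAt, h0]
    exact tendsto_const_nhds.congr' (this.mono fun z hz => hz.symm)
  · have h1 : ContinuousAt (fun z : ℝ × Plane => D.waveAmp z.1) (ω, X) := by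
      have := (continuousAt_fresnelAmp hω hD.det_paraxial_pos).comp (x := (ω, X))
        (f := fun z : ℝ × Plane => z.1) continuousAt_fst
      unfold waveAmp
      exact ContinuousAt.mul (by fun_prop) this
    unfold source
    exact (h1.mul hD.continuous_incident.continuousAt).mul (by fun_prop)

lemma exists_source_support : ∃ ω₀ > 0, ∃ R > 0, ∀ z, D.source z ≠ 0 → ω₀ ≤ |z.1| ∧ |z.1| ≤ R := by
  obtain ⟨ω₀, h0, R, hR, hsupp⟩ := hD.exists_incident_support
  refine ⟨ω₀, h0, R, hR, fun z hz => hsupp z.1 z.2 fun h => hz ?_⟩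
  simp [source, h]

lemma exists_norm_source_le_incident : ∃ C, ∀ z, ‖D.source z‖ ≤ C * ‖D.incident z.1 z.2‖ := by
  obtain ⟨ω₀, h0, R, hR, hsupp⟩ := hD.exists_incident_support
  obtain ⟨C, hC⟩ := ((isCompact_Icc (a := ω₀) (b := R)).image_of_continuousOn (f := D.waveAmp)
    (fun ω hω => ContinuousAt.continuousWithinAt (by
      unfold waveAmp
      exact ContinuousAt.mul (by fun_prop)
        (continuousAt_fresnelAmp (h0.trans_le hω.1).ne' hD.det_paraxial_pos)))).isBounded.exists_norm_le
  have hneg : ∀ ω, ‖D.waveAmp (-ω)‖ = ‖D.waveAmp ω‖ := fun ω => by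
    rw [waveAmp, waveAmp, ← conj_fresnelAmp, norm_mul, norm_mul, Complex.norm_conj]
    congr 3; ring
  refine ⟨C, fun z => ?_⟩
  rw [source, norm_mul, norm_cis, mul_one, norm_mul]
  by_cases hz : D.incident z.1 z.2 = 0
  · simp [hz]
  · refine mul_le_mul_of_nonneg_right ?_ (norm_nonneg _)
    have h1 := hsupp _ _ hz
    have h2 : ‖D.waveAmp z.1‖ = ‖D.waveAmp |z.1|‖ := by
      rcases abs_cases z.1 with ⟨h, -⟩ | ⟨h, -⟩ <;> rw [h]
      rw [hneg]
    rw [h2]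
    exact hC _ ⟨_, ⟨h1.1, h1.2⟩, rfl⟩

lemma integrable_source : Integrable D.source := by
  obtain ⟨C, hC⟩ := hD.exists_norm_source_le_incident
  exact (hD.integrable_incident_prod.norm.const_mul C).mono'
    hD.continuous_source.aestronglyMeasurable (Eventually.of_forall hC)

lemma exists_norm_source_le : ∃ C, 0 ≤ C ∧ ∀ z, ‖D.source z‖ ≤ C := by
  obtain ⟨C, hC⟩ := hD.exists_norm_source_le_incident
  obtain ⟨C', hC'⟩ := hD.exists_norm_incident_le
  refine ⟨|C| * |C'|, by positivity, fun z => (hC z).trans ?_⟩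
  gcongr
  · exact le_abs_self _
  · exact (hC' _ _).trans (le_abs_self _)

/-- After exchanging the integrals over `q` and over the interface, the regularized integral over `q`
is a regularized Fresnel integral. -/
lemma tendsto_regInt_reflIntegrand {U : Plane → ℝ} (hU : Continuous U) {ε : ℝ} (hε : 0 < ε)
    (t : ℝ) (x : Plane) (ω : ℝ) :
    Tendsto (regInt (D.reflIntegrand U ε t x ω)) (𝓝[>] 0)
      (𝓝 (cis (-(ω * (t - 2 * D.s₀ * D.zint - inner ℝ x D.k₀) / ε)) *
        ((ω ^ 4 / (2 * Real.pi) ^ 2 : ℝ) : ℂ) * ∫ X : Plane,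
          D.modulation U ω ((ε ^ D.γ)⁻¹ • (D.xint + √ε • X)) * D.incident ω X *
          (D.fresnelAmp ω * cis (ω * (inner ℝ ((√ε)⁻¹ • (x - D.xobs) - X)
            (D.paraxialInv ((√ε)⁻¹ • (x - D.xobs) - X)) / 2))))) := by
  set Y := (√ε)⁻¹ • (x - D.xobs) with hY
  set c : ℂ := cis (-(ω * (t - 2 * D.s₀ * D.zint - inner ℝ x D.k₀) / ε)) *
        ((ω ^ 4 / (2 * Real.pi) ^ 2 : ℝ) : ℂ) with hc
  set m : Plane → ℂ := fun X => D.modulation U ω ((ε ^ D.γ)⁻¹ • (D.xint + √ε • X)) with hm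
  have hmc : Continuous m := by
    simp only [hm, modulation]
    fun_prop
  have hmn : ∀ X, ‖m X‖ = 1 := fun X => norm_modulation _ _ _
  have hG := hD.integrable_incident ω
  have hGm : AEStronglyMeasurable (D.incident ω) := hG.aestronglyMeasurable
  have hreg : ∀ δ > 0, regInt (D.reflIntegrand U ε t x ω) δ =
      c * ∫ X, m X * D.incident ω X * D.fresnelReg ω δ (Y - X) := by
    intro δ hδ
    have e1 : ∀ q : Plane, ((Real.exp (-(δ * ‖q‖ ^ 2)) : ℝ) : ℂ) * D.reflIntegrand U ε t x ω q =
        c * ∫ X, m X * D.incident ω X * (((Real.exp (-(δ * ‖q‖ ^ 2)) : ℝ) : ℂ) *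
          (cis (ω * inner ℝ q (Y - X)) * D.U₀ ω q D.zint)) := by
      intro q
      rw [reflIntegrand, scatOp_eq hε]
      simp only [← integral_const_mul, ← integral_mul_const]
      congr 1; ext X
      have e2 : cis (ω * inner ℝ q (Y - X)) = cis (ω * inner ℝ q (x - D.xobs) / √ε) *
          cis (-(ω * inner ℝ q X)) := by
        rw [← cis_add, inner_sub_right, hY, inner_smul_right]
        congr 1; ring
      rw [e2, hc]
      simp only [hm, modulation]
      push_cast
      ring
    rw [regInt]
    simp only [e1]
    rw [integral_const_mul, integral_integral_swap]
    · congr 2; ext X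
      rw [integral_const_mul, fresnelReg]
    · have hg : Integrable fun q : Plane => ((Real.exp (-(δ * ‖q‖ ^ 2)) : ℝ) : ℂ) := by
        have := (integrable_gaussian_plane hδ).ofReal (𝕜 := ℂ)
        simp only [neg_mul] at this
        exact this
      have hU0 : Continuous fun z : Plane × Plane => D.U₀ ω z.1 D.zint :=
        hD.continuous_U₀.comp (f := fun z : Plane × Plane => (ω, z.1)) (by fun_prop)
      refine ((hg.mul_prod hG).mul_bdd (c := 1) (g := fun z : Plane × Plane =>
        m z.2 * (cis (ω * inner ℝ z.1 (Y - z.2)) * D.U₀ ω z.1 D.zint))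
        (Continuous.aestronglyMeasurable (by fun_prop))
        (Eventually.of_forall fun z => by simp [hmn, hD.norm_U₀])).congr
        (Eventually.of_forall fun z => ?_)
      simp only [Function.uncurry]
      ring
  refine Tendsto.const_mul c ?_ |>.congr' (by
    filter_upwards [self_mem_nhdsWithin] with δ hδ using (hreg δ hδ).symm)
  by_cases hω : ω = 0
  · obtain ⟨ω₀, h0, R, hR, hsupp⟩ := hD.exists_incident_support
    have hz : ∀ X, D.incident ω X = 0 := fun X => by
      by_contra hne
      have := (hsupp _ _ hne).1
      rw [hω, abs_zero] at this
      linarith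
    simp [hz]
  obtain ⟨C, hC⟩ := hD.norm_fresnelReg_le hω
  refine tendsto_integral_filter_of_dominated_convergence (fun X => ‖D.incident ω X‖ * C) ?_ ?_
    (hG.norm.mul_const C) ?_
  · filter_upwards with δ
    refine (hmc.aestronglyMeasurable.mul hGm).mul (StronglyMeasurable.aestronglyMeasurable ?_)
    have hU0 : Continuous fun z : Plane × Plane => D.U₀ ω z.2 D.zint :=
      hD.continuous_U₀.comp (f := fun z : Plane × Plane => (ω, z.2)) (by fun_prop)
    have hc : Continuous fun z : Plane × Plane => (Real.exp (-(δ * ‖z.2‖ ^ 2)) : ℂ) *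
        (cis (ω * inner ℝ z.2 (Y - z.1)) * D.U₀ ω z.2 D.zint) := by fun_prop
    exact hc.stronglyMeasurable.integral_prod_right (ν := volume)
  · filter_upwards [self_mem_nhdsWithin] with δ hδ
    refine Eventually.of_forall fun X => ?_
    rw [norm_mul, norm_mul, hmn, one_mul]
    exact mul_le_mul_of_nonneg_left (hC δ hδ _) (norm_nonneg _)
  · exact Eventually.of_forall fun X => (hD.tendsto_fresnelReg hω (Y - X)).const_mul _

lemma oscInt_reflIntegrand {U : Plane → ℝ} (hU : Continuous U) {ε : ℝ} (hε : 0 < ε)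
    (t : ℝ) (x : Plane) (ω : ℝ) :
    oscInt (D.reflIntegrand U ε t x ω) =
      ∫ X : Plane, D.waveAmp ω * D.incident ω X *
        (D.modulation U ω ((ε ^ D.γ)⁻¹ • (D.xint + √ε • X)) *
        cis (-(ω * (t - 2 * D.s₀ * D.zint - inner ℝ x D.k₀) / ε) +
          ω * (inner ℝ ((√ε)⁻¹ • (x - D.xobs) - X)
            (D.paraxialInv ((√ε)⁻¹ • (x - D.xobs) - X)) / 2))) := by
  rw [oscInt, (hD.tendsto_regInt_reflIntegrand hU hε t x ω).limUnder_eq, ← integral_const_mul]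
  congr 1; ext X
  rw [cis_add, waveAmp]
  push_cast
  ring

lemma integrable_wave {U : Plane → ℝ} (hU : Continuous U) {f : ℝ × Plane → Plane}
    (hf : Continuous f) {p : ℝ × Plane → ℝ} (hp : Continuous p) :
    Integrable fun z : ℝ × Plane => D.waveAmp z.1 * D.incident z.1 z.2 *
      (D.modulation U z.1 (f z) * cis (p z)) := by
  have h1 : Integrable fun z : ℝ × Plane => D.waveAmp z.1 * D.incident z.1 z.2 := by
    refine (integrable_mul_cis hD.integrable_source
      (p := fun z => -(z.1 * (inner ℝ z.2 (D.paraxialInv z.2) / 2))) (by fun_prop)).congr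
      (Eventually.of_forall fun z => ?_)
    simp only [source]
    rw [mul_assoc, ← cis_add, add_neg_cancel, cis_zero, mul_one]
  refine h1.mul_bdd (c := 1) (Continuous.aestronglyMeasurable ?_) (by simp)
  unfold modulation
  fun_prop

/-- The integrals that define the reflected wave exist. -/
lemma reflWellDefined {U : Plane → ℝ} (hU : Continuous U) {ε : ℝ} (hε : 0 < ε) :
    D.ReflWellDefined U ε := by
  intro t x
  refine ⟨fun ω => ⟨_, hD.tendsto_regInt_reflIntegrand hU hε t x ω⟩, ?_⟩
  have := (hD.integrable_wave hU (f := fun z => (ε ^ D.γ)⁻¹ • (D.xint + √ε • z.2)) (by fun_prop)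
    (p := fun z => -(z.1 * (t - 2 * D.s₀ * D.zint - inner ℝ x D.k₀) / ε) +
          z.1 * (inner ℝ ((√ε)⁻¹ • (x - D.xobs) - z.2)
            (D.paraxialInv ((√ε)⁻¹ • (x - D.xobs) - z.2)) / 2)) (by fun_prop)).integral_prod_left
  refine this.congr (Eventually.of_forall fun ω => ?_)
  exact (hD.oscInt_reflIntegrand hU hε t x ω).symm

lemma uRef_eq {U : Plane → ℝ} (hU : Continuous U) {ε : ℝ} (hε : 0 < ε) (t : ℝ) (x : Plane) :
    D.uRef U ε t x = ((D.refl / (2 * (2 * Real.pi) ^ 3) : ℝ) : ℂ) * ∫ z : ℝ × Plane,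
      D.waveAmp z.1 * D.incident z.1 z.2 *
        (D.modulation U z.1 ((ε ^ D.γ)⁻¹ • (D.xint + √ε • z.2)) *
        cis (-(z.1 * (t - 2 * D.s₀ * D.zint - inner ℝ x D.k₀) / ε) +
          z.1 * (inner ℝ ((√ε)⁻¹ • (x - D.xobs) - z.2)
            (D.paraxialInv ((√ε)⁻¹ • (x - D.xobs) - z.2)) / 2))) := by
  rw [uRef]
  congr 1
  rw [Measure.volume_eq_prod, integral_prod _ (hD.integrable_wave hU (by fun_prop) (by fun_prop))]
  congr 1; ext ω
  exact hD.oscInt_reflIntegrand hU hε t x ω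

end Admissible

/-- The phase of the speckle profile, divided by the frequency and without its part quadratic in the
interface point `X`, at scale `η = ε ^ (γ - 1/2)`. -/
noncomputable def specklePhase (D : Setup) (η : ℝ) (a : SpXX) (b : SpX) (X : Plane) : ℝ :=
  -(a.1 / η ^ 2) - b.1 +
    inner ℝ (η⁻¹ • a.2.1 + a.2.2 + η • b.2)
      (D.paraxialInv (η⁻¹ • a.2.1 + a.2.2 + η • b.2)) / 2 -
    inner ℝ (η⁻¹ • a.2.1 + a.2.2 + η • b.2) (D.paraxialInv X)

/-- The rescaled contribution of the interface to the speckle profile. Here `x₀` is the specular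
point, in units of the correlation length of the interface. -/
noncomputable def speckleInt (D : Setup) (U : Plane → ℝ) (η : ℝ) (x₀ : Plane) (a : SpXX)
    (b : SpX) : ℂ :=
  ∫ z : ℝ × Plane, D.source z *
    (D.modulation U z.1 (x₀ + η⁻¹ • z.2) * cis (z.1 * D.specklePhase η a b z.2))

namespace Admissible

variable (hD : D.Admissible)
include hD

/-- The observation time is the time of flight of the specularly reflected wave. -/
lemma tobs_sub : D.tobs - 2 * D.s₀ * D.zint - inner ℝ D.xobs D.k₀ = 0 := by
  have h1 := hD.s₀_pos
  have h0 := hD.c₀_pos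
  have h2 := hD.c₀s₀_sq
  rw [tobs, xobs, inner_smul_left, real_inner_self_eq_norm_sq]
  simp only [conj_trivial]
  field_simp
  linear_combination (-2*D.zint) * h2

/-- In the variables of the speckle profile the parameter `ε` enters through `η = ε ^ (γ - 1/2)` and
through the position of the specular point. -/
lemma speckle_eq {U : Plane → ℝ} (hU : Continuous U) {ε : ℝ} (hε : 0 < ε) (a : SpXX) (b : SpX) :
    D.speckle U ε a b = ((D.refl / (2 * (2 * Real.pi) ^ 3) : ℝ) : ℂ) *
      ((((ε ^ (D.γ - 1 / 2)) ^ 2)⁻¹ : ℝ) : ℂ) *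
      D.speckleInt U (ε ^ (D.γ - 1 / 2)) ((ε ^ D.γ)⁻¹ • D.xint) a b := by
  have hη : 0 < ε ^ (D.γ - 1 / 2) := Real.rpow_pos_of_pos hε _
  set η := ε ^ (D.γ - 1 / 2) with hηd
  have hs : 0 < √ε := Real.sqrt_pos.2 hε
  have hss : √ε ^ 2 = ε := Real.sq_sqrt hε.le
  have p1 : ε ^ D.γ = √ε * η := by
    rw [hηd, Real.sqrt_eq_rpow, ← Real.rpow_add hε]; congr 1; ring
  have p2 : ε ^ (1 - D.γ) = √ε * η⁻¹ := by
    rw [hηd, Real.sqrt_eq_rpow, ← Real.rpow_neg hε.le, ← Real.rpow_add hε]; congr 1; ring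
  have p3 : ε ^ (1 - 2 * D.γ) = (η ^ 2)⁻¹ := by
    rw [hηd, ← Real.rpow_natCast, ← Real.rpow_mul hε.le, ← Real.rpow_neg hε.le]
    congr 1; push_cast; ring
  have p4 : ε ^ (2 * (1 - D.γ)) = ε * (η ^ 2)⁻¹ := by
    rw [← p3]; nth_rw 2 [← Real.rpow_one ε]; rw [← Real.rpow_add hε]; congr 1; ring
  set ζ := η⁻¹ • a.2.1 + a.2.2 + η • b.2 with hζ
  rw [speckle, hD.uRef_eq hU hε, p1, p2, p3, p4, speckleInt]
  have hx : D.xobs + (√ε * η⁻¹) • a.2.1 + √ε • a.2.2 + (√ε * η) • b.2 = D.xobs + √ε • ζ := by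
    simp only [hζ, smul_add, smul_smul]; abel
  have ht : D.tobs + √ε * η⁻¹ * inner ℝ D.k₀ a.2.1 + √ε * inner ℝ D.k₀ a.2.2 +
        √ε * η * inner ℝ D.k₀ b.2 + ε * (η ^ 2)⁻¹ * a.1 + ε * b.1 =
        D.tobs + √ε * inner ℝ ζ D.k₀ + ε * (a.1 / η ^ 2 + b.1) := by
    have : inner ℝ ζ D.k₀ = η⁻¹ * inner ℝ D.k₀ a.2.1 + inner ℝ D.k₀ a.2.2 +
        η * inner ℝ D.k₀ b.2 := by
      rw [real_inner_comm, hζ, inner_add_right, inner_add_right, inner_smul_right, inner_smul_right]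
    rw [this]; ring
  clear_value ζ
  rw [hx, ht, ← mul_assoc, mul_comm (((η ^ 2)⁻¹ : ℝ) : ℂ)]
  congr 2; ext z
  have e1 : (√ε * η)⁻¹ • (D.xint + √ε • z.2) = (√ε * η)⁻¹ • D.xint + η⁻¹ • z.2 := by
    rw [smul_add, smul_smul]; congr 2; field_simp
  have e2 : (√ε)⁻¹ • (D.xobs + √ε • ζ - D.xobs) = ζ := by
    rw [add_sub_cancel_left, smul_smul, inv_mul_cancel₀ hs.ne', one_smul]
  have e3 : -(z.1 * (D.tobs + √ε * inner ℝ ζ D.k₀ + ε * (a.1 / η ^ 2 + b.1) -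
      2 * D.s₀ * D.zint - inner ℝ (D.xobs + √ε • ζ) D.k₀) / ε) = z.1 * (-(a.1 / η ^ 2) - b.1) := by
    rw [inner_add_left, inner_smul_left, conj_trivial]
    rw [show D.tobs + √ε * inner ℝ ζ D.k₀ + ε * (a.1 / η ^ 2 + b.1) -
      2 * D.s₀ * D.zint - (inner ℝ D.xobs D.k₀ + √ε * inner ℝ ζ D.k₀) =
      (D.tobs - 2 * D.s₀ * D.zint - inner ℝ D.xobs D.k₀) + ε * (a.1 / η ^ 2 + b.1) by ring,
      hD.tobs_sub]
    field_simp
    ring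
  have e4 : inner ℝ (ζ - z.2) (D.paraxialInv (ζ - z.2)) = inner ℝ ζ (D.paraxialInv ζ) -
      2 * inner ℝ ζ (D.paraxialInv z.2) + inner ℝ z.2 (D.paraxialInv z.2) := by
    have : inner ℝ z.2 (D.paraxialInv ζ) = inner ℝ ζ (D.paraxialInv z.2) := by
      rw [hD.paraxialInv_symm, real_inner_comm]
    simp only [map_sub, inner_sub_left, inner_sub_right]
    linarith
  rw [e1, e2, e3, source, specklePhase, ← hζ, e4]
  rw [mul_assoc, mul_assoc, mul_assoc, mul_left_comm (cis _) (D.modulation _ _ _), ← cis_add]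
  congr 4
  ring

/-- The speckle profile is real, since the field emitted by the source is. -/
lemma conj_speckleInt {U : Plane → ℝ} (η : ℝ) (x₀ : Plane) (a : SpXX) (b : SpX) :
    conj (D.speckleInt U η x₀ a b) = D.speckleInt U η x₀ a b := by
  rw [speckleInt, ← integral_conj]
  have h : MeasurePreserving (fun z : ℝ × Plane => (-z.1, z.2)) :=
    (Measure.measurePreserving_neg (volume : Measure ℝ)).prod (MeasurePreserving.id volume)
  have he : MeasurableEmbedding (fun z : ℝ × Plane => (-z.1, z.2)) :=
    ((MeasurableEquiv.neg ℝ).prodCongr (MeasurableEquiv.refl Plane)).measurableEmbedding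
  rw [← h.integral_comp he]
  congr 1; ext z
  simp only [map_mul, ← conj_source, modulation, conj_cis, Complex.conj_conj, ← cis_add]
  congr 2
  ring

lemma exists_norm_speckleInt_le : ∃ C, 0 ≤ C ∧ ∀ (U : Plane → ℝ) (η : ℝ) (x₀ : Plane) (a : SpXX)
    (b : SpX), ‖D.speckleInt U η x₀ a b‖ ≤ C := by
  refine ⟨∫ z, ‖D.source z‖, by positivity, fun U η x₀ a b => ?_⟩
  refine norm_integral_le_of_norm_le hD.integrable_source.norm (Eventually.of_forall fun z => ?_)
  simp

end Admissible
end Setup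

/-! ### The deterministic kernel of a pairing with a test function -/

section Haar

variable {E F : Type*} [NormedAddCommGroup E] [NormedSpace ℝ E] [FiniteDimensional ℝ E]
  [MeasureSpace E] [BorelSpace E] [(volume : Measure E).IsAddHaarMeasure]
  [NormedAddCommGroup F] [NormedSpace ℝ F] [FiniteDimensional ℝ F] [MeasureSpace F] [BorelSpace F]
  [(volume : Measure F).IsAddHaarMeasure]

/-- Stated as a lemma, with instances for the products of use below, since the search for instances
does not find it for iterated products. -/
lemma isAddHaarMeasure_volume_prod : (volume : Measure (E × F)).IsAddHaarMeasure := by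
  have : ProperSpace E := FiniteDimensional.proper_real E
  have : ProperSpace F := FiniteDimensional.proper_real F
  rw [Measure.volume_eq_prod]; infer_instance

end Haar

instance : (volume : Measure SpX).IsAddHaarMeasure := isAddHaarMeasure_volume_prod

instance : (volume : Measure (Plane × Plane)).IsAddHaarMeasure := isAddHaarMeasure_volume_prod

instance : (volume : Measure SpXX).IsAddHaarMeasure := isAddHaarMeasure_volume_prod

instance : (volume : Measure (SpX × SpX)).IsAddHaarMeasure := isAddHaarMeasure_volume_prod

instance {M : Type*} [NormedAddCommGroup M] [NormedSpace ℝ M] [FiniteDimensional ℝ M]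
    [MeasureSpace M] [BorelSpace M] [(volume : Measure M).IsAddHaarMeasure] :
    (volume : Measure (SpXX × M)).IsAddHaarMeasure := isAddHaarMeasure_volume_prod

namespace Setup

variable {D : Setup} {M : Type*} [NormedAddCommGroup M] [NormedSpace ℝ M] [FiniteDimensional ℝ M]
  [MeasureSpace M] [BorelSpace M] [(volume : Measure M).IsAddHaarMeasure]
  {L₁ L₂ : M →L[ℝ] SpX}

/-- The difference of the phases of two speckle profiles with the same macroscopic variable `w.1`
and microscopic variables `L₁ w.2`, `L₂ w.2`, where `z₁`, `z₂` are (frequency, interface point)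
pairs, and `y = (ν, ξ)` is their rescaled difference, `z₁.1 - z₂.1 = η² ν` and
`z₁.1 z₁.2 - z₂.1 z₂.2 = η ξ`. -/
noncomputable def kernelPhase (D : Setup) (L₁ L₂ : M →L[ℝ] SpX) (η : ℝ) (z₁ z₂ y : ℝ × Plane)
    (w : SpXX × M) : ℝ :=
  y.1 * (-w.1.1 + inner ℝ (w.1.2.1 + η • w.1.2.2) (D.paraxialInv (w.1.2.1 + η • w.1.2.2)) / 2) -
    (z₁.1 * (L₁ w.2).1 - z₂.1 * (L₂ w.2).1) +
    inner ℝ (w.1.2.1 + η • w.1.2.2)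
      (D.paraxialInv (z₁.1 • (L₁ w.2).2 - z₂.1 • (L₂ w.2).2 - y.2)) +
    η ^ 2 / 2 * (z₁.1 * inner ℝ (L₁ w.2).2 (D.paraxialInv (L₁ w.2).2) -
      z₂.1 * inner ℝ (L₂ w.2).2 (D.paraxialInv (L₂ w.2).2)) -
    η * (z₁.1 * inner ℝ (L₁ w.2).2 (D.paraxialInv z₁.2) -
      z₂.1 * inner ℝ (L₂ w.2).2 (D.paraxialInv z₂.2))

/-- The oscillatory integral of a test function against `kernelPhase`. -/
noncomputable def kernel (D : Setup) (L₁ L₂ : M →L[ℝ] SpX) (φ : 𝓢(SpXX × M, ℂ)) (η : ℝ)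
    (z₁ z₂ y : ℝ × Plane) : ℂ :=
  ∫ w, φ w * cis (D.kernelPhase L₁ L₂ η z₁ z₂ y w)

lemma continuous_kernelPhase (η : ℝ) (z₁ z₂ y : ℝ × Plane) :
    Continuous (D.kernelPhase L₁ L₂ η z₁ z₂ y) := by
  unfold kernelPhase
  fun_prop

namespace Admissible

variable (hD : D.Admissible)
include hD

/-- In the rescaled differences of frequencies and interface points, the difference of two speckle
phases is regular as `η → 0`. -/
lemma kernelPhase_eq {η : ℝ} (hη : η ≠ 0) {z₁ z₂ y : ℝ × Plane} (h1 : z₁.1 - z₂.1 = η ^ 2 * y.1)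
    (h2 : z₁.1 • z₁.2 - z₂.1 • z₂.2 = η • y.2) (w : SpXX × M) :
    z₁.1 * D.specklePhase η w.1 (L₁ w.2) z₁.2 - z₂.1 * D.specklePhase η w.1 (L₂ w.2) z₂.2 =
      D.kernelPhase L₁ L₂ η z₁ z₂ y w := by
  set Y := w.1.2.1 + η • w.1.2.2 with hY
  have hζ : ∀ b : Plane, η⁻¹ • w.1.2.1 + w.1.2.2 + η • b = η⁻¹ • (Y + η ^ 2 • b) := by
    intro b
    rw [hY, smul_add, smul_add, smul_smul, smul_smul, inv_mul_cancel₀ hη, one_smul]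
    congr 2
    field_simp
  have hsym : ∀ a b : Plane, inner ℝ a (D.paraxialInv b) = inner ℝ b (D.paraxialInv a) := by
    intro a b
    rw [hD.paraxialInv_symm, real_inner_comm]
  have h3 : z₁.1 * inner ℝ Y (D.paraxialInv z₁.2) - z₂.1 * inner ℝ Y (D.paraxialInv z₂.2) =
      η * inner ℝ Y (D.paraxialInv y.2) := by
    rw [← inner_smul_right, ← inner_smul_right, ← inner_smul_right, ← map_smul, ← map_smul,
      ← map_smul, ← inner_sub_right, ← map_sub, h2]
  rw [specklePhase, specklePhase, kernelPhase, hζ, hζ, ← hY]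
  simp only [map_add, map_smul, map_sub, inner_add_left, inner_add_right, inner_sub_right,
    inner_smul_left, inner_smul_right, conj_trivial]
  rw [hsym (L₁ w.2).2 Y, hsym (L₂ w.2).2 Y]
  clear_value Y
  field_simp
  linear_combination (-2 * w.1.1 + inner ℝ Y (D.paraxialInv Y)) * h1 - 2 * η * h3

/-- Non-stationary phase: integrating by parts in `s̄` gives decay in `ν`, and integrating by parts
in `ȳ` gives decay in `ξ`, at the price of powers of `ν`. -/
lemma exists_kernel_decay (L₁ L₂ : M →L[ℝ] SpX) (R : ℝ) (n k : ℕ) (φ : 𝓢(SpXX × M, ℂ)) :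
    ∃ C, ∀ (η : ℝ) (z₁ z₂ y : ℝ × Plane), |η| ≤ 1 → |z₁.1| ≤ R → |z₂.1| ≤ R →
      ‖y.2‖ ^ k * ((1 + |y.1|) ^ n * ‖D.kernel L₁ L₂ φ η z₁ z₂ y‖) ≤ C := by
  let ι := {i : ℝ × (ℝ × Plane) × (ℝ × Plane) × (ℝ × Plane) //
    |i.1| ≤ 1 ∧ |i.2.1.1| ≤ R ∧ |i.2.2.1.1| ≤ R}
  let p : ι → SpXX × M → ℝ := fun i => D.kernelPhase L₁ L₂ i.1.1 i.1.2.1 i.1.2.2.1 i.1.2.2.2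
  have hp : ∀ i, Continuous (p i) := fun i => continuous_kernelPhase _ _ _ _
  suffices H : ∀ n, ∀ φ : 𝓢(SpXX × M, ℂ), ∃ C, ∀ i : ι,
      ‖i.1.2.2.2.2‖ ^ k * ((1 + |i.1.2.2.2.1|) ^ n * ‖∫ w, φ w * cis (p i w)‖) ≤ C by
    obtain ⟨C, hC⟩ := H n φ
    exact ⟨C, fun η z₁ z₂ y h h1 h2 => hC ⟨(η, z₁, z₂, y), h, h1, h2⟩⟩
  clear φ n
  induction k with
  | zero =>
    intro n
    induction n with
    | zero =>
      intro φ
      obtain ⟨C, hC⟩ := norm_oscillatory_le (μ := (volume : Measure (SpXX × M))) φ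
      exact ⟨C, fun i => by simpa using hC (p i)⟩
    | succ n ih =>
      intro φ
      -- along `s̄` the phase has the constant derivative `-ν`
      let e : SpXX × M := ((1, 0, 0), 0)
      have hd : ∀ (i : ι) w, HasLineDerivAt ℝ (p i)
          (-i.1.2.2.2.1 + (0 : SpXX × M →L[ℝ] ℝ) w) w e := by
        intro i w
        have hl : (fun t : ℝ => p i (w + t • e)) = fun t => p i w + t * -i.1.2.2.2.1 := by
          funext t
          simp only [p, kernelPhase, e, Prod.fst_add, Prod.snd_add, Prod.smul_fst, Prod.smul_snd,
            smul_zero, add_zero, smul_eq_mul, mul_one]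
          ring
        rw [HasLineDerivAt, hl]
        simpa using ((hasDerivAt_id (0 : ℝ)).mul_const (-i.1.2.2.2.1)).const_add (p i w)
      obtain ⟨C1, h1⟩ := ih φ
      obtain ⟨C2, h2⟩ := bounded_oscillatory_step (μ := (volume : Measure (SpXX × M))) hp e
        (N := fun _ => 1) (W := fun i => (1 + |i.1.2.2.2.1|) ^ n) (C₀ := 0) hd (by simp)
        (fun _ => le_rfl) (fun _ => by positivity) (by simpa using ih) φ
      refine ⟨C1 + C2, fun i => ?_⟩
      have k1 := h1 i
      have k2 := h2 i
      rw [abs_neg] at k2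
      rw [pow_zero, one_mul] at k1 ⊢
      rw [pow_succ]
      linarith
  | succ k ih =>
    intro n φ
    have hstep : ∀ j : Fin 2, ∃ C, ∀ i : ι, |(i.1.2.2.2.2) j| *
        (‖i.1.2.2.2.2‖ ^ k * ((1 + |i.1.2.2.2.1|) ^ n * ‖∫ w, φ w * cis (p i w)‖)) ≤ C := by
      intro j
      let u : Plane := EuclideanSpace.single j 1
      -- along `ȳ`, in the direction `z_int c₀ A₀ u`, the phase has the derivative `-ξ_j` up to terms
      -- that are linear in the variables with coefficients of order `1 + |ν|`
      let e : SpXX × M := ((0, D.paraxial u, 0), 0)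
      let A₁ : SpXX × M →L[ℝ] ℝ := (innerSL ℝ u).comp ((ContinuousLinearMap.fst ℝ Plane Plane).comp
        ((ContinuousLinearMap.snd ℝ ℝ (Plane × Plane)).comp (ContinuousLinearMap.fst ℝ SpXX M)))
      let A₂ : SpXX × M →L[ℝ] ℝ := (innerSL ℝ u).comp ((ContinuousLinearMap.snd ℝ Plane Plane).comp
        ((ContinuousLinearMap.snd ℝ ℝ (Plane × Plane)).comp (ContinuousLinearMap.fst ℝ SpXX M)))
      let B : (M →L[ℝ] SpX) → (SpXX × M →L[ℝ] ℝ) := fun L => (innerSL ℝ u).comp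
        ((ContinuousLinearMap.snd ℝ ℝ Plane).comp (L.comp (ContinuousLinearMap.snd ℝ SpXX M)))
      let l : ι → (SpXX × M →L[ℝ] ℝ) := fun i => i.1.2.2.2.1 • (A₁ + i.1.1 • A₂) +
        (i.1.2.1.1 • B L₁ - i.1.2.2.1.1 • B L₂)
      have hl : ∀ i, ‖l i‖ ≤ (‖A₁‖ + ‖A₂‖ + R * ‖B L₁‖ + R * ‖B L₂‖) * (1 + |i.1.2.2.2.1|) := by
        intro i
        obtain ⟨⟨η, z₁, z₂, y⟩, h0, h1, h2⟩ := i
        simp only at h0 h1 h2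
        have hR : 0 ≤ R := (abs_nonneg _).trans h1
        have s1 : ‖A₁ + η • A₂‖ ≤ ‖A₁‖ + 1 * ‖A₂‖ := by
          refine (norm_add_le _ _).trans ?_
          rw [norm_smul, Real.norm_eq_abs]
          gcongr
        have s2 : ‖z₁.1 • B L₁ - z₂.1 • B L₂‖ ≤ R * ‖B L₁‖ + R * ‖B L₂‖ := by
          refine (norm_sub_le _ _).trans ?_
          rw [norm_smul, norm_smul, Real.norm_eq_abs, Real.norm_eq_abs]
          gcongr
        calc ‖l ⟨⟨η, z₁, z₂, y⟩, h0, h1, h2⟩‖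
            ≤ |y.1| * (‖A₁‖ + 1 * ‖A₂‖) + (R * ‖B L₁‖ + R * ‖B L₂‖) := by
              refine (norm_add_le _ _).trans ?_
              rw [norm_smul, Real.norm_eq_abs]
              gcongr
          _ ≤ _ := by
              have := mul_nonneg (abs_nonneg y.1)
                (add_nonneg (mul_nonneg hR (norm_nonneg (B L₁))) (mul_nonneg hR (norm_nonneg (B L₂))))
              have := norm_nonneg A₁
              have := norm_nonneg A₂
              simp only
              linarith
      have hd : ∀ (i : ι) w, HasLineDerivAt ℝ (p i) (-(i.1.2.2.2.2) j + l i w) w e := by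
        intro i w
        obtain ⟨⟨η, z₁, z₂, y⟩, h0, h1, h2⟩ := i
        have hu : ∀ x : Plane, inner ℝ (D.paraxial u) (D.paraxialInv x) = inner ℝ u x := by
          intro x
          rw [← hD.paraxial_symm, hD.paraxial_paraxialInv]
        have hu' : ∀ x : Plane, inner ℝ x (D.paraxialInv (D.paraxial u)) = inner ℝ u x := by
          intro x
          rw [hD.paraxialInv_paraxial, real_inner_comm]
        have hq : (fun t : ℝ => p ⟨⟨η, z₁, z₂, y⟩, h0, h1, h2⟩ (w + t • e)) = fun t =>
            p ⟨⟨η, z₁, z₂, y⟩, h0, h1, h2⟩ w +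
              (t * (-y.2 j + l ⟨⟨η, z₁, z₂, y⟩, h0, h1, h2⟩ w) +
              t ^ 2 * (y.1 / 2 * inner ℝ u (D.paraxial u))) := by
          funext t
          have e0 : y.2 j = inner ℝ u y.2 := by simp [u, EuclideanSpace.inner_single_left]
          have e1 : (w + t • e).1.2.1 + η • (w + t • e).1.2.2 =
              (w.1.2.1 + η • w.1.2.2) + t • D.paraxial u := by
            simp only [e, Prod.fst_add, Prod.snd_add, Prod.smul_fst, Prod.smul_snd, smul_zero,
              add_zero]
            abel
          have e2 : (w + t • e).2 = w.2 := by simp [e]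
          have e3 : (w + t • e).1.1 = w.1.1 := by simp [e]
          have e4 : l ⟨⟨η, z₁, z₂, y⟩, h0, h1, h2⟩ w = y.1 * (inner ℝ u w.1.2.1 +
              η * inner ℝ u w.1.2.2) + (z₁.1 * inner ℝ u (L₁ w.2).2 -
              z₂.1 * inner ℝ u (L₂ w.2).2) := by
            simp only [l, A₁, A₂, B, add_apply, sub_apply,
              smul_apply, ContinuousLinearMap.comp_apply, innerSL_apply_apply,
              ContinuousLinearMap.coe_fst', ContinuousLinearMap.coe_snd', smul_eq_mul]
          rw [e0, e4]
          simp only [p, kernelPhase, e1, e2, e3]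
          simp only [map_add, map_smul, map_sub, inner_add_left, inner_add_right, inner_sub_right,
            inner_smul_left, inner_smul_right, conj_trivial, hu, hu']
          ring
        rw [HasLineDerivAt, hq]
        have := (((hasDerivAt_id (0 : ℝ)).mul_const
          (-y.2 j + l ⟨⟨η, z₁, z₂, y⟩, h0, h1, h2⟩ w)).add
          ((hasDerivAt_pow 2 (0 : ℝ)).mul_const (y.1 / 2 * inner ℝ u (D.paraxial u)))).const_add
          (p ⟨⟨η, z₁, z₂, y⟩, h0, h1, h2⟩ w)
        simpa using this
      obtain ⟨C, hC⟩ := bounded_oscillatory_step (μ := (volume : Measure (SpXX × M))) hp e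
        (N := fun i => 1 + |i.1.2.2.2.1|)
        (W := fun i => ‖i.1.2.2.2.2‖ ^ k * (1 + |i.1.2.2.2.1|) ^ n) hd hl
        (fun _ => le_add_of_nonneg_right (abs_nonneg _)) (fun _ => by positivity)
        (fun φ => by
          obtain ⟨C, hC⟩ := ih (n + 1) φ
          refine ⟨C, fun i => (le_of_eq ?_).trans (hC i)⟩
          ring) φ
      refine ⟨C, fun i => (le_of_eq ?_).trans (hC i)⟩
      rw [abs_neg]
      ring
    obtain ⟨C, hC⟩ := bounded_norm_of_bounded_coords (fun i => by positivity) hstep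
    refine ⟨C, fun i => (le_of_eq ?_).trans (hC i)⟩
    ring

/-- An integrable bound on the kernel, uniform in the scale parameter. -/
lemma exists_norm_kernel_le (L₁ L₂ : M →L[ℝ] SpX) (R : ℝ) (φ : 𝓢(SpXX × M, ℂ)) :
    ∃ C, 0 ≤ C ∧ ∀ (η : ℝ) (z₁ z₂ y : ℝ × Plane), |η| ≤ 1 → |z₁.1| ≤ R → |z₂.1| ≤ R →
      ‖D.kernel L₁ L₂ φ η z₁ z₂ y‖ ≤
        C * ((1 + ‖y.1‖) ^ (-2 : ℝ) * (1 + ‖y.2‖) ^ (-3 : ℝ)) := by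
  obtain ⟨C0, h0⟩ := hD.exists_kernel_decay L₁ L₂ R 2 0 φ
  obtain ⟨C3, h3⟩ := hD.exists_kernel_decay L₁ L₂ R 2 3 φ
  refine ⟨4 * (|C0| + |C3|), by positivity, fun η z₁ z₂ y hη h1 h2 => ?_⟩
  have k0 := (h0 η z₁ z₂ y hη h1 h2).trans (le_abs_self _)
  have k3 := (h3 η z₁ z₂ y hη h1 h2).trans (le_abs_self _)
  rw [pow_zero, one_mul] at k0
  rw [Real.norm_eq_abs, Real.rpow_neg (by positivity), Real.rpow_neg (by positivity),
    ← mul_inv, ← div_eq_mul_inv, le_div_iff₀ (by positivity),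
    show (3 : ℝ) = ((3 : ℕ) : ℝ) by norm_num, show (2 : ℝ) = ((2 : ℕ) : ℝ) by norm_num,
    Real.rpow_natCast, Real.rpow_natCast]
  have hx := norm_nonneg y.2
  have hp : (1 + ‖y.2‖) ^ 3 ≤ 4 * (1 + ‖y.2‖ ^ 3) := by
    nlinarith [sq_nonneg (‖y.2‖ - 1)]
  set K := ‖D.kernel L₁ L₂ φ η z₁ z₂ y‖
  have hK : 0 ≤ (1 + |y.1|) ^ 2 * K := by positivity
  calc K * ((1 + |y.1|) ^ 2 * (1 + ‖y.2‖) ^ 3)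
      = ((1 + |y.1|) ^ 2 * K) * (1 + ‖y.2‖) ^ 3 := by ring
    _ ≤ ((1 + |y.1|) ^ 2 * K) * (4 * (1 + ‖y.2‖ ^ 3)) := by gcongr
    _ = 4 * ((1 + |y.1|) ^ 2 * K + ‖y.2‖ ^ 3 * ((1 + |y.1|) ^ 2 * K)) := by ring
    _ ≤ _ := by gcongr

end Admissible
end Setup

/-! ### Pairings of two speckle profiles with a test function -/

namespace Setup

variable {D : Setup} {M : Type*} [NormedAddCommGroup M] [NormedSpace ℝ M] [FiniteDimensional ℝ M]
  [MeasureSpace M] [BorelSpace M] [(volume : Measure M).IsAddHaarMeasure]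
  {L₁ L₂ : M →L[ℝ] SpX}

/-- The second (frequency, interface point) pair `(ω₂, X₂)`, as a function of the first one
`z.1 = (ω₁, X₁)` and of the rescaled differences `z.2 = (ν, ξ)`: one has `ω₁ - ω₂ = η² ν` and
`ω₁ X₁ - ω₂ X₂ = η ξ`, the latter if `ω₂ ≠ 0`. -/
noncomputable def partner (η : ℝ) (z : (ℝ × Plane) × (ℝ × Plane)) : ℝ × Plane :=
  (z.1.1 - η ^ 2 * z.2.1, (z.1.1 - η ^ 2 * z.2.1)⁻¹ • (z.1.1 • z.1.2 - η • z.2.2))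

lemma measurable_partner (η : ℝ) : Measurable (partner η) := by
  unfold partner
  fun_prop

lemma tendsto_partner {z : (ℝ × Plane) × (ℝ × Plane)} (hz : z.1.1 ≠ 0) :
    Tendsto (fun η => partner η z) (𝓝 0) (𝓝 z.1) := by
  have h : ContinuousAt (fun η => partner η z) 0 := by
    unfold partner
    have h1 : ContinuousAt (fun η : ℝ => z.1.1 - η ^ 2 * z.2.1) 0 := by fun_prop
    exact h1.prodMk ((h1.inv₀ (by simpa using hz)).smul (by fun_prop))
  have h0 : partner 0 z = z.1 := by
    simp [partner, hz, smul_smul]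
  rw [ContinuousAt, h0] at h
  exact h

/-- The change of variables `(ω₂, X₂) = partner η (z₁, (ν, ξ))`. -/
lemma integral_eq_integral_partner {η : ℝ} (hη : 0 < η) (z₁ : ℝ × Plane) {F : ℝ × Plane → ℂ}
    (hF : Integrable F)
    (hG : Integrable fun y => ((((partner η (z₁, y)).1 ^ 2)⁻¹ : ℝ) : ℂ) * F (partner η (z₁, y))) :
    ∫ z, F z = ((η ^ 4 : ℝ) : ℂ) *
      ∫ y, ((((partner η (z₁, y)).1 ^ 2)⁻¹ : ℝ) : ℂ) * F (partner η (z₁, y)) := by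
  have hfin : Module.finrank ℝ Plane = 2 := by simp
  have h1 : ∀ H : ℝ → ℂ, ∫ s, H s = ((η ^ 2 : ℝ) : ℂ) * ∫ ν, H (z₁.1 - η ^ 2 * ν) := by
    intro H
    rw [Measure.integral_comp_mul_left (fun s => H (z₁.1 - s)) (η ^ 2),
      integral_sub_left_eq_self H volume z₁.1, abs_of_nonneg (by positivity), Complex.real_smul,
      ← mul_assoc, ← Complex.ofReal_mul, mul_inv_cancel₀ (by positivity), Complex.ofReal_one,
      one_mul]
  have h2 : ∀ s : ℝ, s ≠ 0 → ∫ X, F (s, X) = ((η ^ 2 : ℝ) : ℂ) *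
      ∫ ξ, (((s ^ 2)⁻¹ : ℝ) : ℂ) * F (s, s⁻¹ • (z₁.1 • z₁.2 - η • ξ)) := by
    intro s hs
    have e : ∀ ξ : Plane, s⁻¹ • (z₁.1 • z₁.2 - η • ξ) =
        s⁻¹ • z₁.1 • z₁.2 - (s⁻¹ * η) • ξ := fun ξ => by rw [smul_sub, smul_smul s⁻¹ η]
    simp only [e]
    rw [integral_const_mul, Measure.integral_comp_smul volume
      (fun x => F (s, s⁻¹ • z₁.1 • z₁.2 - x)) (s⁻¹ * η),
      integral_sub_left_eq_self (fun x => F (s, x)) volume, hfin, abs_of_nonneg (by positivity),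
      Complex.real_smul, ← mul_assoc, ← mul_assoc, ← Complex.ofReal_mul, ← Complex.ofReal_mul]
    have : η ^ 2 * (s ^ 2)⁻¹ * ((s⁻¹ * η) ^ 2)⁻¹ = 1 := by field_simp
    rw [this, Complex.ofReal_one, one_mul]
  rw [Measure.volume_eq_prod] at hF hG ⊢
  rw [integral_prod _ hF, integral_prod _ hG, h1]
  -- the substitution in the interface point fails at zero frequency only
  have h3 : ∀ᵐ ν : ℝ, ν ≠ z₁.1 / η ^ 2 := by
    simp [ae_iff]
  have h4 : ∫ ν, ∫ X, F (z₁.1 - η ^ 2 * ν, X) = ∫ ν, ((η ^ 2 : ℝ) : ℂ) * ∫ ξ,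
      ((((partner η (z₁, (ν, ξ))).1 ^ 2)⁻¹ : ℝ) : ℂ) * F (partner η (z₁, (ν, ξ))) := by
    refine integral_congr_ae (h3.mono fun ν hν => ?_)
    refine h2 _ fun h => hν ?_
    field_simp
    linarith
  rw [h4, integral_const_mul, ← mul_assoc, ← Complex.ofReal_mul]
  congr 2
  ring

/-- The deterministic amplitude in `speckleMoment_eq`: the two sources, the kernel, and the factor
`ω₂⁻²` from the change of variables. It vanishes where `ω₂` is small. -/
noncomputable def kernelAmp (D : Setup) (L₁ L₂ : M →L[ℝ] SpX) (φ : 𝓢(SpXX × M, ℂ)) (η : ℝ)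
    (z : (ℝ × Plane) × (ℝ × Plane)) : ℂ :=
  ((((partner η z).1 ^ 2)⁻¹ : ℝ) : ℂ) * (D.source z.1 * conj (D.source (partner η z)) *
    D.kernel L₁ L₂ φ η z.1 (partner η z) z.2)

/-- The random factor in `speckleMoment_eq`, for the interface `U`. -/
noncomputable def modPair (D : Setup) (U : Plane → ℝ) (η : ℝ) (x₀ : Plane)
    (z : (ℝ × Plane) × (ℝ × Plane)) : ℂ :=
  D.modulation U z.1.1 (x₀ + η⁻¹ • z.1.2) *
    conj (D.modulation U (partner η z).1 (x₀ + η⁻¹ • (partner η z).2))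

/-- The pairing of a product of two speckle profiles with a test function. -/
noncomputable def speckleMoment (D : Setup) (L₁ L₂ : M →L[ℝ] SpX) (φ : 𝓢(SpXX × M, ℂ))
    (U : Plane → ℝ) (η : ℝ) (x₀ : Plane) : ℂ :=
  ∫ w, D.speckleInt U η x₀ w.1 (L₁ w.2) * conj (D.speckleInt U η x₀ w.1 (L₂ w.2)) * φ w

lemma norm_modPair (U : Plane → ℝ) (η : ℝ) (x₀ : Plane) (z : (ℝ × Plane) × (ℝ × Plane)) :
    ‖D.modPair U η x₀ z‖ = 1 := by
  simp [modPair]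

lemma continuous_kernelPhase_uncurry (η : ℝ) :
    Continuous fun q : ((ℝ × Plane) × (ℝ × Plane) × (ℝ × Plane)) × (SpXX × M) =>
      D.kernelPhase L₁ L₂ η q.1.1 q.1.2.1 q.1.2.2 q.2 := by
  unfold kernelPhase
  fun_prop

lemma measurable_kernel (φ : 𝓢(SpXX × M, ℂ)) (η : ℝ) : Measurable
    fun z : (ℝ × Plane) × (ℝ × Plane) => D.kernel L₁ L₂ φ η z.1 (partner η z) z.2 := by
  have : ProperSpace M := FiniteDimensional.proper_real M
  have hf : Measurable fun z : (ℝ × Plane) × (ℝ × Plane) => (z.1, partner η z, z.2) :=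
    measurable_fst.prodMk ((measurable_partner η).prodMk measurable_snd)
  have hc : Continuous fun q : ((ℝ × Plane) × (ℝ × Plane) × (ℝ × Plane)) × (SpXX × M) =>
      φ q.2 * cis (D.kernelPhase L₁ L₂ η q.1.1 q.1.2.1 q.1.2.2 q.2) :=
    (φ.continuous.comp continuous_snd).mul
      (continuous_cis.comp (continuous_kernelPhase_uncurry η))
  have hm : StronglyMeasurable fun r : (ℝ × Plane) × (ℝ × Plane) × (ℝ × Plane) =>
      ∫ w, φ w * cis (D.kernelPhase L₁ L₂ η r.1 r.2.1 r.2.2 w) := by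
    exact StronglyMeasurable.integral_prod_right' (ν := (volume : Measure (SpXX × M)))
      hc.stronglyMeasurable
  simp only [kernel]
  have h := hm.measurable.comp hf
  simp only [Function.comp_def] at h
  exact h

namespace Admissible

variable (hD : D.Admissible)
include hD

lemma measurable_kernelAmp (φ : 𝓢(SpXX × M, ℂ)) (η : ℝ) : Measurable (D.kernelAmp L₁ L₂ φ η) := by
  have h1 := measurable_partner η
  have h2 := measurable_kernel (D := D) (L₁ := L₁) (L₂ := L₂) φ η
  have h3 := hD.continuous_source.measurable
  unfold kernelAmp
  fun_prop

/-- The amplitude is dominated uniformly in the scale parameter. -/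
lemma exists_norm_kernelAmp_le (L₁ L₂ : M →L[ℝ] SpX) (φ : 𝓢(SpXX × M, ℂ)) :
    ∃ b : (ℝ × Plane) × (ℝ × Plane) → ℝ, Integrable b ∧
      ∀ η, |η| ≤ 1 → ∀ z, ‖D.kernelAmp L₁ L₂ φ η z‖ ≤ b z := by
  obtain ⟨ω₀, h0, R, hR, hsupp⟩ := hD.exists_source_support
  obtain ⟨C, hC0, hC⟩ := hD.exists_norm_kernel_le L₁ L₂ R φ
  obtain ⟨S, hS0, hS⟩ := hD.exists_norm_source_le
  refine ⟨fun z => ‖D.source z.1‖ * ((ω₀ ^ 2)⁻¹ * S * C *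
    ((1 + ‖z.2.1‖) ^ (-2 : ℝ) * (1 + ‖z.2.2‖) ^ (-3 : ℝ))), ?_, fun η hη z => ?_⟩
  · have i1 : Integrable fun ν : ℝ => (1 + ‖ν‖) ^ (-2 : ℝ) :=
      integrable_one_add_norm (by simp)
    have i2 : Integrable fun ξ : Plane => (1 + ‖ξ‖) ^ (-3 : ℝ) :=
      integrable_one_add_norm (by simp; norm_num)
    exact hD.integrable_source.norm.mul_prod ((i1.mul_prod i2).const_mul ((ω₀ ^ 2)⁻¹ * S * C))
  · rw [kernelAmp, norm_mul, norm_mul, norm_mul, RCLike.norm_conj]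
    by_cases hz1 : D.source z.1 = 0
    · simp [hz1]
    by_cases hz2 : D.source (partner η z) = 0
    · rw [hz2]; simp only [norm_zero, mul_zero, zero_mul]; positivity
    obtain ⟨a1, a2⟩ := hsupp _ hz1
    obtain ⟨b1, b2⟩ := hsupp _ hz2
    have e : ‖((((partner η z).1 ^ 2)⁻¹ : ℝ) : ℂ)‖ ≤ (ω₀ ^ 2)⁻¹ := by
      rw [Complex.norm_real, Real.norm_of_nonneg (by positivity)]
      refine inv_anti₀ (by positivity) ?_
      rw [← sq_abs (partner η z).1]
      gcongr
    calc _ ≤ (ω₀ ^ 2)⁻¹ * (‖D.source z.1‖ * S *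
          (C * ((1 + ‖z.2.1‖) ^ (-2 : ℝ) * (1 + ‖z.2.2‖) ^ (-3 : ℝ)))) := by
            gcongr
            · exact hS _
            · exact hC η _ _ _ hη a2 b2
      _ = _ := by ring

lemma tendsto_kernelAmp (φ : 𝓢(SpXX × M, ℂ)) (z : (ℝ × Plane) × (ℝ × Plane)) :
    Tendsto (fun η => D.kernelAmp L₁ L₂ φ η z) (𝓝 0) (𝓝 (D.kernelAmp L₁ L₂ φ 0 z)) := by
  have : ProperSpace M := FiniteDimensional.proper_real M
  obtain ⟨ω₀, h0, R, hR, hsupp⟩ := hD.exists_source_support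
  by_cases hz : D.source z.1 = 0
  · simp [kernelAmp, hz]
  have hω : z.1.1 ≠ 0 := by
    intro h
    have := (hsupp _ hz).1
    rw [h, abs_zero] at this
    linarith
  have hp := tendsto_partner hω
  have hp0 : partner 0 z = z.1 := by simp [partner, hω, smul_smul]
  have hk : Tendsto (fun η => D.kernel L₁ L₂ φ η z.1 (partner η z) z.2) (𝓝 0)
      (𝓝 (D.kernel L₁ L₂ φ 0 z.1 (partner 0 z) z.2)) := by
    refine tendsto_integral_filter_of_dominated_convergence (fun w => ‖φ w‖) ?_ ?_
      φ.integrable.norm ?_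
    · refine Eventually.of_forall fun η => Continuous.aestronglyMeasurable ?_
      have := continuous_kernelPhase (D := D) (L₁ := L₁) (L₂ := L₂) η z.1 (partner η z) z.2
      have := φ.continuous
      fun_prop
    · exact Eventually.of_forall fun η => Eventually.of_forall fun w => by simp
    · refine Eventually.of_forall fun w => Tendsto.const_mul _ ?_
      have hc : Continuous fun q : ℝ × (ℝ × Plane) =>
          cis (D.kernelPhase L₁ L₂ q.1 z.1 q.2 z.2 w) := by
        unfold kernelPhase
        fun_prop
      have := (hc.tendsto (0, z.1)).comp (tendsto_id.prodMk_nhds hp)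
      rw [hp0]
      exact this
  have hs : Tendsto (fun η => D.source (partner η z)) (𝓝 0) (𝓝 (D.source (partner 0 z))) := by
    rw [hp0]; exact (hD.continuous_source.tendsto _).comp hp
  have hi : Tendsto (fun η => ((((partner η z).1 ^ 2)⁻¹ : ℝ) : ℂ)) (𝓝 0)
      (𝓝 ((((partner 0 z).1 ^ 2)⁻¹ : ℝ) : ℂ)) := by
    refine (Complex.continuous_ofReal.tendsto _).comp ?_
    rw [hp0]
    exact (((continuous_fst.tendsto _).comp hp).pow 2).inv₀ (by positivity)
  exact hi.mul ((tendsto_const_nhds.mul ((Complex.continuous_conj.tendsto _).comp hs)).mul hk)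

lemma measurable_modPair {U : Plane → ℝ} (hU : Continuous U) (η : ℝ) (x₀ : Plane) :
    Measurable (D.modPair U η x₀) := by
  have h1 := measurable_partner η
  have h2 := hU.measurable
  unfold modPair modulation
  fun_prop

/-- The pairing of a product of two speckle profiles with a test function as an integral of the
random factor `modPair` against a deterministic amplitude which has a limit as `η → 0`. -/
lemma speckleMoment_eq (φ : 𝓢(SpXX × M, ℂ)) {U : Plane → ℝ} (hU : Continuous U) {η : ℝ}
    (hη : 0 < η) (hη1 : η ≤ 1) (x₀ : Plane) :
    D.speckleMoment L₁ L₂ φ U η x₀ = ((η ^ 4 : ℝ) : ℂ) *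
      ∫ z, D.kernelAmp L₁ L₂ φ η z * D.modPair U η x₀ z := by
  have : ProperSpace M := FiniteDimensional.proper_real M
  obtain ⟨b, hb, hbound⟩ := hD.exists_norm_kernelAmp_le L₁ L₂ φ
  have hKint : Integrable fun z => D.kernelAmp L₁ L₂ φ η z * D.modPair U η x₀ z := by
    refine hb.mono' ((hD.measurable_kernelAmp φ η).mul
      (hD.measurable_modPair hU η x₀)).aestronglyMeasurable (Eventually.of_forall fun z => ?_)
    rw [norm_mul, norm_modPair, mul_one]
    exact hbound η (by rwa [abs_of_pos hη]) z
  set m : ℝ × Plane → ℂ := fun z => D.modulation U z.1 (x₀ + η⁻¹ • z.2) with hm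
  have hmc : Continuous m := by
    simp only [hm, modulation]
    fun_prop
  set q : (SpXX × M) → (ℝ × Plane) × (ℝ × Plane) → ℝ := fun w z =>
    z.1.1 * D.specklePhase η w.1 (L₁ w.2) z.1.2 - z.2.1 * D.specklePhase η w.1 (L₂ w.2) z.2.2
    with hq
  have hqc : Continuous fun r : (SpXX × M) × (ℝ × Plane) × (ℝ × Plane) => q r.1 r.2 := by
    simp only [hq, specklePhase]
    fun_prop
  set B : (SpXX × M) → (ℝ × Plane) × (ℝ × Plane) → ℂ := fun w z =>
    φ w * (D.source z.1 * conj (D.source z.2)) * (m z.1 * conj (m z.2) * cis (q w z)) with hB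
  have hBint : Integrable (fun r : (SpXX × M) × (ℝ × Plane) × (ℝ × Plane) => B r.1 r.2)
      (volume.prod volume) := by
    have hsc := hD.integrable_source
    have h1 : Integrable fun z : (ℝ × Plane) × (ℝ × Plane) => D.source z.1 * conj (D.source z.2) :=
      hsc.mul_prod (LinearIsometryEquiv.integrable_comp_iff (Complex.conjLIE) |>.2 hsc)
    refine (φ.integrable.mul_prod h1).mul_bdd (c := 1)
      (Continuous.aestronglyMeasurable (by fun_prop)) (Eventually.of_forall fun r => ?_)
    simp [hm]
  have e1 : ∀ w, D.speckleInt U η x₀ w.1 (L₁ w.2) * conj (D.speckleInt U η x₀ w.1 (L₂ w.2)) *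
      φ w = ∫ z, B w z := by
    intro w
    rw [speckleInt, speckleInt, ← integral_conj, ← integral_prod_mul, ← integral_mul_const]
    congr 1; ext z
    simp only [hB, hq, hm, map_mul, conj_cis, sub_eq_add_neg, cis_add]
    ring
  rw [speckleMoment]
  simp only [e1]
  rw [integral_integral_swap hBint, Measure.volume_eq_prod (ℝ × Plane) (ℝ × Plane),
    integral_prod _ hKint, ← integral_const_mul]
  have hA := hBint.integral_prod_right
  rw [Measure.volume_eq_prod (ℝ × Plane) (ℝ × Plane)] at hA
  rw [integral_prod _ hA]
  refine integral_congr_ae ?_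
  filter_upwards [hA.prod_right_ae, hKint.prod_right_ae] with z₁ hz₁ hk₁
  have e2 : ∀ y, D.kernelAmp L₁ L₂ φ η (z₁, y) * D.modPair U η x₀ (z₁, y) =
      ((((partner η (z₁, y)).1 ^ 2)⁻¹ : ℝ) : ℂ) * ∫ w, B w (z₁, partner η (z₁, y)) := by
    intro y
    -- at `ω₂ = 0` both sides vanish because `0⁻¹ = 0`
    by_cases hz : (partner η (z₁, y)).1 = 0
    · simp [kernelAmp, hz]
    have h1 : z₁.1 - (partner η (z₁, y)).1 = η ^ 2 * y.1 := by simp [partner]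
    have h2 : z₁.1 • z₁.2 - (partner η (z₁, y)).1 • (partner η (z₁, y)).2 = η • y.2 := by
      have : (partner η (z₁, y)).1 • (partner η (z₁, y)).2 = z₁.1 • z₁.2 - η • y.2 := by
        rw [show (partner η (z₁, y)).2 = (partner η (z₁, y)).1⁻¹ • (z₁.1 • z₁.2 - η • y.2) from rfl,
          smul_smul, mul_inv_cancel₀ hz, one_smul]
      rw [this, sub_sub_cancel]
    have h3 := fun w => hD.kernelPhase_eq (L₁ := L₁) (L₂ := L₂) hη.ne' h1 h2 w
    rw [kernelAmp, mul_assoc]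
    congr 1
    rw [kernel, ← integral_const_mul, ← integral_mul_const]
    congr 1; ext w
    simp only [hB, hq, h3, modPair, hm]
    ring
  simp only [e2] at hk₁ ⊢
  exact integral_eq_integral_partner hη z₁ hz₁ hk₁

end Admissible
end Setup

/-! ### Averaging over the random interface -/

namespace Setup

variable {D : Setup} {M : Type*} [NormedAddCommGroup M] [NormedSpace ℝ M] [FiniteDimensional ℝ M]
  [MeasureSpace M] [BorelSpace M] [(volume : Measure M).IsAddHaarMeasure]
  {L₁ L₂ : M →L[ℝ] SpX} {Ω : Type*} [MeasurableSpace Ω] {P : Measure Ω} [IsProbabilityMeasure P]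
  {V : Plane → Ω → ℝ}

/-- The two-point function of the interface factors at a common frequency, which replaces `modPair`
in the limit of a small scale parameter. -/
noncomputable def modRef (D : Setup) (U : Plane → ℝ) (ω : ℝ) (x d : Plane) : ℂ :=
  cis (ω * (2 * D.s₀) * (U x - U (x + d)))

lemma norm_modRef (U : Plane → ℝ) (ω : ℝ) (x d : Plane) : ‖D.modRef U ω x d‖ = 1 := norm_cis _

lemma measurable_modPair_uncurry (hV : IsInterfaceField P V) (η : ℝ) (x₀ : Plane) :
    Measurable fun q : ((ℝ × Plane) × (ℝ × Plane)) × Ω =>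
      D.modPair (fun x => V x q.2) η x₀ q.1 := by
  have h1 : Measurable fun q : ((ℝ × Plane) × (ℝ × Plane)) × Ω => partner η q.1 :=
    (measurable_partner η).comp measurable_fst
  have h2 : Measurable fun q : ((ℝ × Plane) × (ℝ × Plane)) × Ω => V (x₀ + η⁻¹ • q.1.1.2) q.2 :=
    hV.measurable_comp (by fun_prop) measurable_snd
  have h3 : Measurable fun q : ((ℝ × Plane) × (ℝ × Plane)) × Ω =>
      V (x₀ + η⁻¹ • (partner η q.1).2) q.2 :=
    hV.measurable_comp (by fun_prop) measurable_snd
  have key : ∀ v₁ v₂ : ((ℝ × Plane) × (ℝ × Plane)) × Ω → ℝ, Measurable v₁ → Measurable v₂ →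
      Measurable fun q : ((ℝ × Plane) × (ℝ × Plane)) × Ω => cis (q.1.1.1 * (2 * D.s₀) * v₁ q) *
        conj (cis ((partner η q.1).1 * (2 * D.s₀) * v₂ q)) := fun v₁ v₂ hv₁ hv₂ => by fun_prop
  simp only [modPair, modulation]
  exact key _ _ h2 h3

lemma measurable_modPair_right (hV : IsInterfaceField P V) (η : ℝ) (x₀ : Plane)
    (z : (ℝ × Plane) × (ℝ × Plane)) : Measurable fun θ => D.modPair (fun x => V x θ) η x₀ z := by
  have hm : Measurable fun θ : Ω => (z, θ) := measurable_prodMk_left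
  have h := (measurable_modPair_uncurry (D := D) hV η x₀).comp hm
  simp only [Function.comp_def] at h
  exact h

lemma measurable_modRef (hV : IsInterfaceField P V) (ω : ℝ) (x d : Plane) :
    Measurable fun θ => D.modRef (fun y => V y θ) ω x d := by
  have h1 := hV.measurable x
  have h2 := hV.measurable (x + d)
  unfold modRef
  fun_prop

lemma integrable_modPair (hV : IsInterfaceField P V) (η : ℝ) (x₀ : Plane)
    (z : (ℝ × Plane) × (ℝ × Plane)) : Integrable (fun θ => D.modPair (fun x => V x θ) η x₀ z) P :=
  Integrable.of_bound (measurable_modPair_right hV η x₀ z).aestronglyMeasurable 1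
    (Eventually.of_forall fun _ => (norm_modPair _ _ _ _).le)

lemma integrable_modRef (hV : IsInterfaceField P V) (ω : ℝ) (x d : Plane) :
    Integrable (fun θ => D.modRef (fun y => V y θ) ω x d) P :=
  Integrable.of_bound (measurable_modRef hV ω x d).aestronglyMeasurable 1
    (Eventually.of_forall fun _ => (norm_modRef _ _ _ _).le)

lemma integral_modRef (hV : IsInterfaceField P V) (ω : ℝ) (x d : Plane) :
    ∫ θ, D.modRef (fun y => V y θ) ω x (-d) ∂P = fieldCorr P V (ω * (2 * D.s₀)) d := by
  have hF : StronglyMeasurable fun u : ℝ × ℝ => cis (ω * (2 * D.s₀) * (u.1 - u.2)) :=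
    Continuous.stronglyMeasurable (by fun_prop)
  have h := hV.integral_shift hF d 0 (x + -d)
  rw [show d + (x + -d) = x by abel, zero_add] at h
  exact h

variable {ι : Type*} {l : Filter ι} {η : ι → ℝ}

/-- In units of the correlation length, the difference `X₂ - X₁` of the interface points tends to
`-ξ / ω₁`. -/
lemma tendsto_partner_sub (hη : Tendsto η l (𝓝[>] 0)) {z : (ℝ × Plane) × (ℝ × Plane)}
    (hz : z.1.1 ≠ 0) :
    Tendsto (fun i => (η i)⁻¹ • ((partner (η i) z).2 - z.1.2)) l (𝓝 (-(z.1.1⁻¹ • z.2.2))) := by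
  have hη0 : Tendsto η l (𝓝 0) := hη.mono_right nhdsWithin_le_nhds
  have hp : Tendsto (fun i => (partner (η i) z).1) l (𝓝 z.1.1) :=
    (continuous_fst.tendsto _).comp ((tendsto_partner hz).comp hη0)
  have h1 : Tendsto (fun i => (partner (η i) z).1⁻¹ • ((η i * z.2.1) • z.1.2 - z.2.2)) l
      (𝓝 (z.1.1⁻¹ • ((0 * z.2.1) • z.1.2 - z.2.2))) :=
    (hp.inv₀ hz).smul (((hη0.mul_const _).smul_const _).sub_const _)
  rw [zero_mul, zero_smul, zero_sub, smul_neg] at h1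
  refine h1.congr' ?_
  filter_upwards [hη self_mem_nhdsWithin, hp.eventually_ne hz] with i hi hne
  have hi' : η i ≠ 0 := ne_of_gt hi
  have hi1 : (partner (η i) z).1 = z.1.1 - η i ^ 2 * z.2.1 := rfl
  have hi2 : (partner (η i) z).2 = (partner (η i) z).1⁻¹ • (z.1.1 • z.1.2 - η i • z.2.2) := rfl
  have e' : (partner (η i) z).2 - z.1.2 =
      (partner (η i) z).1⁻¹ • (η i • ((η i * z.2.1) • z.1.2 - z.2.2)) := by
    have e : (partner (η i) z).2 - z.1.2 = (partner (η i) z).1⁻¹ • (z.1.1 • z.1.2 - η i • z.2.2) -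
        (partner (η i) z).1⁻¹ • ((partner (η i) z).1 • z.1.2) := by
      rw [smul_smul (partner (η i) z).1⁻¹ (partner (η i) z).1, inv_mul_cancel₀ hne, one_smul, ← hi2]
    rw [e, ← smul_sub]
    congr 1
    rw [hi1]
    module
  rw [e', smul_comm _ (η i), smul_smul, inv_mul_cancel₀ hi', one_smul]

/-- By stationarity the specular point drops out of the expectation; path continuity and dominated
convergence then allow passing to the limit in the second frequency and interface point. -/
lemma tendsto_integral_norm_modPair_sub [l.IsCountablyGenerated] (hV : IsInterfaceField P V)
    (hη : Tendsto η l (𝓝[>] 0)) (x₀ : ι → Plane) {z : (ℝ × Plane) × (ℝ × Plane)} (hz : z.1.1 ≠ 0) :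
    Tendsto (fun i => ∫ θ, ‖D.modPair (fun x => V x θ) (η i) (x₀ i) z -
      D.modRef (fun x => V x θ) z.1.1 (x₀ i + (η i)⁻¹ • z.1.2) (-(z.1.1⁻¹ • z.2.2))‖ ∂P) l
      (𝓝 0) := by
  have hη0 : Tendsto η l (𝓝 0) := hη.mono_right nhdsWithin_le_nhds
  have hp : Tendsto (fun i => (partner (η i) z).1) l (𝓝 z.1.1) :=
    (continuous_fst.tendsto _).comp ((tendsto_partner hz).comp hη0)
  set d : Plane := -(z.1.1⁻¹ • z.2.2) with hd
  set δ : ι → Plane := fun i => (η i)⁻¹ • ((partner (η i) z).2 - z.1.2) with hδd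
  have hδ : Tendsto δ l (𝓝 d) := tendsto_partner_sub hη hz
  have e : ∀ i, ∫ θ, ‖D.modPair (fun x => V x θ) (η i) (x₀ i) z -
      D.modRef (fun x => V x θ) z.1.1 (x₀ i + (η i)⁻¹ • z.1.2) d‖ ∂P =
      ∫ θ, ‖cis (-((partner (η i) z).1 * (2 * D.s₀) * V (δ i) θ)) -
        cis (-(z.1.1 * (2 * D.s₀) * V d θ))‖ ∂P := by
    intro i
    have hF : StronglyMeasurable fun u : ℝ × ℝ =>
        ‖cis (-((partner (η i) z).1 * (2 * D.s₀) * u.1)) - cis (-(z.1.1 * (2 * D.s₀) * u.2))‖ :=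
      Continuous.stronglyMeasurable (by fun_prop)
    rw [← hV.integral_shift hF (δ i) d (x₀ i + (η i)⁻¹ • z.1.2)]
    congr 1; ext θ
    have e1 : δ i + (x₀ i + (η i)⁻¹ • z.1.2) = x₀ i + (η i)⁻¹ • (partner (η i) z).2 := by
      simp only [hδd, smul_sub]; abel
    have e2 : ∀ κ a b : ℝ, cis (κ * (a - b)) = cis (κ * a) * cis (-(κ * b)) := fun κ a b => by
      rw [← cis_add]; congr 1; ring
    simp only [e1, add_comm d, modPair, modRef, modulation, conj_cis, e2]
    rw [← mul_sub, norm_mul, norm_cis, one_mul]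
  simp only [e]
  have h0 : ∫ θ, ‖cis (-(z.1.1 * (2 * D.s₀) * V d θ)) - cis (-(z.1.1 * (2 * D.s₀) * V d θ))‖ ∂P
      = 0 := by simp
  rw [← h0]
  refine tendsto_integral_filter_of_dominated_convergence (fun _ => 2) ?_ ?_
    (integrable_const _) ?_
  · refine Eventually.of_forall fun i => Measurable.aestronglyMeasurable ?_
    have h1 := hV.measurable (δ i)
    have h2 := hV.measurable d
    fun_prop
  · refine Eventually.of_forall fun i => Eventually.of_forall fun θ => ?_
    rw [norm_norm]
    refine (norm_sub_le _ _).trans ?_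
    rw [norm_cis, norm_cis]
    norm_num
  · refine Eventually.of_forall fun θ => Tendsto.norm (Tendsto.sub_const ?_ _)
    exact (continuous_cis.tendsto _).comp
      (((hp.mul_const _).mul (((hV.continuous θ).tendsto d).comp hδ)).neg)

lemma tendsto_integral_modPair [l.IsCountablyGenerated] (hV : IsInterfaceField P V)
    (hη : Tendsto η l (𝓝[>] 0)) (x₀ : ι → Plane) {z : (ℝ × Plane) × (ℝ × Plane)} (hz : z.1.1 ≠ 0) :
    Tendsto (fun i => ∫ θ, D.modPair (fun x => V x θ) (η i) (x₀ i) z ∂P) l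
      (𝓝 (fieldCorr P V (z.1.1 * (2 * D.s₀)) (z.1.1⁻¹ • z.2.2))) := by
  refine tendsto_iff_norm_sub_tendsto_zero.2 (squeeze_zero (fun _ => norm_nonneg _) (fun i => ?_)
    (tendsto_integral_norm_modPair_sub (D := D) hV hη x₀ hz))
  rw [← integral_modRef hV z.1.1 (x₀ i + (η i)⁻¹ • z.1.2),
    ← integral_sub (integrable_modPair hV _ _ _) (integrable_modRef hV _ _ _)]
  exact norm_integral_le_integral_norm _

/-- Mixing: pairs attached to distinct interface points become independent. -/
lemma tendsto_integral_modPair_mul_conj [l.IsCountablyGenerated] (hV : IsInterfaceField P V)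
    (hη : Tendsto η l (𝓝[>] 0)) (x₀ : ι → Plane) {z z' : (ℝ × Plane) × (ℝ × Plane)}
    (hz : z.1.1 ≠ 0) (hz' : z'.1.1 ≠ 0) (hne : z.1.2 ≠ z'.1.2) :
    Tendsto (fun i => ∫ θ, D.modPair (fun x => V x θ) (η i) (x₀ i) z *
        conj (D.modPair (fun x => V x θ) (η i) (x₀ i) z') ∂P) l
      (𝓝 (fieldCorr P V (z.1.1 * (2 * D.s₀)) (z.1.1⁻¹ • z.2.2) *
        conj (fieldCorr P V (z'.1.1 * (2 * D.s₀)) (z'.1.1⁻¹ • z'.2.2)))) := by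
  set W : (ℝ × Plane) × (ℝ × Plane) → ι → Ω → ℂ := fun z i θ =>
    D.modPair (fun x => V x θ) (η i) (x₀ i) z with hW
  set R : (ℝ × Plane) × (ℝ × Plane) → ι → Ω → ℂ := fun z i θ =>
    D.modRef (fun x => V x θ) z.1.1 (x₀ i + (η i)⁻¹ • z.1.2) (-(z.1.1⁻¹ • z.2.2)) with hR
  have hWm : ∀ z i, Measurable (W z i) := fun z i => measurable_modPair_right hV _ _ _
  have hRm : ∀ z i, Measurable (R z i) := fun z i => measurable_modRef hV _ _ _
  have hW1 : ∀ z i θ, ‖W z i θ‖ = 1 := fun z i θ => norm_modPair _ _ _ _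
  have hR1 : ∀ z i θ, ‖R z i θ‖ = 1 := fun z i θ => norm_modRef _ _ _ _
  have hWR : ∀ z i, Integrable (fun θ => ‖W z i θ - R z i θ‖) P := fun z i =>
    ((integrable_modPair hV _ _ _).sub (integrable_modRef hV _ _ _)).norm
  have hint : ∀ {f g : Ω → ℂ}, Measurable f → Measurable g → (∀ θ, ‖f θ‖ = 1) → (∀ θ, ‖g θ‖ = 1) →
      Integrable (fun θ => f θ * conj (g θ)) P := fun hf hg hf1 hg1 =>
    Integrable.of_bound (hf.mul (Complex.continuous_conj.measurable.comp hg)).aestronglyMeasurable 1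
      (Eventually.of_forall fun θ => by simp [hf1, hg1])
  -- replacing both pairs by their reference versions costs nothing in the limit
  have h1 : Tendsto (fun i => ∫ θ, W z i θ * conj (W z' i θ) ∂P -
      ∫ θ, R z i θ * conj (R z' i θ) ∂P) l (𝓝 0) := by
    have hlim := (tendsto_integral_norm_modPair_sub (D := D) hV hη x₀ hz).add
      (tendsto_integral_norm_modPair_sub (D := D) hV hη x₀ hz')
    rw [add_zero] at hlim
    refine squeeze_zero_norm (fun i => ?_) hlim
    rw [← integral_sub (hint (hWm _ _) (hWm _ _) (hW1 _ _) (hW1 _ _))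
      (hint (hRm _ _) (hRm _ _) (hR1 _ _) (hR1 _ _)), ← integral_add (hWR z i) (hWR z' i)]
    refine norm_integral_le_of_norm_le ((hWR z i).add (hWR z' i)) (Eventually.of_forall fun θ => ?_)
    have e : W z i θ * conj (W z' i θ) - R z i θ * conj (R z' i θ) =
        (W z i θ - R z i θ) * conj (W z' i θ) + R z i θ * conj (W z' i θ - R z' i θ) := by
      rw [map_sub]; ring
    rw [e]
    refine (norm_add_le _ _).trans (le_of_eq ?_)
    rw [norm_mul, norm_mul, RCLike.norm_conj, RCLike.norm_conj, hW1, hR1, mul_one, one_mul]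
  have hdist : Tendsto (fun i => dist (x₀ i + (η i)⁻¹ • z.1.2) (x₀ i + (η i)⁻¹ • z'.1.2)) l
      atTop := by
    have hinv : Tendsto (fun i => (η i)⁻¹) l atTop := tendsto_inv_nhdsGT_zero.comp hη
    refine (hinv.atTop_mul_const (dist_pos.2 hne)).congr' ?_
    filter_upwards [hη self_mem_nhdsWithin] with i hi
    rw [dist_add_left, dist_smul₀, Real.norm_of_nonneg (inv_nonneg.2 (le_of_lt hi))]
  have hF : ∀ ω : ℝ, Measurable fun u : ℝ × ℝ => cis (ω * (2 * D.s₀) * (u.1 - u.2)) := fun ω => by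
    fun_prop
  have h2 := tendsto_cov_of_dist_tendsto hV hdist (-(z.1.1⁻¹ • z.2.2)) (-(z'.1.1⁻¹ • z'.2.2))
    (hF z.1.1) (G := fun u => conj (cis (z'.1.1 * (2 * D.s₀) * (u.1 - u.2))))
    (Complex.continuous_conj.measurable.comp (hF z'.1.1)) (by simp) (by simp)
  have h3 := (h1.add h2).add_const (fieldCorr P V (z.1.1 * (2 * D.s₀)) (z.1.1⁻¹ • z.2.2) *
    conj (fieldCorr P V (z'.1.1 * (2 * D.s₀)) (z'.1.1⁻¹ • z'.2.2)))
  rw [add_zero, zero_add] at h3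
  refine h3.congr fun i => ?_
  rw [← integral_modRef hV z.1.1 (x₀ i + (η i)⁻¹ • z.1.2),
    ← integral_modRef hV z'.1.1 (x₀ i + (η i)⁻¹ • z'.1.2), ← integral_conj]
  simp only [hR, modRef]
  ring

lemma ae_fst_ne_zero : ∀ᵐ z : (ℝ × Plane) × (ℝ × Plane), z.1.1 ≠ 0 := by
  have h : ∀ᵐ s : ℝ, s ≠ 0 := by simp [ae_iff]
  exact (Measure.quasiMeasurePreserving_fst.comp Measure.quasiMeasurePreserving_fst).ae h

lemma ae_snd_ne (c : Plane) : ∀ᵐ z : (ℝ × Plane) × (ℝ × Plane), c ≠ z.1.2 := by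
  have h : ∀ᵐ x : Plane, c ≠ x := by simp [ae_iff]
  exact (Measure.quasiMeasurePreserving_snd.comp Measure.quasiMeasurePreserving_fst).ae h

/-- Almost every pair of arguments has nonzero frequencies and distinct interface points. -/
lemma ae_pair_generic : ∀ᵐ q : ((ℝ × Plane) × (ℝ × Plane)) × ((ℝ × Plane) × (ℝ × Plane))
    ∂((volume : Measure ((ℝ × Plane) × (ℝ × Plane))).prod volume),
    q.1.1.1 ≠ 0 ∧ q.2.1.1 ≠ 0 ∧ q.1.1.2 ≠ q.2.1.2 := by
  have h3 : ∀ᵐ q : ((ℝ × Plane) × (ℝ × Plane)) × ((ℝ × Plane) × (ℝ × Plane))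
      ∂((volume : Measure ((ℝ × Plane) × (ℝ × Plane))).prod volume), q.1.1.2 ≠ q.2.1.2 := by
    refine (Measure.ae_prod_iff_ae_ae ?_).2 (Eventually.of_forall fun z => ae_snd_ne z.1.2)
    exact (measurableSet_eq_fun (by fun_prop) (by fun_prop)).compl
  filter_upwards [Measure.quasiMeasurePreserving_fst.ae ae_fst_ne_zero,
    Measure.quasiMeasurePreserving_snd.ae ae_fst_ne_zero, h3] with q h1 h2 h3
  exact ⟨h1, h2, h3⟩

/-- The limit of the pairing of a product of two speckle profiles with a test function, before its
identification. -/
noncomputable def momentLimit (D : Setup) (P : Measure Ω) (V : Plane → Ω → ℝ) (L₁ L₂ : M →L[ℝ] SpX)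
    (φ : 𝓢(SpXX × M, ℂ)) : ℂ :=
  ∫ z, D.kernelAmp L₁ L₂ φ 0 z * fieldCorr P V (z.1.1 * (2 * D.s₀)) (z.1.1⁻¹ • z.2.2)

namespace Admissible

variable (hD : D.Admissible)
include hD

lemma stronglyMeasurable_speckleInt (hV : IsInterfaceField P V) (L : M →L[ℝ] SpX) (η : ℝ)
    (x₀ : Plane) : StronglyMeasurable fun r : (SpXX × M) × Ω =>
      D.speckleInt (fun x => V x r.2) η x₀ r.1.1 (L r.1.2) := by
  have h1 : Measurable fun r : ((SpXX × M) × Ω) × (ℝ × Plane) => V (x₀ + η⁻¹ • r.2.2) r.1.2 :=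
    hV.measurable_comp (by fun_prop) (by fun_prop)
  have h2 : Measurable fun r : ((SpXX × M) × Ω) × (ℝ × Plane) => D.source r.2 :=
    hD.continuous_source.measurable.comp measurable_snd
  have h3 : Measurable fun r : ((SpXX × M) × Ω) × (ℝ × Plane) =>
      D.specklePhase η r.1.1.1 (L r.1.1.2) r.2.2 := by
    have hc : Continuous fun r : (SpXX × M) × (ℝ × Plane) =>
        D.specklePhase η r.1.1 (L r.1.2) r.2.2 := by
      unfold specklePhase
      fun_prop
    have : ProperSpace M := FiniteDimensional.proper_real M
    have hm : Measurable fun r : ((SpXX × M) × Ω) × (ℝ × Plane) => (r.1.1, r.2) := by fun_prop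
    exact hc.measurable.comp hm
  have h4 : Measurable fun r : ((SpXX × M) × Ω) × (ℝ × Plane) =>
      D.source r.2 * (D.modulation (fun x => V x r.1.2) r.2.1 (x₀ + η⁻¹ • r.2.2) *
        cis (r.2.1 * D.specklePhase η r.1.1.1 (L r.1.1.2) r.2.2)) := by
    have key : ∀ v : ((SpXX × M) × Ω) × (ℝ × Plane) → ℝ, Measurable v →
        Measurable fun r : ((SpXX × M) × Ω) × (ℝ × Plane) => D.source r.2 *
          (cis (r.2.1 * (2 * D.s₀) * v r) *
            cis (r.2.1 * D.specklePhase η r.1.1.1 (L r.1.1.2) r.2.2)) := fun v hv => by fun_prop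
    simp only [modulation]
    exact key _ h1
  exact StronglyMeasurable.integral_prod_right' (ν := (volume : Measure (ℝ × Plane)))
    h4.stronglyMeasurable

lemma stronglyMeasurable_moment_integrand (hV : IsInterfaceField P V) (φ : 𝓢(SpXX × M, ℂ)) (η : ℝ)
    (x₀ : Plane) : StronglyMeasurable fun r : (SpXX × M) × Ω =>
      D.speckleInt (fun x => V x r.2) η x₀ r.1.1 (L₁ r.1.2) *
        conj (D.speckleInt (fun x => V x r.2) η x₀ r.1.1 (L₂ r.1.2)) * φ r.1 := by
  have : ProperSpace M := FiniteDimensional.proper_real M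
  have h := φ.continuous.measurable.comp
    (measurable_fst : Measurable (Prod.fst : (SpXX × M) × Ω → SpXX × M))
  exact ((hD.stronglyMeasurable_speckleInt hV L₁ η x₀).mul
    (Complex.continuous_conj.comp_stronglyMeasurable
      (hD.stronglyMeasurable_speckleInt hV L₂ η x₀))).mul h.stronglyMeasurable

lemma integrable_moment_integrand (hV : IsInterfaceField P V) (φ : 𝓢(SpXX × M, ℂ)) (η : ℝ)
    (x₀ : Plane) (θ : Ω) : Integrable fun w : SpXX × M =>
      D.speckleInt (fun x => V x θ) η x₀ w.1 (L₁ w.2) *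
        conj (D.speckleInt (fun x => V x θ) η x₀ w.1 (L₂ w.2)) * φ w := by
  obtain ⟨C, hC0, hC⟩ := hD.exists_norm_speckleInt_le
  refine (φ.integrable.norm.const_mul (C * C)).mono' ?_ (Eventually.of_forall fun w => ?_)
  · exact ((hD.stronglyMeasurable_moment_integrand hV φ η x₀).comp_measurable
      (measurable_id.prodMk measurable_const)).aestronglyMeasurable
  · rw [norm_mul, norm_mul, RCLike.norm_conj]
    gcongr <;> exact hC _ _ _ _ _

lemma stronglyMeasurable_speckleMoment (hV : IsInterfaceField P V) (φ : 𝓢(SpXX × M, ℂ)) (η : ℝ)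
    (x₀ : Plane) :
    StronglyMeasurable fun θ => D.speckleMoment L₁ L₂ φ (fun x => V x θ) η x₀ :=
  have : ProperSpace M := FiniteDimensional.proper_real M
  StronglyMeasurable.integral_prod_left' (μ := (volume : Measure (SpXX × M)))
    (hD.stronglyMeasurable_moment_integrand hV φ η x₀)

/-- Self-averaging of the pairing of a product of two speckle profiles with a test function. -/
lemma tendstoInMeasure_speckleMoment [l.IsCountablyGenerated] (hV : IsInterfaceField P V)
    (hη : Tendsto η l (𝓝[>] 0)) (x₀ : ι → Plane) (φ : 𝓢(SpXX × M, ℂ)) (c : ℂ) :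
    TendstoInMeasure P (fun i θ => c * ((((η i) ^ 4)⁻¹ : ℝ) : ℂ) *
      D.speckleMoment L₁ L₂ φ (fun x => V x θ) (η i) (x₀ i)) l
      (fun _ => c * D.momentLimit P V L₁ L₂ φ) := by
  obtain ⟨b, hb, hbound⟩ := hD.exists_norm_kernelAmp_le L₁ L₂ φ
  have hη0 : Tendsto η l (𝓝 0) := hη.mono_right nhdsWithin_le_nhds
  have hpos : ∀ᶠ i in l, 0 < η i := hη self_mem_nhdsWithin
  have hle : ∀ᶠ i in l, η i ≤ 1 := (hη0.eventually_lt_const one_pos).mono fun i hi => hi.le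
  have hms := tendsto_meanSquare_integral (P := P) hb (l := l)
    (f := fun i => D.kernelAmp L₁ L₂ φ (η i)) (f₀ := D.kernelAmp L₁ L₂ φ 0)
    (W := fun i z θ => D.modPair (fun x => V x θ) (η i) (x₀ i) z)
    (w := fun z => fieldCorr P V (z.1.1 * (2 * D.s₀)) (z.1.1⁻¹ • z.2.2))
    (Eventually.of_forall fun i => (hD.measurable_kernelAmp φ _).aestronglyMeasurable)
    (by
      filter_upwards [hpos, hle] with i h0 h1
      exact hbound _ (by rwa [abs_of_pos h0]))
    (Eventually.of_forall fun z => (hD.tendsto_kernelAmp φ z).comp hη0)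
    (fun i => measurable_modPair_uncurry hV _ _) (fun i z θ => (norm_modPair _ _ _ _).le)
    (ae_fst_ne_zero.mono fun z hz => tendsto_integral_modPair hV hη x₀ hz)
    (ae_pair_generic.mono fun q hq =>
      tendsto_integral_modPair_mul_conj hV hη x₀ hq.1 hq.2.1 hq.2.2)
  have heq : ∀ᶠ i in l, ∀ θ, c * ((((η i) ^ 4)⁻¹ : ℝ) : ℂ) *
      D.speckleMoment L₁ L₂ φ (fun x => V x θ) (η i) (x₀ i) =
      c * ∫ z, D.kernelAmp L₁ L₂ φ (η i) z * D.modPair (fun x => V x θ) (η i) (x₀ i) z := by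
    filter_upwards [hpos, hle] with i h0 h1 θ
    rw [hD.speckleMoment_eq φ (hV.continuous θ) h0 h1, mul_assoc, ← mul_assoc _ (((η i) ^ 4 : ℝ) : ℂ),
      ← Complex.ofReal_mul, inv_mul_cancel₀ (by positivity), Complex.ofReal_one, one_mul]
  refine tendstoInMeasure_of_tendsto_meanSquare (C := fun _ => ‖c‖ * ∫ z, b z) ?_ ?_ ?_
  · exact Eventually.of_forall fun i => ((hD.stronglyMeasurable_speckleMoment hV φ _ _).const_mul
      _).aestronglyMeasurable
  · filter_upwards [hpos, hle, heq] with i h0 h1 h θ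
    rw [h θ, norm_mul]
    gcongr
    refine norm_integral_le_of_norm_le hb (Eventually.of_forall fun z => ?_)
    rw [norm_mul, norm_modPair, mul_one]
    exact hbound _ (by rwa [abs_of_pos h0]) z
  · have h2 := hms.const_mul (‖c‖ ^ 2)
    rw [mul_zero] at h2
    refine h2.congr' (heq.mono fun i h => ?_)
    rw [← integral_const_mul]
    congr 1; ext θ
    rw [h θ, ← mul_sub, norm_mul, mul_pow, momentLimit]

end Admissible
end Setup

/-! ### Identification of the limit -/

section Inversion

variable {Q : Type*} [MeasurableSpace Q] {μ : Measure Q} [SFinite μ]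

/-- Fourier inversion for the Dirac mass `δ(s - h(q))`, written as an oscillatory integral. -/
lemma integral_cis_sub_eq {F : Q × ℝ → ℂ} (hF : Integrable F (μ.prod volume))
    (hFm : StronglyMeasurable F) (hFc : ∀ q, Continuous fun s => F (q, s)) {B : Q → ℝ}
    (hB : Integrable B μ) (hFB : ∀ q s, ‖F (q, s)‖ ≤ B q) {h : Q → ℝ} (hh : Measurable h)
    (hK : Integrable fun ν : ℝ => ∫ z, F z * cis (ν * (h z.1 - z.2)) ∂(μ.prod volume)) :
    ∫ ν : ℝ, ∫ z, F z * cis (ν * (h z.1 - z.2)) ∂(μ.prod volume) =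
      2 * Real.pi * ∫ q, F (q, h q) ∂μ := by
  -- shearing by `h` turns the phase into `-ν s`, independent of `q`
  set G : Q × ℝ → ℂ := fun z => F (z.1, z.2 + h z.1) with hG
  have hmp : MeasurePreserving (fun z : Q × ℝ => (z.1, z.2 + h z.1)) (μ.prod volume)
      (μ.prod volume) :=
    (MeasurePreserving.id μ).skew_product (g := fun q s => s + h q)
      (measurable_snd.add (hh.comp measurable_fst))
      (Eventually.of_forall fun q => map_add_right_eq_self volume (h q))
  have hGi : Integrable G (μ.prod volume) := hmp.integrable_comp_of_integrable hF
  have hGm : StronglyMeasurable G := hFm.comp_measurable hmp.measurable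
  set g : ℝ → ℂ := fun s => ∫ q, G (q, s) ∂μ with hg
  have hgi : Integrable g := hGi.integral_prod_right
  have hgc : Continuous g := by
    refine continuous_of_dominated (bound := B)
      (fun s => (hGm.comp_measurable measurable_prodMk_right).aestronglyMeasurable)
      (fun s => Eventually.of_forall fun q => hFB q _) hB (Eventually.of_forall fun q => ?_)
    exact (hFc q).comp (continuous_add_const (h q))
  have hKg : ∀ ν : ℝ, ∫ z, F z * cis (ν * (h z.1 - z.2)) ∂(μ.prod volume) =
      ∫ s, cis (-inner ℝ ν s) * g s := by
    intro ν
    have hc : ∀ {H : Q × ℝ → ℂ}, Integrable H (μ.prod volume) → ∀ p : Q × ℝ → ℝ, Measurable p →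
        Integrable (fun z => H z * cis (p z)) (μ.prod volume) := fun hH p hp =>
      hH.mul_bdd (c := 1) (measurable_cis.comp hp).aestronglyMeasurable (by simp)
    have i1 := hc hF (fun z => ν * (h z.1 - z.2))
      (((hh.comp measurable_fst).sub measurable_snd).const_mul ν)
    have i2 := hc hGi (fun z => -inner ℝ ν z.2) (by fun_prop)
    calc ∫ z, F z * cis (ν * (h z.1 - z.2)) ∂(μ.prod volume)
        = ∫ q, (∫ s, F (q, s) * cis (ν * (h q - s))) ∂μ := integral_prod _ i1
      _ = ∫ q, (∫ s, G (q, s) * cis (-inner ℝ ν s)) ∂μ := by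
          congr 1; ext q
          rw [← integral_add_right_eq_self (fun s => F (q, s) * cis (ν * (h q - s))) (h q)]
          congr 1; ext s
          simp only [hG, sub_add_cancel_right, real_inner_eq_re_inner]
          congr 2
          simp [mul_comm]
      _ = ∫ s, ∫ q, G (q, s) * cis (-inner ℝ ν s) ∂μ := integral_integral_swap i2
      _ = _ := by
          congr 1; ext s
          rw [integral_mul_const, mul_comm]
  simp only [hKg] at hK ⊢
  have := fourier_inversion_cis hgc hgi hK 0
  simp only [inner_zero_right, cis_zero, one_mul, Module.finrank_self, pow_one] at this
  rw [this]
  simp [hg, hG]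

end Inversion

lemma SchwartzMap.exists_norm_le_one_add_rpow {E : Type*} [NormedAddCommGroup E] [NormedSpace ℝ E]
    (φ : 𝓢(E, ℂ)) (k : ℕ) : ∃ C, 0 ≤ C ∧ ∀ x, ‖φ x‖ ≤ C * (1 + ‖x‖) ^ (-(k : ℝ)) := by
  refine ⟨2 ^ k * ((Finset.Iic (k, 0)).sup fun m => SchwartzMap.seminorm ℝ m.1 m.2) φ,
    by positivity, fun x => ?_⟩
  have h := SchwartzMap.one_add_le_sup_seminorm_apply (𝕜 := ℝ) (m := (k, 0)) le_rfl le_rfl φ x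
  rw [norm_iteratedFDeriv_zero] at h
  rw [Real.rpow_neg (by positivity), Real.rpow_natCast, ← div_eq_mul_inv,
    le_div_iff₀ (by positivity), mul_comm]
  exact h

lemma integral_comp_linear {E : Type*} [NormedAddCommGroup E] [NormedSpace ℝ E]
    [MeasurableSpace E] [BorelSpace E] [FiniteDimensional ℝ E] (μ : Measure E) [μ.IsAddHaarMeasure]
    (A : E →L[ℝ] E) (hA : 0 < A.toLinearMap.det) (f : E → ℂ) :
    ∫ x, f x ∂μ = (A.toLinearMap.det : ℂ) * ∫ x, f (A x) ∂μ := by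
  have hinj : Function.Injective A := by
    have := (LinearEquiv.ofIsUnitDet (f := A.toLinearMap) (v := Module.finBasis ℝ E)
      (v' := Module.finBasis ℝ E) (by
        rw [LinearMap.det_toMatrix]; exact hA.ne'.isUnit)).injective
    exact this
  have hsurj : Function.Surjective A := LinearMap.injective_iff_surjective.1 hinj
  have h := integral_image_eq_integral_abs_det_fderiv_smul μ (s := Set.univ) (f := A)
    (f' := fun _ => A) MeasurableSet.univ (fun x _ => A.hasFDerivAt.hasFDerivWithinAt)
    hinj.injOn f
  rw [Set.image_univ, hsurj.range_eq, setIntegral_univ, setIntegral_univ, integral_smul] at h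
  rw [h, ContinuousLinearMap.det, abs_of_pos hA, Complex.real_smul]

instance {M : Type*} [NormedAddCommGroup M] [NormedSpace ℝ M] [FiniteDimensional ℝ M]
    [MeasureSpace M] [BorelSpace M] [(volume : Measure M).IsAddHaarMeasure] :
    (volume : Measure ((Plane × Plane) × M)).IsAddHaarMeasure := isAddHaarMeasure_volume_prod

instance {M : Type*} [NormedAddCommGroup M] [NormedSpace ℝ M] [FiniteDimensional ℝ M]
    [MeasureSpace M] [BorelSpace M] [(volume : Measure M).IsAddHaarMeasure] :
    (volume : Measure (Plane × M)).IsAddHaarMeasure := isAddHaarMeasure_volume_prod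

instance {M : Type*} [NormedAddCommGroup M] [NormedSpace ℝ M] [FiniteDimensional ℝ M]
    [MeasureSpace M] [BorelSpace M] [(volume : Measure M).IsAddHaarMeasure] :
    (volume : Measure (Plane × Plane × M)).IsAddHaarMeasure := isAddHaarMeasure_volume_prod

namespace Setup

variable {D : Setup} {M : Type*} [NormedAddCommGroup M] [NormedSpace ℝ M] [FiniteDimensional ℝ M]
  [MeasureSpace M] [BorelSpace M] [(volume : Measure M).IsAddHaarMeasure]
  {L₁ L₂ : M →L[ℝ] SpX}

/-- The test function, restricted to the support of the Dirac masses at the direction `p`,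
modulated, and integrated over the remaining variables. -/
noncomputable def diracTest (D : Setup) (L₁ L₂ : M →L[ℝ] SpX) (φ : 𝓢(SpXX × M, ℂ)) (ω : ℝ)
    (p : Plane) : ℂ :=
  ∫ m : Plane × M, cis (-(ω * (((L₁ m.2).1 - (L₂ m.2).1) -
    inner ℝ p ((L₁ m.2).2 - (L₂ m.2).2)))) * φ ((D.sDirac p, D.yDirac p, m.1), m.2)

/-- The limit of the kernel as the scale parameter tends to zero. -/
noncomputable def kernelZero (D : Setup) (L₁ L₂ : M →L[ℝ] SpX) (φ : 𝓢(SpXX × M, ℂ)) (ω : ℝ)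
    (y : ℝ × Plane) : ℂ := D.kernel L₁ L₂ φ 0 (ω, 0) (ω, 0) y

lemma kernelAmp_zero (φ : 𝓢(SpXX × M, ℂ)) {z : (ℝ × Plane) × (ℝ × Plane)} (hz : z.1.1 ≠ 0) :
    D.kernelAmp L₁ L₂ φ 0 z =
      (((z.1.1 ^ 2)⁻¹ * ‖D.source z.1‖ ^ 2 : ℝ) : ℂ) * D.kernelZero L₁ L₂ φ z.1.1 z.2 := by
  have hp0 : partner 0 z = z.1 := by simp [partner, hz, smul_smul]
  have hk : D.kernel L₁ L₂ φ 0 z.1 z.1 z.2 = D.kernelZero L₁ L₂ φ z.1.1 z.2 := by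
    simp [kernelZero, kernel, kernelPhase]
  rw [kernelAmp, hp0, hk, Complex.mul_conj, Complex.normSq_eq_norm_sq]
  push_cast
  ring

lemma measurable_kernelZero (φ : 𝓢(SpXX × M, ℂ)) (ω : ℝ) :
    Measurable (D.kernelZero L₁ L₂ φ ω) := by
  have : ProperSpace M := FiniteDimensional.proper_real M
  have hm : Measurable fun r : (ℝ × Plane) × (SpXX × M) =>
      (((ω, (0 : Plane)), (ω, (0 : Plane)), r.1), r.2) := by fun_prop
  have hc : Measurable fun r : (ℝ × Plane) × (SpXX × M) =>
      D.kernelPhase L₁ L₂ 0 (ω, 0) (ω, 0) r.1 r.2 :=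
    (continuous_kernelPhase_uncurry (D := D) (L₁ := L₁) (L₂ := L₂) 0).measurable.comp hm
  have hφ : Measurable fun r : (ℝ × Plane) × (SpXX × M) => φ r.2 :=
    φ.continuous.measurable.comp measurable_snd
  have h : Measurable fun r : (ℝ × Plane) × (SpXX × M) =>
      φ r.2 * cis (D.kernelPhase L₁ L₂ 0 (ω, 0) (ω, 0) r.1 r.2) := hφ.mul (measurable_cis.comp hc)
  exact (StronglyMeasurable.integral_prod_right' (ν := (volume : Measure (SpXX × M)))
    h.stronglyMeasurable).measurable

namespace Admissible

variable (hD : D.Admissible)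
include hD

lemma integrable_kernelZero (φ : 𝓢(SpXX × M, ℂ)) (ω : ℝ) :
    Integrable (D.kernelZero L₁ L₂ φ ω) := by
  obtain ⟨C, hC0, hC⟩ := hD.exists_norm_kernel_le L₁ L₂ |ω| φ
  have i1 : Integrable fun ν : ℝ => (1 + ‖ν‖) ^ (-2 : ℝ) :=
    integrable_one_add_norm (by simp)
  have i2 : Integrable fun ξ : Plane => (1 + ‖ξ‖) ^ (-3 : ℝ) :=
    integrable_one_add_norm (by simp; norm_num)
  exact ((i1.mul_prod i2).const_mul C).mono' (measurable_kernelZero φ ω).aestronglyMeasurable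
    (Eventually.of_forall fun y => hC 0 _ _ y (by simp) le_rfl le_rfl)

/-- The test function on the support of the Dirac masses decays in all of the remaining variables:
the direction `p` is controlled by `ȳ = z_int c₀ A₀ p`. -/
lemma exists_bound_diracTest_integrand (φ : 𝓢(SpXX × M, ℂ)) :
    ∃ B : Plane × Plane × M → ℝ, Integrable B ∧ (∃ b : Plane × M → ℝ, Integrable b ∧
      ∀ p m, B (p, m) ≤ b m) ∧
      ∀ p m, ‖φ ((D.sDirac p, D.yDirac p, m.1), m.2)‖ ≤ B (p, m) := by
  set N := Module.finrank ℝ (Plane × Plane × M) + 1 with hN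
  obtain ⟨C, hC0, hC⟩ := φ.exists_norm_le_one_add_rpow N
  set c := 1 + ‖D.paraxialInv‖ with hc
  have hc1 : 1 ≤ c := le_add_of_nonneg_right (norm_nonneg _)
  have hlow : ∀ (p : Plane) (m : Plane × M),
      (1 + ‖(p, m)‖) ≤ c * (1 + ‖((D.sDirac p, D.yDirac p, m.1), m.2)‖) := by
    intro p m
    set w : SpXX × M := ((D.sDirac p, D.yDirac p, m.1), m.2) with hw
    have h1 : ‖p‖ ≤ c * ‖w‖ := by
      have e : p = D.paraxialInv (D.yDirac p) := by rw [yDirac_eq, hD.paraxialInv_paraxial]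
      calc ‖p‖ ≤ ‖D.paraxialInv‖ * ‖D.yDirac p‖ := by
            nth_rw 1 [e]; exact D.paraxialInv.le_opNorm _
        _ ≤ c * ‖w‖ := by
            gcongr
            · rw [hc]; linarith
            · exact ((norm_fst_le _).trans (norm_snd_le _)).trans (norm_fst_le w)
    have h2 : ‖m‖ ≤ ‖w‖ := by
      refine norm_prod_le_iff.2 ⟨?_, norm_snd_le w⟩
      exact ((norm_snd_le w.1.2).trans (norm_snd_le w.1)).trans (norm_fst_le w)
    have h3 : ‖(p, m)‖ ≤ c * ‖w‖ := by
      refine norm_prod_le_iff.2 ⟨h1, h2.trans ?_⟩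
      exact le_mul_of_one_le_left (norm_nonneg _) hc1
    linarith
  refine ⟨fun r => C * c ^ (N : ℝ) * (1 + ‖r‖) ^ (-(N : ℝ)), ?_,
    ⟨fun m => C * c ^ (N : ℝ) * (1 + ‖m‖) ^ (-(N : ℝ)), ?_, fun p m => ?_⟩, fun p m => ?_⟩
  · exact (integrable_one_add_norm (by rw [hN]; push_cast; linarith)).const_mul _
  · refine (integrable_one_add_norm ?_).const_mul _
    rw [hN, show Module.finrank ℝ (Plane × Plane × M) = Module.finrank ℝ Plane +
      Module.finrank ℝ (Plane × M) from Module.finrank_prod]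
    push_cast
    have : (0 : ℝ) ≤ Module.finrank ℝ Plane := by positivity
    linarith
  · simp only
    gcongr ?_ * ?_
    exact Real.rpow_le_rpow_of_nonpos (by positivity)
      (by gcongr; exact norm_snd_le (p, m)) (by simp)
  · refine (hC _).trans ?_
    simp only
    rw [mul_assoc]
    gcongr
    rw [Real.rpow_neg (by positivity), Real.rpow_neg (by positivity), ← div_eq_mul_inv,
      le_div_iff₀ (by positivity), inv_mul_le_iff₀ (by positivity),
      ← Real.mul_rpow (by positivity) (by positivity)]
    gcongr
    rw [mul_comm]
    exact hlow p m

lemma continuous_diracTest_integrand (φ : 𝓢(SpXX × M, ℂ)) (ω : ℝ) :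
    Continuous fun r : Plane × Plane × M => cis (-(ω * (((L₁ r.2.2).1 - (L₂ r.2.2).1) -
      inner ℝ r.1 ((L₁ r.2.2).2 - (L₂ r.2.2).2)))) *
        φ ((D.sDirac r.1, D.yDirac r.1, r.2.1), r.2.2) := by
  have := φ.continuous
  simp only [yDirac_eq, sDirac_eq]
  fun_prop

lemma integrable_diracTest_integrand (φ : 𝓢(SpXX × M, ℂ)) (ω : ℝ) :
    Integrable fun r : Plane × Plane × M => cis (-(ω * (((L₁ r.2.2).1 - (L₂ r.2.2).1) -
      inner ℝ r.1 ((L₁ r.2.2).2 - (L₂ r.2.2).2)))) *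
        φ ((D.sDirac r.1, D.yDirac r.1, r.2.1), r.2.2) := by
  have : ProperSpace M := FiniteDimensional.proper_real M
  obtain ⟨B, hB, -, hφ⟩ := hD.exists_bound_diracTest_integrand φ
  refine hB.mono' (hD.continuous_diracTest_integrand φ ω).aestronglyMeasurable
    (Eventually.of_forall fun r => ?_)
  rw [norm_mul, norm_cis, one_mul]
  exact hφ r.1 r.2

lemma continuous_diracTest (φ : 𝓢(SpXX × M, ℂ)) (ω : ℝ) :
    Continuous (D.diracTest L₁ L₂ φ ω) := by
  have : ProperSpace M := FiniteDimensional.proper_real M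
  obtain ⟨B, -, ⟨b, hb, hBb⟩, hφ⟩ := hD.exists_bound_diracTest_integrand φ
  have hc := hD.continuous_diracTest_integrand (L₁ := L₁) (L₂ := L₂) φ ω
  refine continuous_of_dominated (bound := b) (fun p => ?_)
    (fun p => Eventually.of_forall fun m => ?_) hb (Eventually.of_forall fun m => ?_)
  · have h := hc.comp (by fun_prop : Continuous fun m : Plane × M => (p, m))
    simp only [Function.comp_def] at h
    exact h.aestronglyMeasurable
  · rw [norm_mul, norm_cis, one_mul]
    exact (hφ p m).trans (hBb p m)
  · have h := hc.comp (by fun_prop : Continuous fun p : Plane => (p, m))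
    simp only [Function.comp_def] at h
    exact h

lemma integrable_diracTest (φ : 𝓢(SpXX × M, ℂ)) (ω : ℝ) :
    Integrable (D.diracTest L₁ L₂ φ ω) :=
  have : ProperSpace M := FiniteDimensional.proper_real M
  (hD.integrable_diracTest_integrand φ ω).integral_prod_left

end Admissible
end Setup

namespace Setup

variable {D : Setup} {M : Type*} [NormedAddCommGroup M] [NormedSpace ℝ M] [FiniteDimensional ℝ M]
  [MeasureSpace M] [BorelSpace M] [(volume : Measure M).IsAddHaarMeasure]
  {L₁ L₂ : M →L[ℝ] SpX}

/-- The integral over `SpXX × M`, with the variable `s̄` separated from the others. -/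
lemma integral_split (f : SpXX × M → ℂ) :
    ∫ w, f w = ∫ z : ((Plane × Plane) × M) × ℝ, f ((z.2, z.1.1), z.1.2)
      ∂((volume : Measure ((Plane × Plane) × M)).prod volume) := by
  have : ProperSpace M := FiniteDimensional.proper_real M
  have h1 : MeasurePreserving (MeasurableEquiv.prodComm : ((Plane × Plane) × M) × ℝ ≃ᵐ _)
      ((volume : Measure ((Plane × Plane) × M)).prod volume) (volume.prod volume) :=
    Measure.measurePreserving_swap
  have h2 : MeasurePreserving
      (MeasurableEquiv.prodAssoc.symm : ℝ × ((Plane × Plane) × M) ≃ᵐ SpXX × M)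
      (volume.prod volume) volume := volume_preserving_prodAssoc.symm
  rw [← h2.integral_comp' f, ← h1.integral_comp']
  rfl

namespace Admissible

variable (hD : D.Admissible)
include hD

/-- Integrating the limit kernel over `ν` and changing variables `ȳ = z_int c₀ A₀ p` yields the
Fourier transform of `diracTest`. -/
lemma integral_kernelZero (φ : 𝓢(SpXX × M, ℂ)) (ω : ℝ) (ξ : Plane) :
    ∫ ν : ℝ, D.kernelZero L₁ L₂ φ ω (ν, ξ) =
      2 * Real.pi * ((D.paraxial.toLinearMap.det : ℂ) *
        ∫ p, cis (-inner ℝ ξ p) * D.diracTest L₁ L₂ φ ω p) := by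
  have : ProperSpace M := FiniteDimensional.proper_real M
  set r : (Plane × Plane) × M → ℂ := fun q => cis (-(ω * ((L₁ q.2).1 - (L₂ q.2).1)) +
    inner ℝ q.1.1 (D.paraxialInv (ω • (L₁ q.2).2 - ω • (L₂ q.2).2 - ξ))) with hr
  set F : ((Plane × Plane) × M) × ℝ → ℂ := fun z => φ ((z.2, z.1.1), z.1.2) * r z.1 with hF
  set h : (Plane × Plane) × M → ℝ := fun q => inner ℝ q.1.1 (D.paraxialInv q.1.1) / 2 with hh
  have hrc : Continuous r := by simp only [hr]; fun_prop
  have hhc : Continuous h := by simp only [hh]; fun_prop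
  have hφc := φ.continuous
  have hFc : Continuous F := by simp only [hF]; fun_prop
  have hFn : ∀ z, ‖F z‖ = ‖φ ((z.2, z.1.1), z.1.2)‖ := fun z => by simp [hF, hr]
  set N := Module.finrank ℝ ((Plane × Plane) × M) + 1 with hN
  obtain ⟨C, hC0, hC⟩ := φ.exists_norm_le_one_add_rpow N
  set B : (Plane × Plane) × M → ℝ := fun q => C * (1 + ‖q‖) ^ (-(N : ℝ)) with hB
  have hBi : Integrable B :=
    (integrable_one_add_norm (by rw [hN]; push_cast; linarith)).const_mul _
  have hFB : ∀ q s, ‖F (q, s)‖ ≤ B q := fun q s => by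
    rw [hFn]
    refine (hC _).trans (mul_le_mul_of_nonneg_left ?_ hC0)
    refine Real.rpow_le_rpow_of_nonpos (by positivity) ?_ (by simp)
    gcongr
    exact norm_prod_le_iff.2 ⟨(norm_snd_le (s, q.1)).trans (norm_fst_le ((s, q.1), q.2)),
      norm_snd_le ((s, q.1), q.2)⟩
  have hK : ∀ ν : ℝ, D.kernelZero L₁ L₂ φ ω (ν, ξ) =
      ∫ z, F z * cis (ν * (h z.1 - z.2)) ∂((volume : Measure ((Plane × Plane) × M)).prod volume) := by
    intro ν
    rw [kernelZero, kernel, integral_split]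
    congr 1; ext z
    simp only [hF, hr, kernelPhase]
    rw [mul_assoc, ← cis_add]
    congr 2
    simp only [hh, zero_smul, add_zero]
    ring
  have hFi : Integrable F ((volume : Measure ((Plane × Plane) × M)).prod volume) := by
    have h1 : MeasurePreserving (MeasurableEquiv.prodComm : ((Plane × Plane) × M) × ℝ ≃ᵐ _)
        ((volume : Measure ((Plane × Plane) × M)).prod volume) (volume.prod volume) :=
      Measure.measurePreserving_swap
    have h2 : MeasurePreserving
        (MeasurableEquiv.prodAssoc.symm : ℝ × ((Plane × Plane) × M) ≃ᵐ SpXX × M)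
        (volume.prod volume) volume := volume_preserving_prodAssoc.symm
    refine ((h2.comp h1).integrable_comp_of_integrable φ.integrable).norm.mono'
      hFc.aestronglyMeasurable (Eventually.of_forall fun z => (hFn z).le)
  have hKi : Integrable fun ν : ℝ => D.kernelZero L₁ L₂ φ ω (ν, ξ) := by
    obtain ⟨C', -, hC'⟩ := hD.exists_norm_kernel_le L₁ L₂ |ω| φ
    have i1 : Integrable fun ν : ℝ => (1 + ‖ν‖) ^ (-2 : ℝ) :=
      integrable_one_add_norm (by simp)
    exact ((i1.mul_const ((1 + ‖ξ‖) ^ (-3 : ℝ))).const_mul C').mono'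
      ((measurable_kernelZero φ ω).comp measurable_prodMk_right).aestronglyMeasurable
      (Eventually.of_forall fun ν => hC' 0 _ _ (ν, ξ) (by simp) le_rfl le_rfl)
  simp only [hK] at hKi ⊢
  rw [integral_cis_sub_eq hFi hFc.stronglyMeasurable
    (fun q => hFc.comp (by fun_prop : Continuous fun s : ℝ => (q, s))) hBi hFB hhc.measurable hKi]
  congr 1
  have h3 : MeasurePreserving
      (MeasurableEquiv.prodAssoc.symm : Plane × (Plane × M) ≃ᵐ (Plane × Plane) × M)
      (volume.prod volume) volume := volume_preserving_prodAssoc.symm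
  have hFh : Integrable fun q => F (q, h q) :=
    hBi.mono' (hFc.comp (continuous_id.prodMk hhc)).aestronglyMeasurable
      (Eventually.of_forall fun q => hFB q _)
  have hFh' := h3.integrable_comp_of_integrable hFh
  rw [← h3.integral_comp']
  refine (integral_prod _ hFh').trans ?_
  rw [integral_comp_linear volume D.paraxial hD.det_paraxial_pos]
  congr 2; ext p
  rw [diracTest, ← integral_const_mul]
  congr 1; ext m
  have e1 : ∀ u : Plane, inner ℝ (D.paraxial p) (D.paraxialInv u) = inner ℝ p u := fun u => by
    rw [← hD.paraxial_symm, hD.paraxial_paraxialInv]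
  change φ ((inner ℝ (D.paraxial p) (D.paraxialInv (D.paraxial p)) / 2, D.paraxial p, m.1), m.2) *
    cis (-(ω * ((L₁ m.2).1 - (L₂ m.2).1)) +
      inner ℝ (D.paraxial p) (D.paraxialInv (ω • (L₁ m.2).2 - ω • (L₂ m.2).2 - ξ))) = _
  rw [e1, e1, yDirac_eq, sDirac_eq, ← mul_assoc, ← cis_add, mul_comm]
  congr 2
  rw [inner_sub_right, ← smul_sub, inner_smul_right, real_inner_comm p ξ]
  ring

lemma integrable_fourier_diracTest (φ : 𝓢(SpXX × M, ℂ)) (ω : ℝ) :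
    Integrable fun ξ => ∫ p, cis (-inner ℝ ξ p) * D.diracTest L₁ L₂ φ ω p := by
  have h := hD.integrable_kernelZero (L₁ := L₁) (L₂ := L₂) φ ω
  rw [Measure.volume_eq_prod] at h
  have h2 := h.integral_prod_right.const_mul
    ((2 * Real.pi * (D.paraxial.toLinearMap.det : ℂ))⁻¹)
  refine h2.congr (Eventually.of_forall fun ξ => ?_)
  have hne : (2 * Real.pi * (D.paraxial.toLinearMap.det : ℂ)) ≠ 0 := by
    have h1 := hD.det_paraxial_pos.ne'
    have h2 := Real.pi_ne_zero
    exact mul_ne_zero (mul_ne_zero two_ne_zero (by exact_mod_cast h2)) (by exact_mod_cast h1)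
  simp only [hD.integral_kernelZero]
  rw [← mul_assoc (2 * (Real.pi : ℂ)), ← mul_assoc, inv_mul_cancel₀ hne, one_mul]

lemma norm_sq_waveAmp {ω : ℝ} (hω : ω ≠ 0) :
    ‖D.waveAmp ω‖ ^ 2 = ω ^ 6 / ((2 * Real.pi) ^ 2 * D.paraxial.toLinearMap.det) := by
  have hd := hD.det_paraxial_pos
  rw [waveAmp, norm_mul, mul_pow, fresnelAmp, norm_div, Complex.norm_real, norm_mul, norm_mul,
    norm_mul, Complex.norm_real, Complex.norm_real, Complex.norm_I, Complex.norm_real, div_pow,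
    mul_pow _ ‖√_‖, Real.norm_eq_abs, Real.norm_eq_abs, Real.norm_eq_abs, Real.norm_eq_abs, sq_abs,
    sq_abs (√_), Real.sq_sqrt hd.le, one_mul, sq_abs,
    abs_of_pos Real.pi_pos, Complex.norm_ofNat]
  have hpi := Real.pi_ne_zero
  field_simp

lemma integral_norm_sq_source {ω : ℝ} (hω : ω ≠ 0) :
    ∫ X, ‖D.source (ω, X)‖ ^ 2 =
      (2 * Real.pi) ^ 2 * (ω ^ 2 * D.hatΨSq ω) / D.paraxial.toLinearMap.det := by
  have hd := hD.det_paraxial_pos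
  have hpi := Real.pi_ne_zero
  have e : ∀ X, ‖D.source (ω, X)‖ ^ 2 = ‖D.waveAmp ω‖ ^ 2 * ‖D.incident ω X‖ ^ 2 := fun X => by
    rw [source, norm_mul, norm_cis, mul_one, norm_mul, mul_pow]
  simp only [e]
  rw [integral_const_mul, hD.integral_norm_sq_incident hω, hD.norm_sq_waveAmp hω, hatΨSq]
  field_simp

end Admissible

section Random

variable {Ω : Type*} [MeasurableSpace Ω] {P : Measure Ω} [IsProbabilityMeasure P]
  {V : Plane → Ω → ℝ}

lemma measurable_fieldCorr_uncurry (hV : IsInterfaceField P V) :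
    Measurable fun r : ℝ × Plane => fieldCorr P V r.1 r.2 := by
  have h1 : Measurable fun q : (ℝ × Plane) × Ω => V q.1.2 q.2 :=
    hV.measurable_comp (by fun_prop) (by fun_prop)
  have h2 : Measurable fun q : (ℝ × Plane) × Ω => V 0 q.2 :=
    hV.measurable_comp (by fun_prop) (by fun_prop)
  have h3 : Measurable fun q : (ℝ × Plane) × Ω => cis (q.1.1 * (V q.1.2 q.2 - V 0 q.2)) :=
    measurable_cis.comp (measurable_fst.fst.mul (h1.sub h2))
  exact (StronglyMeasurable.integral_prod_right' (ν := P) h3.stronglyMeasurable).measurable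

namespace Admissible

variable (hD : D.Admissible)
include hD

/-- The substitution `ξ = ω y'` recovers the Fourier transform that defines the scattering
distribution. -/
lemma integral_kernelZero_mul_fieldCorr (hV : IsInterfaceField P V) (φ : 𝓢(SpXX × M, ℂ)) {ω : ℝ}
    (hω : ω ≠ 0) :
    ∫ y : ℝ × Plane, D.kernelZero L₁ L₂ φ ω y * fieldCorr P V (ω * (2 * D.s₀)) (ω⁻¹ • y.2) =
      2 * Real.pi * (D.paraxial.toLinearMap.det : ℂ) * (ω : ℂ) ^ 2 *
        ∫ p, D.diracTest L₁ L₂ φ ω p ∂(scatteringDistribution P V (2 * D.s₀) ω) := by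
  have hcm : Measurable fun y : ℝ × Plane => fieldCorr P V (ω * (2 * D.s₀)) (ω⁻¹ • y.2) :=
    (measurable_fieldCorr_uncurry hV).comp
      (by fun_prop : Measurable fun y : ℝ × Plane => (ω * (2 * D.s₀), ω⁻¹ • y.2))
  have hi : Integrable fun y : ℝ × Plane =>
      D.kernelZero L₁ L₂ φ ω y * fieldCorr P V (ω * (2 * D.s₀)) (ω⁻¹ • y.2) :=
    (hD.integrable_kernelZero φ ω).mul_bdd (c := 1) hcm.aestronglyMeasurable
      (Eventually.of_forall fun y => norm_fieldCorr_le _ _)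
  rw [integral_scatteringDistribution hV _ hω (hD.continuous_diracTest φ ω)
    (hD.integrable_diracTest φ ω) (hD.integrable_fourier_diracTest φ ω)]
  rw [Measure.volume_eq_prod] at hi ⊢
  rw [integral_prod_symm _ hi]
  simp only [integral_mul_const, hD.integral_kernelZero]
  -- the substitution `ξ = ω y'`
  have h := Measure.integral_comp_smul (volume : Measure Plane) (fun ξ : Plane =>
    2 * (Real.pi : ℂ) * ((D.paraxial.toLinearMap.det : ℂ) *
        ∫ p, cis (-inner ℝ ξ p) * D.diracTest L₁ L₂ φ ω p) *
      fieldCorr P V (ω * (2 * D.s₀)) (ω⁻¹ • ξ)) ω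
  have hfin : Module.finrank ℝ Plane = 2 := by simp
  rw [hfin, abs_of_nonneg (by positivity), eq_inv_smul_iff₀ (by positivity)] at h
  rw [← h, Complex.real_smul, ← integral_const_mul, ← integral_const_mul]
  congr 1; ext y
  have e : ∀ p : Plane, -inner ℝ (ω • y) p = -(ω * inner ℝ p y) := fun p => by
    rw [inner_smul_left, real_inner_comm]; rfl
  simp only [e]
  rw [smul_smul, inv_mul_cancel₀ hω, one_smul]
  push_cast
  ring

lemma momentLimit_eq (hV : IsInterfaceField P V) (φ : 𝓢(SpXX × M, ℂ)) :
    D.momentLimit P V L₁ L₂ φ = (((2 * Real.pi) ^ 3 : ℝ) : ℂ) *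
      ∫ ω : ℝ, ((ω ^ 2 * D.hatΨSq ω : ℝ) : ℂ) *
        ∫ p, D.diracTest L₁ L₂ φ ω p ∂(scatteringDistribution P V (2 * D.s₀) ω) := by
  obtain ⟨b, hb, hbound⟩ := hD.exists_norm_kernelAmp_le L₁ L₂ φ
  have hcm : Measurable fun z : (ℝ × Plane) × (ℝ × Plane) =>
      fieldCorr P V (z.1.1 * (2 * D.s₀)) (z.1.1⁻¹ • z.2.2) :=
    (measurable_fieldCorr_uncurry hV).comp
      (by fun_prop : Measurable fun z : (ℝ × Plane) × (ℝ × Plane) =>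
        (z.1.1 * (2 * D.s₀), z.1.1⁻¹ • z.2.2))
  have hi : Integrable fun z : (ℝ × Plane) × (ℝ × Plane) =>
      D.kernelAmp L₁ L₂ φ 0 z * fieldCorr P V (z.1.1 * (2 * D.s₀)) (z.1.1⁻¹ • z.2.2) :=
    (hb.mono' (hD.measurable_kernelAmp φ 0).aestronglyMeasurable
      (Eventually.of_forall (hbound 0 (by simp)))).mul_bdd (c := 1) hcm.aestronglyMeasurable
      (Eventually.of_forall fun z => norm_fieldCorr_le _ _)
  set I : ℝ → ℂ := fun ω =>
    ∫ p, D.diracTest L₁ L₂ φ ω p ∂(scatteringDistribution P V (2 * D.s₀) ω) with hI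
  set Δ : ℝ := D.paraxial.toLinearMap.det with hΔ
  have hΔ0 : 0 < Δ := hD.det_paraxial_pos
  have hne : ∀ᵐ s : ℝ, s ≠ 0 := by simp [ae_iff]
  have h1 : ∀ᵐ z : ℝ × Plane, ∫ y : ℝ × Plane, D.kernelAmp L₁ L₂ φ 0 (z, y) *
      fieldCorr P V (z.1 * (2 * D.s₀)) (z.1⁻¹ • y.2) =
      ((2 * Real.pi * Δ * ‖D.source z‖ ^ 2 : ℝ) : ℂ) * I z.1 := by
    have hz : ∀ᵐ z : ℝ × Plane, z.1 ≠ 0 := Measure.quasiMeasurePreserving_fst.ae hne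
    filter_upwards [hz] with z hz
    have e : ∀ y, D.kernelAmp L₁ L₂ φ 0 (z, y) = _ := fun y =>
      kernelAmp_zero (D := D) (L₁ := L₁) (L₂ := L₂) φ (z := (z, y)) hz
    simp only [e, mul_assoc]
    rw [integral_const_mul, hD.integral_kernelZero_mul_fieldCorr hV φ hz]
    simp only [hI, hΔ]
    push_cast
    have : (z.1 : ℂ) ≠ 0 := by exact_mod_cast hz
    field_simp
  rw [Measure.volume_eq_prod] at hi
  have hi1 := hi.integral_prod_left.congr h1
  rw [momentLimit, Measure.volume_eq_prod, integral_prod _ hi, integral_congr_ae h1]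
  rw [Measure.volume_eq_prod] at hi1 ⊢
  rw [integral_prod _ hi1, ← integral_const_mul]
  refine integral_congr_ae (hne.mono fun ω hω => ?_)
  simp only
  have e : 2 * Real.pi * Δ * ((2 * Real.pi) ^ 2 * (ω ^ 2 * D.hatΨSq ω) / Δ) =
      (2 * Real.pi) ^ 3 * (ω ^ 2 * D.hatΨSq ω) := by
    field_simp
  rw [integral_mul_const, integral_complex_ofReal, integral_const_mul,
    hD.integral_norm_sq_source hω, e, Complex.ofReal_mul, mul_assoc]

end Admissible
end Random
end Setup

/-! ### Convergence of the speckle correlations -/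

namespace Setup

variable {D : Setup} {M : Type*} [NormedAddCommGroup M] [NormedSpace ℝ M] [FiniteDimensional ℝ M]
  [MeasureSpace M] [BorelSpace M] [(volume : Measure M).IsAddHaarMeasure]
  {L₁ L₂ : M →L[ℝ] SpX} {Ω : Type*} [MeasurableSpace Ω] {P : Measure Ω} [IsProbabilityMeasure P]
  {V : Plane → Ω → ℝ}

namespace Admissible

variable (hD : D.Admissible)
include hD

/-- The scale parameter `η = ε ^ (γ - 1/2)` tends to zero. -/
lemma tendsto_scale : Tendsto (fun ε : ℝ => ε ^ (D.γ - 1 / 2)) (𝓝[>] 0) (𝓝[>] 0) := by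
  have hpos : 0 < D.γ - 1 / 2 := by linarith [hD.γ_gt]
  refine tendsto_nhdsWithin_iff.2 ⟨?_, ?_⟩
  · have h := Real.continuousAt_rpow_const 0 (D.γ - 1 / 2) (Or.inr hpos.le)
    rw [ContinuousAt, Real.zero_rpow hpos.ne'] at h
    exact h.mono_left nhdsWithin_le_nhds
  · filter_upwards [self_mem_nhdsWithin] with ε hε using Real.rpow_pos_of_pos hε _

lemma speckle_mul_speckle {U : Plane → ℝ} (hU : Continuous U) {ε : ℝ} (hε : 0 < ε) (a : SpXX)
    (b₁ b₂ : SpX) : D.speckle U ε a b₁ * D.speckle U ε a b₂ =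
      (((D.refl / (2 * (2 * Real.pi) ^ 3)) ^ 2 : ℝ) : ℂ) *
        ((((ε ^ (D.γ - 1 / 2)) ^ 4)⁻¹ : ℝ) : ℂ) *
        (D.speckleInt U (ε ^ (D.γ - 1 / 2)) ((ε ^ D.γ)⁻¹ • D.xint) a b₁ *
          conj (D.speckleInt U (ε ^ (D.γ - 1 / 2)) ((ε ^ D.γ)⁻¹ • D.xint) a b₂)) := by
  rw [hD.speckle_eq hU hε, hD.speckle_eq hU hε, hD.conj_speckleInt]
  push_cast
  ring

lemma conj_speckle {U : Plane → ℝ} (hU : Continuous U) {ε : ℝ} (hε : 0 < ε) (a : SpXX) (b : SpX) :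
    conj (D.speckle U ε a b) = D.speckle U ε a b := by
  rw [hD.speckle_eq hU hε, map_mul, map_mul, hD.conj_speckleInt, Complex.conj_ofReal,
    Complex.conj_ofReal]

/-- Pairings with a family of functions which are, for each interface, products of two speckle
profiles: they exist, are random variables, and converge in probability. -/
lemma pairing_convergence (hV : IsInterfaceField P V) (φ : 𝓢(SpXX × M, ℂ))
    {f : (Plane → ℝ) → ℝ → SpXX × M → ℂ} (hf : ∀ U, Continuous U → ∀ ε > 0, ∀ w,
      f U ε w = D.speckle U ε w.1 (L₁ w.2) * D.speckle U ε w.1 (L₂ w.2)) :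
    (∀ ε > 0, (∀ θ, Integrable fun w => f (fun x => V x θ) ε w * φ w) ∧
      AEStronglyMeasurable (fun θ => ∫ w, f (fun x => V x θ) ε w * φ w) P) ∧
    TendstoInMeasure P (fun (ε : ℝ) θ => ∫ w, f (fun x => V x θ) ε w * φ w) (𝓝[>] 0)
      (fun _ => ((D.refl ^ 2 / (4 * (2 * Real.pi) ^ 3) : ℝ) : ℂ) *
        ∫ ω : ℝ, ((ω ^ 2 * D.hatΨSq ω : ℝ) : ℂ) *
          ∫ p, D.diracTest L₁ L₂ φ ω p ∂(scatteringDistribution P V (2 * D.s₀) ω)) := by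
  set c : ℂ := (((D.refl / (2 * (2 * Real.pi) ^ 3)) ^ 2 : ℝ) : ℂ) with hc
  have e : ∀ ε > 0, ∀ θ w, f (fun x => V x θ) ε w * φ w =
      c * ((((ε ^ (D.γ - 1 / 2)) ^ 4)⁻¹ : ℝ) : ℂ) *
        (D.speckleInt (fun x => V x θ) (ε ^ (D.γ - 1 / 2)) ((ε ^ D.γ)⁻¹ • D.xint) w.1 (L₁ w.2) *
          conj (D.speckleInt (fun x => V x θ) (ε ^ (D.γ - 1 / 2)) ((ε ^ D.γ)⁻¹ • D.xint) w.1
            (L₂ w.2)) * φ w) := fun ε hε θ w => by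
    rw [hf _ (hV.continuous θ) ε hε, hD.speckle_mul_speckle (hV.continuous θ) hε]
    ring
  have e' : ∀ ε > 0, ∀ θ, ∫ w, f (fun x => V x θ) ε w * φ w =
      c * ((((ε ^ (D.γ - 1 / 2)) ^ 4)⁻¹ : ℝ) : ℂ) *
        D.speckleMoment L₁ L₂ φ (fun x => V x θ) (ε ^ (D.γ - 1 / 2)) ((ε ^ D.γ)⁻¹ • D.xint) :=
    fun ε hε θ => by
      simp only [e ε hε θ]
      rw [integral_const_mul, speckleMoment]
  refine ⟨fun ε hε => ⟨fun θ => ?_, ?_⟩, ?_⟩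
  · simp only [e ε hε θ]
    exact (hD.integrable_moment_integrand hV φ _ _ θ).const_mul _
  · simp only [e' ε hε]
    exact ((hD.stronglyMeasurable_speckleMoment hV φ _ _).const_mul _).aestronglyMeasurable
  · have h := hD.tendstoInMeasure_speckleMoment (L₁ := L₁) (L₂ := L₂) hV hD.tendsto_scale
      (fun ε : ℝ => (ε ^ D.γ)⁻¹ • D.xint) φ c
    have hlim : c * D.momentLimit P V L₁ L₂ φ = ((D.refl ^ 2 / (4 * (2 * Real.pi) ^ 3) : ℝ) : ℂ) *
        ∫ ω : ℝ, ((ω ^ 2 * D.hatΨSq ω : ℝ) : ℂ) *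
          ∫ p, D.diracTest L₁ L₂ φ ω p ∂(scatteringDistribution P V (2 * D.s₀) ω) := by
      rw [hD.momentLimit_eq hV, ← mul_assoc, hc, ← Complex.ofReal_mul]
      congr 2
      have := Real.pi_ne_zero
      field_simp
      ring
    rw [hlim] at h
    refine h.congr' ?_ (Eventually.of_forall fun _ => rfl)
    filter_upwards [self_mem_nhdsWithin] with ε hε
    exact Eventually.of_forall fun θ => (e' ε hε θ).symm

end Admissible
end Setup

theorem mainTheorem3 {Ω : Type*} [MeasurableSpace Ω] (P : Measure Ω) [IsProbabilityMeasure P]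
    (V : Plane → Ω → ℝ) (hV : IsInterfaceField P V) (D : Setup) (hD : D.Admissible) :
    -- the reflected wave and the scattering distribution are well defined
    (∀ ε > 0, ∀ θ, D.ReflWellDefined (fun x => V x θ) ε) ∧
    (∀ ω ≠ 0, IsScatteringDistribution P V (2 * D.s₀) ω
      (scatteringDistribution P V (2 * D.s₀) ω)) ∧
    -- convergence in probability of the correlation function in the space of tempered distributions
    (∀ φ : 𝓢(SpXX × SpX × SpX, ℂ),
      (∀ ε > 0, (∀ θ, Integrable fun w => D.corr (fun x => V x θ) ε w * φ w) ∧
        AEStronglyMeasurable (fun θ => D.corrPairing (fun x => V x θ) ε φ) P) ∧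
      TendstoInMeasure P (fun (ε : ℝ) θ => D.corrPairing (fun x => V x θ) ε φ) (𝓝[>] 0)
        (fun _ => D.corrLimit P V φ)) ∧
    -- convergence in probability of the intensity in the space of tempered distributions
    (∀ φ : 𝓢(SpXX × SpX, ℂ),
      (∀ ε > 0, (∀ θ, Integrable fun w => (D.intensity (fun x => V x θ) ε w : ℂ) * φ w) ∧
        AEStronglyMeasurable (fun θ => D.intensityPairing (fun x => V x θ) ε φ) P) ∧
      TendstoInMeasure P (fun (ε : ℝ) θ => D.intensityPairing (fun x => V x θ) ε φ) (𝓝[>] 0)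
        (fun _ => D.intensityLimit P V φ)) := by
  refine ⟨fun ε hε θ => hD.reflWellDefined (hV.continuous θ) hε,
    fun ω hω => isScatteringDistribution_scatteringDistribution hV _ hω, fun φ => ?_, fun φ => ?_⟩
  · exact hD.pairing_convergence (L₁ := ContinuousLinearMap.fst ℝ SpX SpX)
      (L₂ := ContinuousLinearMap.snd ℝ SpX SpX) hV φ
      (f := fun U ε w => D.corr U ε w) (fun U hU ε hε w => rfl)
  · have h := hD.pairing_convergence (L₁ := ContinuousLinearMap.id ℝ SpX)
      (L₂ := ContinuousLinearMap.id ℝ SpX) hV φ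
      (f := fun U ε w => (D.intensity U ε w : ℂ)) (fun U hU ε hε w => by
        rw [Setup.intensity, ContinuousLinearMap.id_apply]
        nth_rw 3 [← hD.conj_speckle hU hε]
        rw [Complex.mul_conj, Complex.normSq_eq_norm_sq])
    simp only [Setup.diracTest, ContinuousLinearMap.id_apply, sub_self, inner_zero_right,
      mul_zero, neg_zero, cis_zero, one_mul] at h
    exact h
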